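/- **Mac Lane type theory.** Mac Lane set theory (MC) has the axioms of extensionality, empty set, pairing, union, power set, infinity and choice, and the separation scheme for bounded ($\Delta_0$) formulas of set theory; it has neither foundation nor replacement. Mac Lane type theory (MTT) has the types Set, Class (of sets), Collection (of classes) and product types $\tau_1\times\dots\times\tau_n$ (whose objects have $n$-tuples of objects of types $\tau_1,\dots,\tau_n$ as members). Its axioms are those of MC for sets, and comprehension: for every *set theoretic* formula $\Psi$ (variables of all types, but quantifiers over sets only) there is a class, a collection or an object of product type $\{\langle v_1,\dots,v_n\rangle \mid \Psi(v_1,\dots,v_n)\}$. A statement holds *in MTT* if it is true in every (Henkin) model of these axioms; by the completeness theorem, this means that it is provable in MTT. **Categories in MTT.** A *small category* is a 5-tuple of sets $\langle C_0,C_1,d_0,d_1,m\rangle$ (objects, arrows, domain, codomain, composition) satisfying the category axioms; a *class category* is a 5-tuple of classes satisfying them. A *presheaf* on a small category $C$ is a set $F_0$ with a function $\gamma:F_0\to C_0$ and a functorial action $e$ of the arrows of $C$, where $e\langle s,f\rangle$ is defined for $\gamma(s)=\operatorname{cod} f$ and lies over $\operatorname{dom} f$; a transformation of presheaves is a function over $C_0$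 that commutes with the actions. A *small site* is a small category $C$ with a Grothendieck topology $J$ (a set); a presheaf is a *sheaf* if for every cover $S$ of an object $A$ every compatible family (a set) of elements over $S$ comes from exactly one element over $A$. The sheaves on $\langle C,J\rangle$ and their transformations form the category $\widetilde{C}_J$. A *class Grothendieck topos* is a class category $\mathcal E$ that is equivalent to $\widetilde C_J$ for some small site $\langle C,J\rangle$, the equivalence being given by two functors and two natural isomorphisms that are classes. **Elementary toposes.** The *elementary theory of toposes* is the first-order theory, in the language with a sort of objects, a sort of arrows, and the relations of domain, codomain and composition, whose axioms are the category axioms and the existence of a terminal object, of pullbacks, of an exponential of any two objects, and of a subobject classifier. **Theorem.** In MTT, every class Grothendieck topos $\mathcal E$ satisfies the elementary topos axioms: it has finite limits, exponentials and a subobject classifier. Hence every theorem of elementary topos theory, that is, every first-order sentence $\varphi$ in the language of categories that follows from the elementary theory of toposes, is true in $\mathcal E$. -/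

import Mathlib

/-!
Mac Lane type theory (MTT), its models, class categories and sheaves on small sites inside a model,
and the first-order theory of elementary toposes.

MTT is a (many-sorted) first-order theory.  A statement is treated as a theorem of MTT when it holds
in every model of the axioms; models are Henkin style, i.e. the classes and collections of a model
need not be all subsets of anything, they only satisfy the comprehension scheme.
-/

universe u v

namespace MTT

/-! ### Types, formulas and models -/

/-- The types of MTT: sets, classes (of sets), collections (of classes), product types. -/
inductive Ty : Type
  | set : Ty
  | cls : Ty
  | coll : Ty
  | prod (σ τ : Ty) : Ty
  deriving DecidableEq

/-- The factors of `τ₁ × (τ₂ × (⋯ × τₙ))`. -/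
def Ty.factors : Ty → List Ty
  | .prod σ τ => σ :: τ.factors
  | τ => [τ]

/-- The types of the entries in an atomic formula `⟨A₁, …, Aₙ⟩ ∈ α`, for `α` of the given type:
members of sets and of classes are sets, members of collections are classes, and a thing of type
`τ₁ × ⋯ × τₙ` has `n`-tuples of things of types `τ₁, …, τₙ` as members. -/
def Ty.args : Ty → List Ty
  | .set => [.set]
  | .cls => [.set]
  | .coll => [.cls]
  | .prod σ τ => (Ty.prod σ τ).factors

/-- Tuples with entries in the sorts listed. -/
def Tuple (D : Ty → Type u) : List Ty → Type u
  | [] => PUnit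
  | σ :: l => D σ × Tuple D l

/-- The tuple of the values of the variables `v 0, v 1, …` (of the listed types). -/
def Tuple.ofVars {D : Ty → Type u} (ρ : ∀ τ, ℕ → D τ) :
    (l : List Ty) → (Fin l.length → ℕ) → Tuple D l
  | [], _ => PUnit.unit
  | σ :: l, v => (ρ σ (v 0), Tuple.ofVars ρ l fun i => v i.succ)

/-- Set theoretic formulas: variables of all types (the `k`-th variable of each type, `k : ℕ`),
but quantifiers over sets only.  The formula `app τ k v` is `⟨v₁, …, vₙ⟩ ∈ α`, where `α` is the `k`-th
variable of type `τ`; identity is available for sets only. -/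
inductive SetFormula : Type
  | falsum : SetFormula
  | eq (x y : ℕ) : SetFormula
  | app (τ : Ty) (k : ℕ) (v : Fin τ.args.length → ℕ) : SetFormula
  | imp (φ ψ : SetFormula) : SetFormula
  | all (x : ℕ) (φ : SetFormula) : SetFormula

/-- Bounded (`Δ₀`) formulas in the language of set theory; `ball x y φ` is `∀ x ∈ y, φ`. -/
inductive BddFormula : Type
  | falsum : BddFormula
  | eq (x y : ℕ) : BddFormula
  | mem (x y : ℕ) : BddFormula
  | imp (φ ψ : BddFormula) : BddFormula
  | ball (x y : ℕ) (φ : BddFormula) : BddFormula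

/-- A structure for the language of MTT: a domain for each type, and membership. -/
structure Struc where
  D : Ty → Type u
  App : ∀ τ : Ty, D τ → Tuple D τ.args → Prop

namespace Struc

variable (M : Struc.{u})

/-- The universe of sets. -/
abbrev V : Type u := M.D .set

/-- `x ∈ y` for sets. -/
def Mem (x y : M.V) : Prop := M.App .set y (x, PUnit.unit)

/-- `x ∈₁ A`: the set `x` is in the class `A`. -/
def Mem₁ (x : M.V) (A : M.D .cls) : Prop := M.App .cls A (x, PUnit.unit)

end Struc

/-- Satisfaction of set theoretic formulas under an assignment to the variables. -/
def SetFormula.Holds {M : Struc.{u}} : SetFormula → (∀ τ, ℕ → M.D τ) → Prop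
  | falsum, _ => False
  | eq x y, ρ => ρ .set x = ρ .set y
  | app τ k v, ρ => M.App τ (ρ τ k) (Tuple.ofVars ρ τ.args v)
  | imp φ ψ, ρ => φ.Holds ρ → ψ.Holds ρ
  | all x φ, ρ => ∀ a : M.V, φ.Holds (Function.update ρ .set (Function.update (ρ .set) x a))

/-- Satisfaction of bounded formulas. -/
def BddFormula.Holds {M : Struc.{u}} : BddFormula → (ℕ → M.V) → Prop
  | falsum, _ => False
  | eq x y, ρ => ρ x = ρ y
  | mem x y, ρ => M.Mem (ρ x) (ρ y)
  | imp φ ψ, ρ => φ.Holds ρ → ψ.Holds ρ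
  | ball x y φ, ρ => ∀ a : M.V, M.Mem a (ρ y) → φ.Holds (Function.update ρ x a)

/-- The axioms of Mac Lane type theory: Mac Lane set theory (Zermelo set theory with choice, with
separation for bounded formulas only, and without foundation) for the sets, and comprehension for
set theoretic formulas at all higher types.  There is no extensionality, and no separation for
formulas that mention classes. -/
structure Struc.IsModel (M : Struc.{u}) : Prop where
  nonempty : ∀ τ, Nonempty (M.D τ)
  extensionality : ∀ x y : M.V, (∀ z, M.Mem z x ↔ M.Mem z y) → x = y
  empty : ∃ x : M.V, ∀ z, ¬ M.Mem z x
  pairing : ∀ x y : M.V, ∃ p, ∀ z, M.Mem z p ↔ z = x ∨ z = y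
  union : ∀ x : M.V, ∃ y, ∀ z, M.Mem z y ↔ ∃ w, M.Mem w x ∧ M.Mem z w
  powerset : ∀ x : M.V, ∃ y, ∀ z, M.Mem z y ↔ ∀ w, M.Mem w z → M.Mem w x
  infinity : ∃ x : M.V, (∃ e, M.Mem e x ∧ ∀ z, ¬ M.Mem z e) ∧
    ∀ y, M.Mem y x → ∃ s, M.Mem s x ∧ ∀ z, M.Mem z s ↔ M.Mem z y ∨ z = y
  separation : ∀ (φ : BddFormula) (k : ℕ) (ρ : ℕ → M.V) (x : M.V),
    ∃ y, ∀ z, M.Mem z y ↔ M.Mem z x ∧ φ.Holds (M := M) (Function.update ρ k z)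
  choice : ∀ x : M.V, (∀ y, M.Mem y x → ∃ z, M.Mem z y) →
    (∀ y y' z, M.Mem y x → M.Mem y' x → M.Mem z y → M.Mem z y' → y = y') →
    ∃ c, ∀ y, M.Mem y x → ∃! z, M.Mem z y ∧ M.Mem z c
  /-- For `τ = τ₁ × ⋯ × τₙ`, the abstract `{⟨v₁, …, vₙ⟩ | φ}`: the assignments `ρ'` are those that
  differ from `ρ` at the abstracted variables only. -/
  comprehension : ∀ (τ : Ty), τ ≠ .set → ∀ (v : Fin τ.args.length → ℕ) (φ : SetFormula)
    (ρ : ∀ σ, ℕ → M.D σ), ∃ A : M.D τ, ∀ ρ' : ∀ σ, ℕ → M.D σ,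
      (∀ σ k, (∀ i, ¬ (τ.args.get i = σ ∧ v i = k)) → ρ' σ k = ρ σ k) →
      (M.App τ A (Tuple.ofVars ρ' τ.args v) ↔ φ.Holds ρ')

/-! ### Categories given by relations -/

/-- Objects, arrows, domain, codomain and composition, as predicates on a type;
`Comp g f h` says that `h = g ∘ f`. -/
structure CatData (U : Type u) where
  Ob : U → Prop
  Ar : U → Prop
  Dom : U → U → Prop
  Cod : U → U → Prop
  Comp : U → U → U → Prop

/-- The relation `R` is a function from `A` to `B`. -/
def IsFunRel {U : Type u} (R : U → U → Prop) (A B : U → Prop) : Prop :=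
  (∀ a b, R a b → A a ∧ B b) ∧ ∀ a, A a → ∃! b, R a b

namespace CatData

variable {U : Type u} (X : CatData U)

/-- `f` is an arrow from `A` to `B`. -/
def Hom (f A B : U) : Prop := X.Dom f A ∧ X.Cod f B

/-- `i` is the identity arrow of `A`. -/
def IsId (i A : U) : Prop :=
  X.Hom i A A ∧ (∀ f, X.Dom f A → X.Comp f i f) ∧ (∀ f, X.Cod f A → X.Comp i f f)

/-- `f : A → B` is an isomorphism. -/
def IsIsoArrow (f A B : U) : Prop :=
  X.Hom f A B ∧ ∃ g i j, X.Hom g B A ∧ X.IsId i A ∧ X.IsId j B ∧ X.Comp g f i ∧ X.Comp f g j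

/-- The category axioms. -/
structure IsCategory : Prop where
  dom : IsFunRel X.Dom X.Ar X.Ob
  cod : IsFunRel X.Cod X.Ar X.Ob
  comp_hom : ∀ g f h, X.Comp g f h → ∃ A B C, X.Hom f A B ∧ X.Hom g B C ∧ X.Hom h A C
  comp_exists : ∀ f g A B C, X.Hom f A B → X.Hom g B C → ∃! h, X.Comp g f h
  assoc : ∀ f g h p q r, X.Comp g f p → X.Comp h g q → X.Comp h p r → X.Comp q f r
  id_exists : ∀ A, X.Ob A → ∃ i, X.IsId i A

/-- The full subcategory on the objects satisfying `P`. -/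
def full (P : U → Prop) : CatData U :=
  let ar : U → Prop := fun f => X.Ar f ∧ ∀ A, X.Dom f A ∨ X.Cod f A → P A
  { Ob := fun A => X.Ob A ∧ P A
    Ar := ar
    Dom := fun f A => X.Dom f A ∧ ar f
    Cod := fun f A => X.Cod f A ∧ ar f
    Comp := fun g f h => X.Comp g f h ∧ ar g ∧ ar f ∧ ar h }

/-- Relations `Fo`, `Fa` are the object and arrow parts of a functor. -/
structure IsFunctor (X Y : CatData U) (Fo Fa : U → U → Prop) : Prop where
  obj : IsFunRel Fo X.Ob Y.Ob
  arr : IsFunRel Fa X.Ar Y.Ar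
  hom : ∀ f A B f' A' B', X.Hom f A B → Fa f f' → Fo A A' → Fo B B' → Y.Hom f' A' B'
  id : ∀ i A i' A', X.IsId i A → Fa i i' → Fo A A' → Y.IsId i' A'
  comp : ∀ g f h g' f' h', X.Comp g f h → Fa g g' → Fa f f' → Fa h h' → Y.Comp g' f' h'

/-- The relation `η` is a natural isomorphism from the functor `(Fo, Fa)` to `(Go, Ga)`. -/
structure IsNatIso (X Y : CatData U) (Fo Fa Go Ga η : U → U → Prop) : Prop where
  fn : IsFunRel η X.Ob Y.Ar
  iso : ∀ A a A' A'', η A a → Fo A A' → Go A A'' → Y.IsIsoArrow a A' A''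
  natural : ∀ f A B f' f'' a b, X.Hom f A B → Fa f f' → Ga f f'' → η A a → η B b →
    ∃ k, Y.Comp b f' k ∧ Y.Comp f'' a k

/-- The objects, as a type. -/
def Obj : Type u := {A : U // X.Ob A}

variable {X}

theorem IsCategory.hom_unique (h : X.IsCategory) {f g k A B C : U} (hf : X.Hom f A B)
    (hg : X.Hom g B C) (hk : X.Comp g f k) : X.Hom k A C := by
  obtain ⟨A', B', C', hf', hg', hk'⟩ := h.comp_hom _ _ _ hk
  have h1 : A' = A := (h.dom.2 _ (h.dom.1 _ _ hf.1).1).unique hf'.1 hf.1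
  have h2 : C' = C := (h.cod.2 _ (h.cod.1 _ _ hg.2).1).unique hg'.2 hg.2
  subst h1 h2
  exact hk'

theorem IsCategory.exists_comp (h : X.IsCategory) {A B C : U} (f : {f : U // X.Hom f A B})
    (g : {g : U // X.Hom g B C}) : ∃ k : {k : U // X.Hom k A C}, X.Comp g.1 f.1 k.1 := by
  obtain ⟨k, hk, -⟩ := h.comp_exists _ _ _ _ _ f.2 g.2
  exact ⟨⟨k, h.hom_unique f.2 g.2 hk⟩, hk⟩

theorem IsCategory.comp_unique (h : X.IsCategory) {A B C : U} {f : {f : U // X.Hom f A B}}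
    {g : {g : U // X.Hom g B C}} {k k' : {k : U // X.Hom k A C}} (hk : X.Comp g.1 f.1 k.1)
    (hk' : X.Comp g.1 f.1 k'.1) : k = k' :=
  Subtype.ext ((h.comp_exists _ _ _ _ _ f.2 g.2).unique hk hk')

/-- A category given by relations, as a category with types of objects and arrows. -/
@[reducible]
noncomputable def IsCategory.category (h : X.IsCategory) : CategoryTheory.Category.{u} X.Obj where
  Hom A B := {f : U // X.Hom f A.1 B.1}
  id A := ⟨(h.id_exists A.1 A.2).choose, (h.id_exists A.1 A.2).choose_spec.1⟩
  comp f g := (h.exists_comp f g).choose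
  id_comp {A _} f :=
    h.comp_unique (h.exists_comp _ f).choose_spec ((h.id_exists A.1 A.2).choose_spec.2.1 _ f.2.1)
  comp_id {_ B} f :=
    h.comp_unique (h.exists_comp f _).choose_spec ((h.id_exists B.1 B.2).choose_spec.2.2 _ f.2.2)
  assoc f g k :=
    h.comp_unique (h.assoc _ _ _ _ _ _ (h.exists_comp f g).choose_spec
      (h.exists_comp g k).choose_spec (h.exists_comp _ k).choose_spec)
      (h.exists_comp f _).choose_spec

end CatData

/-! ### Sets of a model: pairs, functions, categories -/

namespace Struc

variable (M : Struc.{u})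

/-- The members of a set, as a predicate. -/
def elts (x : M.V) : M.V → Prop := fun z => M.Mem z x

/-- The members of a class, as a predicate. -/
def elts₁ (A : M.D .cls) : M.V → Prop := fun z => M.Mem₁ z A

/-- `p = ⟨a, b⟩ = {{a}, {a, b}}`. -/
def IsPair (p a b : M.V) : Prop :=
  ∀ z, M.Mem z p ↔ (∀ w, M.Mem w z ↔ w = a) ∨ (∀ w, M.Mem w z ↔ w = a ∨ w = b)

/-- `p = ⟨a, ⟨b, c⟩⟩`. -/
def IsTriple (p a b c : M.V) : Prop := ∃ q, M.IsPair q b c ∧ M.IsPair p a q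

/-- `⟨a, b⟩` is in the set or class `P`. -/
def Rel (P : M.V → Prop) (a b : M.V) : Prop := ∃ p, M.IsPair p a b ∧ P p

/-- `P` is (the graph of) a function from `A` to `B`; each of the three is a set or a class. -/
def IsFun (P A B : M.V → Prop) : Prop :=
  (∀ p, P p → ∃ a b, M.IsPair p a b) ∧ IsFunRel (M.Rel P) A B

/-- The objects, arrows and operations given by `⟨C₀, C₁, d₀, d₁, m⟩`.  The graph of the composition
consists of the `⟨⟨g, f⟩, g ∘ f⟩`. -/
def catData (C₀ C₁ d₀ d₁ m : M.V → Prop) : CatData M.V where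
  Ob := C₀
  Ar := C₁
  Dom := M.Rel d₀
  Cod := M.Rel d₁
  Comp g f h := ∃ q, M.IsPair q g f ∧ M.Rel m q h

/-- The formula `Cat(C₀, C₁, d₀, d₁, m)`, for five sets or five classes: `d₀`, `d₁` are functions
from `C₁` to `C₀` and `m` is a partial function from `C₁ × C₁` to `C₁` that satisfy the category
axioms. -/
def Cat (C₀ C₁ d₀ d₁ m : M.V → Prop) : Prop :=
  M.IsFun d₀ C₁ C₀ ∧ M.IsFun d₁ C₁ C₀ ∧
  (∀ p, m p → ∃ q h g f, M.IsPair p q h ∧ M.IsPair q g f ∧ C₁ g ∧ C₁ f ∧ C₁ h) ∧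
  (M.catData C₀ C₁ d₀ d₁ m).IsCategory

/-- A small category: five sets. -/
structure SmallCat where
  C₀ : M.V
  C₁ : M.V
  d₀ : M.V
  d₁ : M.V
  m : M.V
  cat : M.Cat (M.elts C₀) (M.elts C₁) (M.elts d₀) (M.elts d₁) (M.elts m)

/-- A class category: five classes. -/
structure ClassCat where
  C₀ : M.D .cls
  C₁ : M.D .cls
  D₀ : M.D .cls
  D₁ : M.D .cls
  m : M.D .cls
  cat : M.Cat (M.elts₁ C₀) (M.elts₁ C₁) (M.elts₁ D₀) (M.elts₁ D₁) (M.elts₁ m)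

variable {M}

/-- The relations of a small category. -/
def SmallCat.data (C : M.SmallCat) : CatData M.V :=
  M.catData (M.elts C.C₀) (M.elts C.C₁) (M.elts C.d₀) (M.elts C.d₁) (M.elts C.m)

/-- The relations of a class category. -/
def ClassCat.data (E : M.ClassCat) : CatData M.V :=
  M.catData (M.elts₁ E.C₀) (M.elts₁ E.C₁) (M.elts₁ E.D₀) (M.elts₁ E.D₁) (M.elts₁ E.m)

/-- The objects of a class category, as a type. -/
def ClassCat.Obj (E : M.ClassCat) : Type u := E.data.Obj

noncomputable instance (E : M.ClassCat) : CategoryTheory.Category.{u} E.Obj :=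
  CatData.IsCategory.category (X := E.data) E.cat.2.2.2

/-! ### Presheaves and sheaves -/

/-- The presheaf with elements `F₀`, indexing `γ : F₀ → C₀` and action `e` of arrows on elements:
`Act e s f t` says that `t = e⟨s, f⟩`, the restriction of `s` along `f`. -/
def Act (e s f t : M.V) : Prop := ∃ q, M.IsPair q s f ∧ M.Rel (M.elts e) q t

/-- `⟨F₀, γ, e⟩` is a presheaf on `C`. -/
structure IsPresheafTriple (C : M.SmallCat) (F₀ γ e : M.V) : Prop where
  index : M.IsFun (M.elts γ) (M.elts F₀) (M.elts C.C₀)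
  /-- `e` is a function from `F₁ = {⟨s, f⟩ ∈ F₀ × C₁ | γ s = cod f}` to `F₀` -/
  action : M.IsFun (M.elts e)
    (fun q => ∃ s f A, M.IsPair q s f ∧ M.Mem s F₀ ∧ M.Mem f C.C₁ ∧
      M.Rel (M.elts γ) s A ∧ C.data.Cod f A) (M.elts F₀)
  restrict : ∀ s g t B, Act e s g t → C.data.Dom g B → M.Rel (M.elts γ) t B
  comp : ∀ s g h k t r, C.data.Comp g h k → Act e s g t → Act e t h r → Act e s k r
  id : ∀ s A i, M.Rel (M.elts γ) s A → C.data.IsId i A → Act e s i s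

/-- `P` is a presheaf on `C`. -/
def IsPresheaf (C : M.SmallCat) (P : M.V) : Prop :=
  ∃ F₀ γ e, M.IsTriple P F₀ γ e ∧ IsPresheafTriple C F₀ γ e

/-- `η` is a natural transformation from the presheaf `P` to the presheaf `Q`. -/
def IsTransform (P Q η : M.V) : Prop :=
  ∃ F₀ γ e G₀ γ' e', M.IsTriple P F₀ γ e ∧ M.IsTriple Q G₀ γ' e' ∧
    M.IsFun (M.elts η) (M.elts F₀) (M.elts G₀) ∧
    (∀ s t A, M.Rel (M.elts η) s t → M.Rel (M.elts γ) s A → M.Rel (M.elts γ') t A) ∧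
    ∀ s t f s' t', M.Rel (M.elts η) s t → Act e s f s' → Act e' t f t' → M.Rel (M.elts η) s' t'

/-- The category of presheaves on `C`.  An arrow is a triple of domain, codomain and
transformation. -/
def presheafCat (C : M.SmallCat) : CatData M.V :=
  let ar : M.V → M.V → M.V → M.V → Prop := fun a P Q η =>
    M.IsTriple a P Q η ∧ IsPresheaf C P ∧ IsPresheaf C Q ∧ IsTransform P Q η
  { Ob := IsPresheaf C
    Ar := fun a => ∃ P Q η, ar a P Q η
    Dom := fun a P => ∃ Q η, ar a P Q η
    Cod := fun a Q => ∃ P η, ar a P Q η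
    Comp := fun b a c => ∃ P Q R η θ ζ, ar a P Q η ∧ ar b Q R θ ∧ ar c P R ζ ∧
      ∀ s t, M.Rel (M.elts ζ) s t ↔ ∃ r, M.Rel (M.elts η) s r ∧ M.Rel (M.elts θ) r t }

/-- The set `S` is a sieve on `A`. -/
def IsSieve (C : M.SmallCat) (S A : M.V) : Prop :=
  (∀ f, M.Mem f S → C.data.Cod f A) ∧ ∀ f g h, M.Mem f S → C.data.Comp f g h → M.Mem h S

/-- `T` is the pullback `g⁎S = {h | g ∘ h ∈ S}` of the sieve `S` along `g`. -/
def IsPullbackSieve (C : M.SmallCat) (g S T : M.V) : Prop :=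
  ∀ h, M.Mem h T ↔ ∃ k, C.data.Comp g h k ∧ M.Mem k S

/-- `J` is a Grothendieck topology on `C`: the set of the pairs `⟨A, S⟩` with `S` a covering sieve
of the object `A`. -/
structure IsTopology (C : M.SmallCat) (J : M.V) : Prop where
  sieve : ∀ p, M.Mem p J → ∃ A S, M.IsPair p A S ∧ M.Mem A C.C₀ ∧ IsSieve C S A
  maximal : ∀ A S, M.Mem A C.C₀ → (∀ f, M.Mem f S ↔ C.data.Cod f A) → M.Rel (M.elts J) A S
  stable : ∀ A S g B T, M.Rel (M.elts J) A S → C.data.Hom g B A → IsPullbackSieve C g S T →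
    M.Rel (M.elts J) B T
  transitive : ∀ A S R, M.Rel (M.elts J) A S → IsSieve C R A →
    (∀ f B T, M.Mem f S → C.data.Dom f B → IsPullbackSieve C f R T → M.Rel (M.elts J) B T) →
    M.Rel (M.elts J) A R

/-- The sheaf condition: for every cover `S` of `A`, every compatible family `x` of elements
`x f ∈ F(dom f)`, `f ∈ S`, comes from exactly one element of `F(A)`. -/
def IsSheaf (C : M.SmallCat) (J P : M.V) : Prop :=
  ∃ F₀ γ e, M.IsTriple P F₀ γ e ∧ IsPresheafTriple C F₀ γ e ∧
    ∀ A S x, M.Rel (M.elts J) A S → M.IsFun (M.elts x) (M.elts S) (M.elts F₀) →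
      (∀ f s B, M.Rel (M.elts x) f s → C.data.Dom f B → M.Rel (M.elts γ) s B) →
      (∀ f f' g g' k s s' t t', C.data.Comp f g k → C.data.Comp f' g' k →
        M.Rel (M.elts x) f s → M.Rel (M.elts x) f' s' → Act e s g t → Act e s' g' t' → t = t') →
      ∃! s, M.Rel (M.elts γ) s A ∧ ∀ f t, M.Rel (M.elts x) f t → Act e s f t

/-- The category of sheaves on `⟨C, J⟩`, a full subcategory of the category of presheaves. -/
def sheafCat (C : M.SmallCat) (J : M.V) : CatData M.V := (presheafCat C).full (IsSheaf C J)

/-! ### Equivalence and Grothendieck toposes -/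

/-- There are class functors `F : X → Y` and `G : Y → X` and (class) natural isomorphisms from the
identity of `X` to `G ∘ F` and from `F ∘ G` to the identity of `Y`. -/
def Equivalent (X Y : CatData M.V) : Prop :=
  ∃ Fo Fa Go Ga η ε : M.D .cls,
    (∀ F ∈ [Fo, Fa, Go, Ga, η, ε], ∀ p, M.Mem₁ p F → ∃ a b, M.IsPair p a b) ∧
    X.IsFunctor Y (M.Rel (M.elts₁ Fo)) (M.Rel (M.elts₁ Fa)) ∧
    Y.IsFunctor X (M.Rel (M.elts₁ Go)) (M.Rel (M.elts₁ Ga)) ∧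
    X.IsNatIso X Eq Eq (Relation.Comp (M.Rel (M.elts₁ Fo)) (M.Rel (M.elts₁ Go)))
      (Relation.Comp (M.Rel (M.elts₁ Fa)) (M.Rel (M.elts₁ Ga))) (M.Rel (M.elts₁ η)) ∧
    Y.IsNatIso Y (Relation.Comp (M.Rel (M.elts₁ Go)) (M.Rel (M.elts₁ Fo)))
      (Relation.Comp (M.Rel (M.elts₁ Ga)) (M.Rel (M.elts₁ Fa))) Eq Eq (M.Rel (M.elts₁ ε))

/-- A class Grothendieck topos: a class category equivalent to the category of sheaves on some small
site. -/
def ClassCat.IsGrothendieckTopos (E : M.ClassCat) : Prop :=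
  ∃ (C : M.SmallCat) (J : M.V), IsTopology C J ∧ Equivalent E.data (sheafCat C J)

end Struc

/-! ### The elementary topos axioms -/

open CategoryTheory CategoryTheory.Limits in
/-- Finite limits, exponentials and a subobject classifier. -/
def IsElementaryTopos (E : Type u) [Category.{v} E] : Prop :=
  ∃ _ : HasFiniteLimits E,
    (∀ A : E, (prod.functor.obj A).IsLeftAdjoint) ∧ HasSubobjectClassifier E

/-! ### The first-order theory of elementary toposes -/

/-- The relation symbols of the first-order language of categories. -/
inductive CatRel : ℕ → Type
  | ob : CatRel 1
  | ar : CatRel 1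
  | dom : CatRel 2
  | cod : CatRel 2
  | comp : CatRel 3

/-- The first-order language of categories: two sorts (objects and arrows, given by predicates), and
the relations "the domain of `f` is `A`", "the codomain of `f` is `A`" and "`g ∘ f = h`". -/
def catLang : FirstOrder.Language.{0, 0} := ⟨fun _ => Empty, CatRel⟩

/-- The objects and arrows of a class category (as disjoint sorts). -/
def Struc.ClassCat.Elt {M : Struc.{u}} (E : M.ClassCat) : Type u :=
  {A : M.V // E.data.Ob A} ⊕ {f : M.V // E.data.Ar f}

/-- A class category as a structure for the language of categories. -/
instance {M : Struc.{u}} (E : M.ClassCat) : catLang.Structure E.Elt where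
  funMap f := nomatch f
  RelMap r x := match r with
    | .ob => ∃ A, x 0 = Sum.inl A
    | .ar => ∃ f, x 0 = Sum.inr f
    | .dom => ∃ f A, x 0 = Sum.inr f ∧ x 1 = Sum.inl A ∧ E.data.Dom f.1 A.1
    | .cod => ∃ f A, x 0 = Sum.inr f ∧ x 1 = Sum.inl A ∧ E.data.Cod f.1 A.1
    | .comp => ∃ g f h, x 0 = Sum.inr g ∧ x 1 = Sum.inr f ∧ x 2 = Sum.inr h ∧
        E.data.Comp g.1 f.1 h.1

namespace ToposTheory

open FirstOrder FirstOrder.Language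

/-- Formulas whose free variables are `0, …, n - 1`. -/
abbrev Fm (n : ℕ) : Type := catLang.BoundedFormula Empty n

variable {n : ℕ}

/-- `x` is an object. -/
def ob (x : Fin n) : Fm n := Relations.boundedFormula₁ (L := catLang) CatRel.ob (&x)

/-- `x` is an arrow. -/
def ar (x : Fin n) : Fm n := Relations.boundedFormula₁ (L := catLang) CatRel.ar (&x)

/-- The domain of `f` is `A`. -/
def dom (f A : Fin n) : Fm n := Relations.boundedFormula₂ (L := catLang) CatRel.dom (&f) (&A)

/-- The codomain of `f` is `A`. -/
def cod (f A : Fin n) : Fm n := Relations.boundedFormula₂ (L := catLang) CatRel.cod (&f) (&A)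

/-- `h = g ∘ f`. -/
def comp (g f h : Fin n) : Fm n :=
  Relations.boundedFormula (L := catLang) (n := 3) CatRel.comp ![&g, &f, &h]

/-- `x = y`. -/
def eq (x y : Fin n) : Fm n := (&x) =' (&y)

/-- `f : A → B`. -/
def hom (f A B : Fin n) : Fm n := dom f A ⊓ cod f B

/-- A variable of the outer context, under `k` further quantifiers. -/
abbrev old (k : ℕ) (x : Fin n) : Fin (n + k) := Fin.castAdd k x

/-- The variable bound by the `i`-th of `k` further quantifiers. -/
abbrev new (k : ℕ) (i : Fin k) : Fin (n + k) := Fin.natAdd n i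

/-- There is exactly one `x` with `φ x`; here `φ k` is the formula in a context with `k` further
variables, the last of which is `x`. -/
def exUnique (φ : ∀ m : ℕ, Fin (n + m) → Fm (n + m)) : Fm n :=
  ∃' (φ 1 (new 1 0) ⊓ ∀' (φ 2 (new 2 1) ⟹ eq (new 2 1) (new 2 0)))

/-- `i` is the identity of `A`. -/
def isId (i A : Fin n) : Fm n :=
  hom i A A ⊓ ∀' ((dom (new 1 0) (old 1 A) ⟹ comp (new 1 0) (old 1 i) (new 1 0)) ⊓
    (cod (new 1 0) (old 1 A) ⟹ comp (old 1 i) (new 1 0) (new 1 0)))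

/-- `T` is a terminal object. -/
def isTerminal (T : Fin n) : Fm n :=
  ob T ⊓ ∀' (ob (new 1 0) ⟹
    exUnique fun m f => hom f (old m (new 1 0)) (old m (old 1 T)))

/-- `f` is monic. -/
def isMonic (f : Fin n) : Fm n :=
  ar f ⊓ ∀' ∀' ∀' (comp (old 3 f) (new 3 0) (new 3 2) ⟹ comp (old 3 f) (new 3 1) (new 3 2) ⟹
    eq (new 3 0) (new 3 1))

/-- `p : P → A` and `q : P → B` are the projections of a product of `A` and `B`. -/
def isProduct (P p q A B : Fin n) : Fm n :=
  hom p P A ⊓ hom q P B ⊓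
  ∀' ∀' ∀' (hom (new 3 1) (new 3 0) (old 3 A) ⟹ hom (new 3 2) (new 3 0) (old 3 B) ⟹
    exUnique fun m u =>
      comp (old m (old 3 p)) u (old m (new 3 1)) ⊓ comp (old m (old 3 q)) u (old m (new 3 2)))

/-- The square with sides `p`, `f` and `q`, `g` is a pullback: `f ∘ p = g ∘ q`, universally. -/
def isPullback (p q f g : Fin n) : Fm n :=
  (∃' (comp (old 1 f) (old 1 p) (new 1 0) ⊓ comp (old 1 g) (old 1 q) (new 1 0))) ⊓
  ∀' ∀' ∀' (comp (old 3 f) (new 3 0) (new 3 2) ⟹ comp (old 3 g) (new 3 1) (new 3 2) ⟹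
    exUnique fun m u =>
      comp (old m (old 3 p)) u (old m (new 3 0)) ⊓ comp (old m (old 3 q)) u (old m (new 3 1)))

/-- `h : Y → X` is a transpose of `g : Q → B` with respect to `e : P → B`, where `p, q` are the
projections from `P = X × A` and `r, s` those from `Q = Y × A`: that is, `e ∘ (h × A) = g`. -/
def isTranspose (Y X p q e r s g h : Fin n) : Fm n :=
  hom h Y X ⊓ ∃' ∃' (comp (old 2 h) (old 2 r) (new 2 1) ⊓ comp (old 2 p) (new 2 0) (new 2 1) ⊓
    comp (old 2 q) (new 2 0) (old 2 s) ⊓ comp (old 2 e) (new 2 0) (old 2 g))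

/-- `e : P → B` is an evaluation that makes `X` the exponential `B^A`, where `p, q` are the
projections from `P = X × A`. -/
def isExponential (X P p q e A B : Fin n) : Fm n :=
  isProduct P p q X A ⊓ hom e P B ⊓
  -- the variables bound here are `Y`, `Q`, `r`, `s`, `g`
  ∀' ∀' ∀' ∀' ∀' (isProduct (new 5 1) (new 5 2) (new 5 3) (new 5 0) (old 5 A) ⟹
    hom (new 5 4) (new 5 1) (old 5 B) ⟹
    exUnique fun m h => isTranspose (old m (new 5 0)) (old m (old 5 X)) (old m (old 5 p))
      (old m (old 5 q)) (old m (old 5 e)) (old m (new 5 2)) (old m (new 5 3)) (old m (new 5 4)) h)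

/-- `t : T → Ω` with `T` terminal is a subobject classifier: for every monic `k : U → Z` there is
exactly one `χ : Z → Ω` such that `k` is a pullback of `t` along `χ`. -/
def isClassifier (T W t : Fin n) : Fm n :=
  isTerminal T ⊓ hom t T W ⊓
  ∀' ∀' ∀' (hom (new 3 2) (new 3 0) (new 3 1) ⟹ isMonic (new 3 2) ⟹
    exUnique fun m χ => hom χ (old m (new 3 1)) (old m (old 3 W)) ⊓
      ∃' isPullback (old 1 (old m (new 3 2))) (new 1 0) (old 1 χ) (old 1 (old m (old 3 t))))

/-- The category axioms. -/
def categoryAxioms : catLang.Theory :=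
  { ∀' (ob 0 ⊔ ar 0),
    ∀' ∼(ob 0 ⊓ ar 0),
    ∀' ∀' (dom 0 1 ⟹ ar 0 ⊓ ob 1),
    ∀' ∀' (cod 0 1 ⟹ ar 0 ⊓ ob 1),
    ∀' (ar 0 ⟹ exUnique fun m A => dom (old m 0) A),
    ∀' (ar 0 ⟹ exUnique fun m A => cod (old m 0) A),
    -- composites: `f = 1`, `g = 0`, `h = 2`
    ∀' ∀' ∀' (comp 0 1 2 ⟹ ∃' ∃' ∃' (hom 1 3 4 ⊓ hom 0 4 5 ⊓ hom 2 3 5)),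
    ∀' ∀' ∀' ∀' ∀' (hom 0 2 3 ⟹ hom 1 3 4 ⟹ exUnique fun m h => comp (old m 1) (old m 0) h),
    -- associativity: `f = 0`, `g = 1`, `h = 2`, `g ∘ f = 3`, `h ∘ g = 4`
    ∀' ∀' ∀' ∀' ∀' ∀' (comp 1 0 3 ⟹ comp 2 1 4 ⟹ comp 2 3 5 ⟹ comp 4 0 5),
    ∀' (ob 0 ⟹ ∃' isId 1 0) }

/-- The axioms for finite limits, exponentials and a subobject classifier. -/
def structureAxioms : catLang.Theory :=
  { ∃' isTerminal 0,
    ∀' ∀' ∀' ∀' ∀' (hom 0 2 4 ⟹ hom 1 3 4 ⟹ ∃' ∃' isPullback 5 6 0 1),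
    -- every pair of objects `0`, `1` has an exponential `2` with product `3`, projections `4`, `5`
    -- and evaluation `6`
    ∀' ∀' (ob 0 ⟹ ob 1 ⟹ ∃' ∃' ∃' ∃' ∃' isExponential 2 3 4 5 6 0 1),
    ∃' ∃' ∃' isClassifier 0 1 2 }

/-- The elementary theory of toposes. -/
def elementaryTopos : catLang.Theory := categoryAxioms ∪ structureAxioms

end ToposTheory

end MTT

/-! The obstacle is the weakness of the set theory: separation covers bounded formulas only and
there is no replacement, so every construction on sheaves must be carved by a bounded formula out of
a set already supplied by products and power sets. The standard constructions allow this. Finite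
limits are computed on elements; the elements of the exponential over A are graphs of
transformations from y(A) × F to G; the elements of Ω over A are closed sieves. Sheafification is
never needed.

To avoid handling formulas throughout, the proof sets up a higher-order logic inside the model. A
type is `Coded` if its elements correspond to the members of a set, and a map is internal (`IFun`)
if its graph is a set. Quantification over a coded type is quantification bounded by its `range`, so
bounded separation closes internal predicates under all logical operations; coded types are closed
under products, internal subtypes and internal power sets, and include the truth values. Internality
of a construction then follows by rote from its shape.

Over an internal site the internal sheaves form an ordinary category, where the textbook arguments
apply element by element: `isPullback_pullback`, `existsUnique_transpose`, `isPullback_classify` and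
`eq_classify` make it an elementary topos (`ISheaf.isElementaryTopos`).

A small site of the model yields an internal site, and the sheaves of the model form a category
equivalent to the internal sheaves. Full faithfulness holds because transformations are exactly the
internal maps (`sheafCatMap`); essential surjectivity holds because the range of a coded type is
itself a set (`exists_iso_sheafCatObj`). A class equivalence, seen from outside, is an ordinary
equivalence, and the topos structure passes along it. Finally the first-order axioms are evaluated
in the class category, so that it is a model of the elementary theory and satisfies every
consequence of it. -/

namespace MTT

/-! ### Bounded formulas -/

namespace BddFormula

/-- Negation. -/
def neg (φ : BddFormula) : BddFormula := imp φ falsum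

/-- Conjunction. -/
def and (φ ψ : BddFormula) : BddFormula := neg (imp φ (neg ψ))

/-- Disjunction. -/
def or (φ ψ : BddFormula) : BddFormula := imp (neg φ) ψ

/-- `∃ x ∈ y, φ`. -/
def bex (x y : ℕ) (φ : BddFormula) : BddFormula := neg (ball x y (neg φ))

/-- `p = ⟨a, b⟩`; the variables `100` and `101` are used as bound variables. -/
def isPair (p a b : ℕ) : BddFormula :=
  let sing : BddFormula := and (mem a 100) (ball 101 100 (eq 101 a))
  let upair : BddFormula :=
    and (and (mem a 100) (mem b 100)) (ball 101 100 (or (eq 101 a) (eq 101 b)))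
  -- `IsPair` quantifies over all sets z. The bounded form says that every member of p is {a} or {a,
  -- b}, and that both of these occur in p.
  and (ball 100 p (or sing upair)) (and (bex 100 p sing) (bex 100 p upair))

variable {M : Struc.{u}} (φ ψ : BddFormula) (ρ : ℕ → M.V)

@[simp] theorem holds_falsum : falsum.Holds ρ ↔ False := Iff.rfl

@[simp] theorem holds_eq (x y : ℕ) : (eq x y).Holds ρ ↔ ρ x = ρ y := Iff.rfl

@[simp] theorem holds_mem (x y : ℕ) : (mem x y).Holds ρ ↔ M.Mem (ρ x) (ρ y) := Iff.rfl

@[simp] theorem holds_imp : (imp φ ψ).Holds ρ ↔ (φ.Holds ρ → ψ.Holds ρ) := Iff.rfl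

@[simp] theorem holds_ball (x y : ℕ) :
    (ball x y φ).Holds ρ ↔ ∀ a : M.V, M.Mem a (ρ y) → φ.Holds (Function.update ρ x a) := Iff.rfl

@[simp] theorem holds_neg : (neg φ).Holds ρ ↔ ¬ φ.Holds ρ := Iff.rfl

@[simp] theorem holds_and : (and φ ψ).Holds ρ ↔ φ.Holds ρ ∧ ψ.Holds ρ := by simp [and]

@[simp] theorem holds_or : (or φ ψ).Holds ρ ↔ φ.Holds ρ ∨ ψ.Holds ρ := by
  simp [or, or_iff_not_imp_left]

@[simp] theorem holds_bex (x y : ℕ) :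
    (bex x y φ).Holds ρ ↔ ∃ a : M.V, M.Mem a (ρ y) ∧ φ.Holds (Function.update ρ x a) := by
  simp [bex]

end BddFormula

/-! ### Pairs, products and power sets in a model -/

namespace Struc

variable {M : Struc.{u}}

theorem IsModel.ext (hM : M.IsModel) {x y : M.V} (h : ∀ z, M.Mem z x ↔ M.Mem z y) : x = y :=
  hM.extensionality x y h

theorem IsModel.exists_singleton (hM : M.IsModel) (a : M.V) : ∃ s, ∀ w, M.Mem w s ↔ w = a := by
  obtain ⟨s, hs⟩ := hM.pairing a a
  exact ⟨s, fun w => by simp [hs]⟩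

theorem IsModel.exists_isPair (hM : M.IsModel) (a b : M.V) : ∃ p, M.IsPair p a b := by
  obtain ⟨s, hs⟩ := hM.exists_singleton a
  obtain ⟨t, ht⟩ := hM.pairing a b
  obtain ⟨p, hp⟩ := hM.pairing s t
  refine ⟨p, fun z => ?_⟩
  rw [hp]
  constructor
  · rintro (rfl | rfl)
    · exact Or.inl hs
    · exact Or.inr ht
  · rintro (h | h)
    · exact Or.inl (hM.ext fun w => (h w).trans (hs w).symm)
    · exact Or.inr (hM.ext fun w => (h w).trans (ht w).symm)

theorem IsPair.unique (hM : M.IsModel) {p q a b : M.V} (hp : M.IsPair p a b)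
    (hq : M.IsPair q a b) : p = q :=
  hM.ext fun z => (hp z).trans (hq z).symm

/-- The four sets {a}, {a, b}, {a'}, {a', b'} exist by pairing and all lie in p, so each is a
singleton or a pair of the other kind; comparing members decides the cases. Foundation plays no
part. -/
theorem IsPair.inj (hM : M.IsModel) {p a b a' b' : M.V} (h : M.IsPair p a b)
    (h' : M.IsPair p a' b') : a = a' ∧ b = b' := by
  obtain ⟨s, hs⟩ := hM.exists_singleton a
  obtain ⟨t, ht⟩ := hM.pairing a b
  obtain ⟨s', hs'⟩ := hM.exists_singleton a'
  obtain ⟨t', ht'⟩ := hM.pairing a' b'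
  have h1 := (h' s).1 ((h s).2 (Or.inl hs))
  have h2 := (h' t).1 ((h t).2 (Or.inr ht))
  have h3 := (h s').1 ((h' s').2 (Or.inl hs'))
  have h4 := (h t').1 ((h' t').2 (Or.inr ht'))
  simp only [hs, ht, hs', ht'] at h1 h2 h3 h4
  have haa : a = a' := by
    rcases h1 with h1 | h1
    · exact (h1 a).1 rfl
    · exact ((h1 a').2 (Or.inl rfl)).symm
  subst haa
  refine ⟨rfl, ?_⟩
  rcases h2 with h2 | h2
  · have hb : b = a := (h2 b).1 (Or.inr rfl)
    subst hb
    rcases h4 with h4 | h4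
    · exact ((h4 b').1 (Or.inr rfl)).symm
    · have := (h4 b').1 (Or.inr rfl)
      tauto
  · have hb := (h2 b).1 (Or.inr rfl)
    have hb' := (h2 b').2 (Or.inr rfl)
    grind

/-- The bounded formula agrees with the unbounded definition because {a} and {a, b} exist in the
model and are determined by their members. The bounds by 100 keep the arguments clear of the two
bound variables. -/
theorem _root_.MTT.BddFormula.holds_isPair (hM : M.IsModel) (ρ : ℕ → M.V) {p a b : ℕ} (hp : p < 100)
    (ha : a < 100) (hb : b < 100) :
    (BddFormula.isPair p a b).Holds ρ ↔ M.IsPair (ρ p) (ρ a) (ρ b) := by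
  have e : ∀ x, x < 100 → x ≠ 100 ∧ x ≠ 101 := by omega
  obtain ⟨hp1, hp2⟩ := e p hp
  obtain ⟨ha1, ha2⟩ := e a ha
  obtain ⟨hb1, hb2⟩ := e b hb
  have h1 : ∀ z, (M.Mem (ρ a) z ∧ ∀ w, M.Mem w z → w = ρ a) ↔ ∀ w, M.Mem w z ↔ w = ρ a :=
    fun z => ⟨fun h w => ⟨h.2 w, fun e => e ▸ h.1⟩, fun h => ⟨(h _).2 rfl, fun w => (h w).1⟩⟩
  have h2 : ∀ z, ((M.Mem (ρ a) z ∧ M.Mem (ρ b) z) ∧ ∀ w, M.Mem w z → w = ρ a ∨ w = ρ b) ↔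
      ∀ w, M.Mem w z ↔ w = ρ a ∨ w = ρ b :=
    fun z => ⟨fun h w => ⟨h.2 w, by rintro (e | e) <;> simp [e, h.1]⟩,
      fun h => ⟨⟨(h _).2 (Or.inl rfl), (h _).2 (Or.inr rfl)⟩, fun w => (h w).1⟩⟩
  simp only [BddFormula.isPair, BddFormula.holds_and, BddFormula.holds_ball, BddFormula.holds_or,
    BddFormula.holds_bex, BddFormula.holds_mem, BddFormula.holds_eq, Function.update_apply,
    ha1, ha2, hb1, hb2, if_true, if_false, Nat.reduceEqDiff, h1, h2]
  constructor
  · rintro ⟨h, ⟨s, hs, hs'⟩, t, ht, ht'⟩ z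
    refine ⟨h z, ?_⟩
    rintro (hz | hz)
    · rwa [hM.ext fun w => (hz w).trans (hs' w).symm]
    · rwa [hM.ext fun w => (hz w).trans (ht' w).symm]
  · intro h
    obtain ⟨s, hs⟩ := hM.exists_singleton (ρ a)
    obtain ⟨t, ht⟩ := hM.pairing (ρ a) (ρ b)
    exact ⟨fun z => (h z).1, ⟨s, (h s).2 (Or.inl hs), hs⟩, t, (h t).2 (Or.inr ht), ht⟩

/-- The assignment with the listed values. -/
def assign (x : M.V) (l : List M.V) : ℕ → M.V := fun n => l.getD n x

/-- Separation with named parameters: variable 0 is the candidate, the list fills the variables from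
1 on, and later variables have a default value. -/
theorem IsModel.sep (hM : M.IsModel) (φ : BddFormula) (l : List M.V) (x : M.V) :
    ∃ y, ∀ z, M.Mem z y ↔ M.Mem z x ∧ φ.Holds (M := M) (assign x (z :: l)) := by
  obtain ⟨y, hy⟩ := hM.separation φ 0 (assign x (x :: l)) x
  refine ⟨y, fun z => (hy z).trans ?_⟩
  have : Function.update (assign x (x :: l)) 0 z = assign x (z :: l) := by
    funext n
    cases n <;> simp [assign]
  rw [this]

/-- Replacement is avoided by separating the product out of the double power set of A ∪ B, which
contains every Kuratowski pair with entries in A and B. -/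
theorem IsModel.exists_prod (hM : M.IsModel) (A B : M.V) :
    ∃ P, ∀ p, M.Mem p P ↔ ∃ a, M.Mem a A ∧ ∃ b, M.Mem b B ∧ M.IsPair p a b := by
  obtain ⟨c, hc⟩ := hM.pairing A B
  obtain ⟨U, hU⟩ := hM.union c
  obtain ⟨P₁, hP₁⟩ := hM.powerset U
  obtain ⟨P₂, hP₂⟩ := hM.powerset P₁
  obtain ⟨P, hP⟩ := hM.sep (.bex 3 1 (.bex 4 2 (.isPair 0 3 4))) [A, B] P₂
  refine ⟨P, fun p => (hP p).trans ?_⟩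
  simp only [BddFormula.holds_bex, assign, BddFormula.holds_isPair hM _ (show 0 < 100 by norm_num)
    (show 3 < 100 by norm_num) (show 4 < 100 by norm_num)]
  simp only [Function.update_apply, Nat.reduceEqDiff, if_true, if_false, List.getD_cons_zero,
    List.getD_cons_succ, OfNat.zero_ne_ofNat]
  refine and_iff_right_of_imp ?_
  rintro ⟨a, ha, b, hb, hp⟩
  rw [hP₂]
  intro z hz
  rw [hP₁]
  intro w hw
  rw [hU]
  rcases (hp z).1 hz with h | h
  · rw [h] at hw
    exact ⟨A, (hc A).2 (Or.inl rfl), hw ▸ ha⟩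
  · rw [h] at hw
    rcases hw with rfl | rfl
    · exact ⟨A, (hc A).2 (Or.inl rfl), ha⟩
    · exact ⟨B, (hc B).2 (Or.inr rfl), hb⟩

end Struc

end MTT

namespace MTT

/-! ### Coded types, internal subsets and internal functions -/

open Struc

variable (M : Struc.{u})

/-- The elements of the type `α` are coded by the members of a set of the model `M`. -/
class Coded (α : Type*) where
  code : α → M.V
  code_injective : Function.Injective code
  range : M.V
  mem_range : ∀ z, M.Mem z range ↔ ∃ a, code a = z

/-- A subset of a coded type is internal if it is given by a set of the model. -/
def IPred {α : Type*} [Coded M α] (P : α → Prop) : Prop :=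
  ∃ s : M.V, ∀ a, M.Mem (Coded.code a) s ↔ P a

section

variable {M} [hM : Fact M.IsModel]
variable {α β γ δ : Type*} [Coded M α] [Coded M β] [Coded M γ] [Coded M δ]

open Coded

omit hM in
theorem code_eq_code {a b : α} : code (M := M) a = code b ↔ a = b := code_injective.eq_iff

omit hM in
theorem code_mem_range (a : α) : M.Mem (code a) (range α) := (mem_range _).2 ⟨a, rfl⟩

omit hM in
theorem exists_mem_range {Q : M.V → Prop} :
    (∃ z, M.Mem z (range α) ∧ Q z) ↔ ∃ a : α, Q (code a) := by
  simp only [mem_range]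
  exact ⟨fun ⟨z, ⟨a, h⟩, hz⟩ => ⟨a, h ▸ hz⟩, fun ⟨a, h⟩ => ⟨_, ⟨a, rfl⟩, h⟩⟩

/-- The single passage from bounded separation to internal predicates. The closure lemmas exhibit a
formula together with the ranges that bound its quantifiers and the parameters it mentions. -/
theorem IPred.of_formula {P : α → Prop} (φ : BddFormula) (l : List M.V)
    (h : ∀ a, φ.Holds (assign (range α) (code a :: l)) ↔ P a) : IPred M P := by
  obtain ⟨s, hs⟩ := hM.out.sep φ l (range α)
  exact ⟨s, fun a => by rw [hs, h, and_iff_right (code_mem_range a)]⟩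

/-- A witness of `IPred` may contain sets that code nothing; intersecting it with the range leaves
exactly the codes. -/
theorem IPred.exists_set {P : α → Prop} (h : IPred M P) :
    ∃ s : M.V, ∀ z, M.Mem z s ↔ ∃ a, P a ∧ code a = z := by
  obtain ⟨s, hs⟩ := h
  obtain ⟨t, ht⟩ := hM.out.sep (.mem 0 1) [s] (range α)
  refine ⟨t, fun z => ?_⟩
  rw [ht, mem_range]
  simp only [BddFormula.holds_mem, assign, List.getD_cons_zero, List.getD_cons_succ]
  constructor
  · rintro ⟨⟨a, rfl⟩, h⟩
    exact ⟨a, (hs a).1 h, rfl⟩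
  · rintro ⟨a, h, rfl⟩
    exact ⟨⟨a, rfl⟩, (hs a).2 h⟩

noncomputable instance : Coded M (α × β) where
  code p := (hM.out.exists_isPair (code p.1) (code p.2)).choose
  code_injective p q h := by
    have h1 := (hM.out.exists_isPair (code (M := M) p.1) (code p.2)).choose_spec
    have h2 := (hM.out.exists_isPair (code (M := M) q.1) (code q.2)).choose_spec
    simp only at h
    rw [← h] at h2
    obtain ⟨h3, h4⟩ := IsPair.inj hM.out h1 h2
    exact Prod.ext (code_injective h3) (code_injective h4)
  range := (hM.out.exists_prod (range α) (range β)).choose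
  mem_range z := by
    rw [(hM.out.exists_prod (range α) (range β)).choose_spec, exists_mem_range]
    simp only [exists_mem_range]
    constructor
    · rintro ⟨a, b, h⟩
      exact ⟨(a, b), IsPair.unique hM.out (hM.out.exists_isPair _ _).choose_spec h⟩
    · rintro ⟨⟨a, b⟩, rfl⟩
      exact ⟨a, b, (hM.out.exists_isPair _ _).choose_spec⟩

theorem isPair_code (a : α) (b : β) : M.IsPair (code (a, b)) (code a) (code b) :=
  (hM.out.exists_isPair (code (M := M) a) (code b)).choose_spec

theorem isPair_iff {p : M.V} {a : α} {b : β} :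
    M.IsPair p (code a) (code b) ↔ p = code (a, b) :=
  ⟨fun h => h.unique hM.out (isPair_code a b), fun h => h ▸ isPair_code a b⟩

theorem rel_elts_iff {s : M.V} {a : α} {b : β} :
    M.Rel (M.elts s) (code a) (code b) ↔ M.Mem (code (a, b)) s := by
  simp [Struc.Rel, isPair_iff, elts]

variable (M) in
/-- A function is internal if its graph is. -/
@[fun_prop]
def IFun (f : α → β) : Prop := IPred M fun p : α × β => f p.1 = p.2

theorem IPred.comp {P : β → Prop} (hP : IPred M P) {f : α → β} (hf : IFun M f) :
    IPred M fun a => P (f a) := by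
  obtain ⟨s, hs⟩ := hP
  obtain ⟨t, ht⟩ := hf
  -- Variables 4 and 5 are bound by the quantifiers, so the repeated `s` in these two places of the
  -- list is padding and the graph `t` is variable 6.
  refine .of_formula (.bex 4 1 (.and (.mem 4 2) (.bex 5 3 (.and (.mem 5 6) (.isPair 5 0 4)))))
    [range β, s, range (α × β), s, s, t] fun a => ?_
  simp [assign, BddFormula.holds_isPair hM.out, exists_mem_range,
    isPair_iff, code_eq_code, hs, ht]

theorem IPred.imp {P Q : α → Prop} (hP : IPred M P) (hQ : IPred M Q) :
    IPred M fun a => P a → Q a := by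
  obtain ⟨s, hs⟩ := hP
  obtain ⟨t, ht⟩ := hQ
  exact .of_formula (.imp (.mem 0 1) (.mem 0 2)) [s, t] fun a => by simp [assign, hs, ht]

-- The proposition is external and has no formula of its own, but it is either true or false, and
-- each case has one.
variable (M) in
theorem IPred.const (p : Prop) : IPred M fun _ : α => p := by
  by_cases hp : p
  · exact .of_formula (.eq 0 0) [] fun a => by simp [hp]
  · exact .of_formula .falsum [] fun a => by simp [hp]

theorem IPred.not {P : α → Prop} (hP : IPred M P) : IPred M fun a => ¬ P a :=
  hP.imp (.const M False)

theorem IPred.and {P Q : α → Prop} (hP : IPred M P) (hQ : IPred M Q) :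
    IPred M fun a => P a ∧ Q a := by
  simpa using (hP.imp hQ.not).not

theorem IPred.exists {P : α → β → Prop} (hP : IPred M fun p : α × β => P p.1 p.2) :
    IPred M fun a => ∃ b, P a b := by
  obtain ⟨s, hs⟩ := hP
  refine .of_formula (.bex 4 1 (.bex 5 2 (.and (.mem 5 3) (.isPair 5 0 4))))
    [range β, range (α × β), s] fun a => ?_
  simp [assign, BddFormula.holds_isPair hM.out, exists_mem_range,
    isPair_iff, code_eq_code, hs]

variable (M α) in
theorem IPred.eq : IPred M fun p : α × α => p.1 = p.2 := by
  -- The diagonal consists of the pairs ⟨a, a⟩ with a in the range.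
  refine .of_formula (.bex 2 1 (.isPair 0 2 2)) [range α] fun p => ?_
  simp [assign, BddFormula.holds_isPair hM.out, exists_mem_range,
    isPair_iff, code_eq_code, Prod.ext_iff, eq_comm]

@[fun_prop]
theorem IFun.id : IFun M fun a : α => a := IPred.eq M α

@[fun_prop]
theorem IFun.const (b : β) : IFun M fun _ : α => b := by
  refine .of_formula (.bex 3 1 (.isPair 0 3 2)) [range α, code b] fun p => ?_
  simp [assign, BddFormula.holds_isPair hM.out, exists_mem_range,
    isPair_iff, code_eq_code, Prod.ext_iff, eq_comm]

@[fun_prop]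
theorem IFun.comp {g : β → γ} (hg : IFun M g) {f : α → β} (hf : IFun M f) :
    IFun M fun a => g (f a) := by
  obtain ⟨s, hs⟩ := hg
  obtain ⟨t, ht⟩ := hf
  refine .of_formula (.bex 10 1 (.bex 11 2 (.bex 12 3 (.and (.isPair 0 10 12)
    (.bex 13 4 (.bex 14 5 (.and (.and (.isPair 13 10 11) (.isPair 14 11 12))
      (.and (.mem 13 6) (.mem 14 7)))))))))
    [range α, range β, range γ, range (α × β), range (β × γ), t, s] fun p => ?_
  simp [assign, BddFormula.holds_isPair hM.out, exists_mem_range,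
    isPair_iff, code_eq_code, hs, ht, Prod.ext_iff, and_assoc, eq_comm]

@[fun_prop]
theorem IFun.prodMk {f : α → β} {g : α → γ} (hf : IFun M f) (hg : IFun M g) :
    IFun M fun a => (f a, g a) := by
  obtain ⟨s, hs⟩ := hf
  obtain ⟨t, ht⟩ := hg
  refine .of_formula (.bex 10 1 (.bex 11 2 (.bex 12 3 (.bex 15 8 (.and (.and (.isPair 15 11 12) (.isPair 0 10 15))
    (.bex 13 4 (.bex 14 5 (.and (.and (.isPair 13 10 11) (.isPair 14 10 12))
      (.and (.mem 13 6) (.mem 14 7))))))))))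
    [range α, range β, range γ, range (α × β), range (α × γ), s, t, range (β × γ)] fun p => ?_
  simp [assign, BddFormula.holds_isPair hM.out, exists_mem_range,
    isPair_iff, code_eq_code, hs, ht, Prod.ext_iff, and_assoc]

theorem IFun.fst_aux : IFun M fun p : α × β => p.1 := by
  refine .of_formula (.bex 10 1 (.bex 11 2 (.bex 12 3 (.and (.isPair 12 10 11) (.isPair 0 12 10)))))
    [range α, range β, range (α × β)] fun p => ?_
  simp [assign, BddFormula.holds_isPair hM.out, exists_mem_range,
    isPair_iff, code_eq_code, Prod.ext_iff, and_assoc, eq_comm]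

theorem IFun.snd_aux : IFun M fun p : α × β => p.2 := by
  refine .of_formula (.bex 10 1 (.bex 11 2 (.bex 12 3 (.and (.isPair 12 10 11) (.isPair 0 12 11)))))
    [range α, range β, range (α × β)] fun p => ?_
  simp [assign, BddFormula.holds_isPair hM.out, exists_mem_range,
    isPair_iff, code_eq_code, Prod.ext_iff, and_assoc, eq_comm]

@[fun_prop]
theorem IFun.fst {f : α → β × γ} (hf : IFun M f) : IFun M fun a => (f a).1 := fst_aux.comp hf

@[fun_prop]
theorem IFun.snd {f : α → β × γ} (hf : IFun M f) : IFun M fun a => (f a).2 := snd_aux.comp hf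

/-! #### Truth values -/

-- Coding true by {∅} and false by ∅ turns predicates into internal maps to `Prop`, so that one
-- closure calculus serves both functions and predicates.
open Classical in
noncomputable instance : Coded M Prop where
  code p := if p then (hM.out.exists_singleton hM.out.empty.choose).choose else hM.out.empty.choose
  code_injective := by
    have h1 := hM.out.empty.choose_spec
    have h2 := (hM.out.exists_singleton hM.out.empty.choose).choose_spec
    have h3 : (hM.out.exists_singleton hM.out.empty.choose).choose ≠ hM.out.empty.choose := by
      intro h
      rw [h] at h2
      exact h1 _ ((h2 _).2 rfl)
    intro p q
    by_cases hp : p <;> by_cases hq : q <;> simp [hp, hq, h3, h3.symm]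
  range := (hM.out.pairing (hM.out.exists_singleton hM.out.empty.choose).choose
    hM.out.empty.choose).choose
  mem_range z := by
    rw [(hM.out.pairing (hM.out.exists_singleton hM.out.empty.choose).choose
      hM.out.empty.choose).choose_spec]
    constructor
    · rintro (rfl | rfl)
      · exact ⟨True, by simp⟩
      · exact ⟨False, by simp⟩
    · rintro ⟨p, rfl⟩
      by_cases hp : p <;> simp [hp]

theorem IPred.self : IPred M fun p : Prop => p := by
  refine .of_formula (.eq 0 1) [code True] fun p => ?_
  simp [assign, code_eq_code]

/-- The graph of P as a map to `Prop` is the set of pairs (a, p) with P a → p and p → P a, which is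
built from P by implication and conjunction. -/
theorem IPred.ifun {P : α → Prop} (hP : IPred M P) : IFun M P := by
  have h1 : IPred M fun p : α × Prop => P p.1 := hP.comp .fst_aux
  have h2 : IPred M fun p : α × Prop => p.2 := IPred.self.comp .snd_aux
  have := (h1.imp h2).and (h2.imp h1)
  simpa only [IFun, eq_iff_iff, iff_def] using this

theorem IFun.ipred {P : α → Prop} (hP : IFun M P) : IPred M P := by
  simpa using IPred.exists (P := fun a (p : Prop) => P a = p ∧ p) (hP.and (IPred.self.comp .snd_aux))

theorem IFun.imp {P Q : α → Prop} (hP : IFun M P) (hQ : IFun M Q) : IFun M fun a => P a → Q a :=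
  (hP.ipred.imp hQ.ipred).ifun

@[fun_prop]
theorem IFun.not {P : α → Prop} (hP : IFun M P) : IFun M fun a => ¬ P a := hP.ipred.not.ifun

@[fun_prop]
theorem IFun.and {P Q : α → Prop} (hP : IFun M P) (hQ : IFun M Q) : IFun M fun a => P a ∧ Q a :=
  (hP.ipred.and hQ.ipred).ifun

@[fun_prop]
theorem IFun.or {P Q : α → Prop} (hP : IFun M P) (hQ : IFun M Q) : IFun M fun a => P a ∨ Q a := by
  simpa only [imp_iff_not_or, not_not] using hP.not.imp hQ

@[fun_prop]
theorem IFun.iff {P Q : α → Prop} (hP : IFun M P) (hQ : IFun M Q) :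
    IFun M fun a => P a ↔ Q a := by
  simpa only [iff_def] using (hP.imp hQ).and (hQ.imp hP)

@[fun_prop]
theorem IFun.exists {P : α → β → Prop} (hP : IFun M fun p : α × β => P p.1 p.2) :
    IFun M fun a => ∃ b, P a b := hP.ipred.exists.ifun

@[fun_prop]
theorem IFun.eq {f g : α → β} (hf : IFun M f) (hg : IFun M g) : IFun M fun a => f a = g a :=
  ((IPred.eq M β).comp (hf.prodMk hg)).ifun

/-- The route to internality for a function obtained by external choice: if its value is unique, its
graph can be rewritten as an explicit predicate, and only that needs to be internal. -/
theorem IFun.of_graph {f : α → β} (h : IFun M fun p : α × β => f p.1 = p.2) : IFun M f := h.ipred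

/-- The registered closure rules treat ∃, ¬, ∧, ∨, ↔, equality and membership. Universal quantifiers
are brought to that form by this equivalence, and implications by `imp_iff_not_or`. -/
theorem forall_iff_not_exists {P : β → Prop} : (∀ b, P b) ↔ ¬ ∃ b, ¬ P b := by simp

open Classical in
@[fun_prop]
theorem IFun.ite {P : α → Prop} {f g : α → β} (hP : IFun M P) (hf : IFun M f) (hg : IFun M g) :
    IFun M fun a => if P a then f a else g a := by
  refine .of_graph ?_
  have h : ∀ p : α × β, ((if P p.1 then f p.1 else g p.1) = p.2) =
      ((P p.1 ∧ f p.1 = p.2) ∨ (¬ P p.1 ∧ g p.1 = p.2)) := fun p => by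
    by_cases h : P p.1 <;> simp [h]
  simp only [h]
  fun_prop

/-! #### Subtypes -/

variable (M) in
/-- The predicate `p` is internal. -/
class IsInternal (p : α → Prop) : Prop where
  out : IFun M p

/-- Elements of a subtype keep their codes, so the inclusion has a diagonal graph. -/
noncomputable instance {p : α → Prop} [hp : IsInternal M p] : Coded M {a // p a} where
  code a := code a.1
  code_injective a b h := Subtype.ext (code_injective h)
  range := hp.out.ipred.exists_set.choose
  mem_range z := by
    rw [hp.out.ipred.exists_set.choose_spec]
    exact ⟨fun ⟨a, h, e⟩ => ⟨⟨a, h⟩, e⟩, fun ⟨a, e⟩ => ⟨a.1, a.2, e⟩⟩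

@[fun_prop]
theorem IFun.subtype_val {p : β → Prop} [hp : IsInternal M p] {f : α → {b // p b}}
    (hf : IFun M f) : IFun M fun a => (f a).1 := by
  refine IFun.comp (g := fun b : {b // p b} => b.1) ?_ hf
  refine .of_formula (.bex 3 1 (.isPair 0 3 3)) [range {b // p b}] fun q => ?_
  have h (b : {b // p b}) : M.IsPair (code q) (code b) (code b) ↔ q = (b, b.1) := by
    rw [← code_eq_code (M := M)]
    exact isPair_iff (b := b.1)
  simp [assign, BddFormula.holds_isPair hM.out, exists_mem_range,
    h, Prod.ext_iff, eq_comm]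

@[fun_prop]
theorem IFun.subtype_mk {p : β → Prop} [hp : IsInternal M p] {f : α → β}
    (hf : IFun M f) (h : ∀ a, p (f a)) : IFun M fun a => (⟨f a, h a⟩ : {b // p b}) := by
  refine .of_graph ?_
  simp only [Subtype.ext_iff]
  fun_prop

/-! #### Power types -/

variable (M α) in
/-- The internal subsets of a coded type. -/
structure IPow : Type _ where
  Mem : α → Prop
  ifun : IFun M Mem

@[ext]
theorem IPow.ext {S T : IPow M α} (h : ∀ a, S.Mem a ↔ T.Mem a) : S = T := by
  cases S
  cases T
  congr
  exact funext fun a => propext (h a)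

/-- An internal subset is coded by the set of the codes of its elements. The power set of the range
is the range: every subset z of it arises, since membership in z is internal by definition. -/
noncomputable instance : Coded M (IPow M α) where
  code S := S.ifun.ipred.exists_set.choose
  code_injective S T h := by
    have hS := S.ifun.ipred.exists_set.choose_spec
    have hT := T.ifun.ipred.exists_set.choose_spec
    simp only at h
    ext a
    have h1 := hS (code a)
    rw [h, hT] at h1
    simpa [code_eq_code] using h1.symm
  range := (hM.out.powerset (range α)).choose
  mem_range z := by
    rw [(hM.out.powerset (range α)).choose_spec]
    constructor
    · intro h
      let S : IPow M α := ⟨fun a => M.Mem (code a) z, IPred.ifun ⟨z, fun a => Iff.rfl⟩⟩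
      refine ⟨S, hM.out.ext fun w => ?_⟩
      rw [S.ifun.ipred.exists_set.choose_spec]
      constructor
      · rintro ⟨a, h, rfl⟩
        exact h
      · intro hw
        obtain ⟨a, rfl⟩ := (mem_range w).1 (h w hw)
        exact ⟨a, hw, rfl⟩
    · rintro ⟨S, rfl⟩ w
      rw [S.ifun.ipred.exists_set.choose_spec]
      rintro ⟨a, h, rfl⟩
      exact code_mem_range a

theorem mem_code_pow {S : IPow M α} {z : M.V} : M.Mem z (code S) ↔ ∃ a, S.Mem a ∧ code a = z :=
  S.ifun.ipred.exists_set.choose_spec z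

theorem code_mem_code_pow {S : IPow M α} {a : α} : M.Mem (code a) (code S) ↔ S.Mem a := by
  simp [mem_code_pow, code_eq_code]

@[fun_prop]
theorem IFun.mem {f : α → IPow M β} {g : α → β} (hf : IFun M f) (hg : IFun M g) :
    IFun M fun a => (f a).Mem (g a) := by
  refine IFun.comp (g := fun p : IPow M β × β => p.1.Mem p.2) (IPred.ifun ?_) (hf.prodMk hg)
  refine .of_formula (.bex 3 1 (.bex 4 2 (.and (.isPair 0 3 4) (.mem 4 3))))
    [range (IPow M β), range β] fun p => ?_
  simp [assign, BddFormula.holds_isPair hM.out, exists_mem_range,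
    isPair_iff, code_eq_code, code_mem_code_pow, Prod.ext_iff, and_assoc]

-- Comprehension terms depend internally on their parameters: by extensionality, {b | P a b} = T is
-- a statement quantified over b.
@[fun_prop]
theorem IFun.pow_mk {P : α → β → Prop} (hP : IFun M fun p : α × β => P p.1 p.2)
    (h : ∀ a, IFun M (P a)) : IFun M fun a => (⟨P a, h a⟩ : IPow M β) := by
  refine .of_graph ?_
  simp only [IPow.ext_iff, forall_iff_not_exists]
  fun_prop

end

end MTT

namespace MTT

/-! ### Internal sites and sheaves -/

open CategoryTheory

variable (M : Struc.{u}) [hM : Fact M.IsModel]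

/-- An internal site, with the category in a one-sorted style: `comp g h` is `g ∘ h`, and is
meaningful only for `cod h = dom g`. -/
structure ISite where
  Ob : Type u
  Ar : Type u
  [codedOb : Coded M Ob]
  [codedAr : Coded M Ar]
  dom : Ar → Ob
  cod : Ar → Ob
  id : Ob → Ar
  comp : Ar → Ar → Ar
  ifun_dom : IFun M dom
  ifun_cod : IFun M cod
  ifun_id : IFun M id
  ifun_comp : IFun M fun p : Ar × Ar => comp p.1 p.2
  dom_id : ∀ A, dom (id A) = A
  cod_id : ∀ A, cod (id A) = A
  dom_comp : ∀ g h, cod h = dom g → dom (comp g h) = dom h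
  cod_comp : ∀ g h, cod h = dom g → cod (comp g h) = cod g
  comp_id : ∀ g, comp g (id (dom g)) = g
  id_comp : ∀ g, comp (id (cod g)) g = g
  assoc : ∀ g h k, cod h = dom g → cod k = dom h → comp (comp g h) k = comp g (comp h k)
  Cov : Ob → IPow M Ar → Prop
  ifun_cov : IFun M fun p : Ob × IPow M Ar => Cov p.1 p.2
  cov_cod : ∀ A S f, Cov A S → S.Mem f → cod f = A
  cov_comp : ∀ A S f h, Cov A S → S.Mem f → cod h = dom f → S.Mem (comp f h)
  cov_max : ∀ A S, (∀ f, S.Mem f ↔ cod f = A) → Cov A S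
  cov_pullback : ∀ S T g, Cov (cod g) S →
    (∀ h, T.Mem h ↔ cod h = dom g ∧ S.Mem (comp g h)) → Cov (dom g) T
  cov_trans : ∀ A S R, Cov A S → (∀ f, R.Mem f → cod f = A) →
    (∀ f h, R.Mem f → cod h = dom f → R.Mem (comp f h)) →
    (∀ f T, S.Mem f → (∀ h, T.Mem h ↔ cod h = dom f ∧ R.Mem (comp f h)) → Cov (dom f) T) →
    Cov A R

attribute [instance] ISite.codedOb ISite.codedAr

namespace ISite

variable {M} (X : ISite M) {α : Type*} [Coded M α]

@[fun_prop]
theorem ifun_dom_comp {f : α → X.Ar} (hf : IFun M f) : IFun M fun a => X.dom (f a) :=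
  X.ifun_dom.comp hf

@[fun_prop]
theorem ifun_cod_comp {f : α → X.Ar} (hf : IFun M f) : IFun M fun a => X.cod (f a) :=
  X.ifun_cod.comp hf

@[fun_prop]
theorem ifun_id_comp {f : α → X.Ob} (hf : IFun M f) : IFun M fun a => X.id (f a) :=
  X.ifun_id.comp hf

@[fun_prop]
theorem ifun_comp_comp {f g : α → X.Ar} (hf : IFun M f) (hg : IFun M g) :
    IFun M fun a => X.comp (f a) (g a) :=
  X.ifun_comp.comp (hf.prodMk hg)

@[fun_prop]
theorem ifun_cov_comp {f : α → X.Ob} {g : α → IPow M X.Ar} (hf : IFun M f) (hg : IFun M g) :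
    IFun M fun a => X.Cov (f a) (g a) :=
  X.ifun_cov.comp (hf.prodMk hg)

/-- The pullback of a sieve. -/
def pull (g : X.Ar) (S : IPow M X.Ar) : IPow M X.Ar :=
  ⟨fun h => X.cod h = X.dom g ∧ S.Mem (X.comp g h), by fun_prop⟩

theorem cov_pull {S : IPow M X.Ar} {A : X.Ob} (h : X.Cov A S) {g : X.Ar} (hg : X.cod g = A) :
    X.Cov (X.dom g) (X.pull g S) :=
  X.cov_pullback S _ g (hg ▸ h) fun _ => Iff.rfl

/-- A sieve R containing a covering sieve S pulls back to the maximal sieve along every member of S,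
so the transitivity axiom makes R covering. -/
theorem cov_mono {A : X.Ob} {S R : IPow M X.Ar} (hS : X.Cov A S) (h1 : ∀ f, R.Mem f → X.cod f = A)
    (h2 : ∀ f h, R.Mem f → X.cod h = X.dom f → R.Mem (X.comp f h))
    (h : ∀ f, S.Mem f → R.Mem f) : X.Cov A R :=
  X.cov_trans A S R hS h1 h2 fun f T hf hT => X.cov_max _ _ fun k => by
    rw [hT]
    exact and_iff_left_of_imp fun hk => h2 f k (h f hf) hk

end ISite

variable {M}

/-- A sheaf on an internal site.  Outside its domain, the action `act` of the arrows is trivial. -/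
structure ISheaf (X : ISite M) where
  El : Type u
  [coded : Coded M El]
  idx : El → X.Ob
  act : El → X.Ar → El
  ifun_idx : IFun M idx
  ifun_act : IFun M fun p : El × X.Ar => act p.1 p.2
  act_of_ne : ∀ x f, idx x ≠ X.cod f → act x f = x
  idx_act : ∀ x f, idx x = X.cod f → idx (act x f) = X.dom f
  act_id : ∀ x, act x (X.id (idx x)) = x
  act_act : ∀ x f g, idx x = X.cod f → X.cod g = X.dom f →
    act (act x f) g = act x (X.comp f g)
  glue : ∀ A (S : IPow M X.Ar) (R : IPow M (X.Ar × El)), X.Cov A S →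
    (∀ f x, R.Mem (f, x) → S.Mem f ∧ idx x = X.dom f) → (∀ f, S.Mem f → ∃ x, R.Mem (f, x)) →
    (∀ f f' x x' g g', R.Mem (f, x) → R.Mem (f', x') → X.cod g = X.dom f → X.cod g' = X.dom f' →
      X.comp f g = X.comp f' g' → act x g = act x' g') →
    ∃! a, idx a = A ∧ ∀ f x, R.Mem (f, x) → act a f = x

attribute [instance] ISheaf.coded

namespace ISheaf

variable {X : ISite M} (F : ISheaf X) {α : Type*} [Coded M α]

@[fun_prop]
theorem ifun_idx_comp {f : α → F.El} (hf : IFun M f) : IFun M fun a => F.idx (f a) :=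
  F.ifun_idx.comp hf

@[fun_prop]
theorem ifun_act_comp {f : α → F.El} {g : α → X.Ar} (hf : IFun M f) (hg : IFun M g) :
    IFun M fun a => F.act (f a) (g a) :=
  F.ifun_act.comp (hf.prodMk hg)

/-- This is the uniqueness half of `glue`, applied to the family of the restrictions of a. -/
theorem separated {A : X.Ob} {S : IPow M X.Ar} (hS : X.Cov A S) {a b : F.El} (ha : F.idx a = A)
    (hb : F.idx b = A) (h : ∀ f, S.Mem f → F.act a f = F.act b f) : a = b := by
  refine (F.glue A S ⟨fun p => S.Mem p.1 ∧ F.act a p.1 = p.2, by fun_prop⟩ hS ?_ ?_ ?_).unique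
    ⟨ha, ?_⟩ ⟨hb, ?_⟩ <;> dsimp only
  · rintro f _ ⟨hf, rfl⟩
    exact ⟨hf, F.idx_act _ _ (ha.trans (X.cov_cod _ _ _ hS hf).symm)⟩
  · exact fun f hf => ⟨F.act a f, hf, rfl⟩
  · rintro f f' _ _ g g' ⟨hf, rfl⟩ ⟨hf', rfl⟩ hg hg' e
    rw [F.act_act _ _ _ (ha.trans (X.cov_cod _ _ _ hS hf).symm) hg,
      F.act_act _ _ _ (ha.trans (X.cov_cod _ _ _ hS hf').symm) hg', e]
  · rintro f _ ⟨hf, rfl⟩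
    rfl
  · rintro f _ ⟨hf, rfl⟩
    exact (h f hf).symm

/-- Maps of sheaves. -/
@[ext]
structure Hom (F G : ISheaf X) where
  toFun : F.El → G.El
  ifun : IFun M toFun
  idx_map : ∀ x, G.idx (toFun x) = F.idx x
  map_act' : ∀ x f, F.idx x = X.cod f → toFun (F.act x f) = G.act (toFun x) f

attribute [simp] Hom.idx_map

variable {F}

/-- Off the domain of the action both sides are trivial, so compatibility holds for all x and f and
no side condition needs to be carried along. -/
theorem Hom.map_act {G : ISheaf X} (φ : F.Hom G) (x : F.El) (f : X.Ar) :
    φ.toFun (F.act x f) = G.act (φ.toFun x) f := by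
  by_cases h : F.idx x = X.cod f
  · exact φ.map_act' x f h
  · rw [F.act_of_ne _ _ h, G.act_of_ne _ _ (by simpa using h)]

@[fun_prop]
theorem Hom.ifun_comp {G : ISheaf X} (φ : F.Hom G) {f : α → F.El} (hf : IFun M f) :
    IFun M fun a => φ.toFun (f a) :=
  φ.ifun.comp hf

instance : Category (ISheaf X) where
  Hom := Hom
  id F := ⟨fun x => x, by fun_prop, fun _ => rfl, fun _ _ _ => rfl⟩
  comp φ ψ := ⟨fun x => ψ.toFun (φ.toFun x), by fun_prop, by simp,
    fun x f h => by rw [φ.map_act, ψ.map_act]⟩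

theorem hom_ext {F G : ISheaf X} {φ ψ : F ⟶ G} (h : ∀ x, φ.toFun x = ψ.toFun x) : φ = ψ :=
  Hom.ext (funext h)

@[simp] theorem comp_toFun {F G H : ISheaf X} (φ : F ⟶ G) (ψ : G ⟶ H) (x : F.El) :
    (φ ≫ ψ).toFun x = ψ.toFun (φ.toFun x) := rfl

theorem congr_toFun {F G : ISheaf X} {φ ψ : F ⟶ G} (h : φ = ψ) (x : F.El) :
    φ.toFun x = ψ.toFun x := h ▸ rfl

/-! #### The terminal sheaf -/

variable (X) in
open Classical in
/-- The terminal sheaf: one element over every object. -/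
@[reducible]
noncomputable def terminal : ISheaf X where
  El := X.Ob
  idx A := A
  act A f := if A = X.cod f then X.dom f else A
  ifun_idx := by fun_prop
  ifun_act := by fun_prop
  act_of_ne x f h := if_neg h
  idx_act x f h := if_pos h
  act_id A := by simp [X.dom_id]
  act_act A f g h h' := by simp [h, h', X.cod_comp, X.dom_comp]
  glue A S R hS h1 h2 h3 := by
    refine ⟨A, ⟨rfl, fun f x hx => ?_⟩, fun B hB => hB.1⟩
    rw [if_pos (X.cov_cod _ _ _ hS (h1 f x hx).1).symm, (h1 f x hx).2]

/-- The map to the terminal sheaf. -/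
@[reducible]
noncomputable def toTerminal (F : ISheaf X) : F ⟶ terminal X where
  toFun := F.idx
  ifun := F.ifun_idx
  idx_map _ := rfl
  map_act' x f h := by
    rw [F.idx_act _ _ h]
    exact (if_pos h).symm

variable (X) in
/-- The terminal sheaf is terminal. -/
noncomputable def isTerminalTerminal : Limits.IsTerminal (terminal X) :=
  Limits.IsTerminal.ofUniqueHom toTerminal fun _ φ => hom_ext fun x => φ.idx_map x

/-! #### Pullbacks -/

section Pullback

variable {F G H : ISheaf X} (φ : F ⟶ H) (ψ : G ⟶ H)

instance : IsInternal M fun p : F.El × G.El => φ.toFun p.1 = ψ.toFun p.2 :=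
  ⟨by fun_prop⟩

variable {φ ψ} in
theorem idx_eq_of_map_eq {x : F.El} {y : G.El} (h : φ.toFun x = ψ.toFun y) :
    G.idx y = F.idx x := by
  rw [← φ.idx_map, ← ψ.idx_map, h]

/-- The pullback of two maps of sheaves. -/
@[reducible]
noncomputable def pullback : ISheaf X where
  El := {p : F.El × G.El // φ.toFun p.1 = ψ.toFun p.2}
  idx p := F.idx p.1.1
  act p f := ⟨(F.act p.1.1 f, G.act p.1.2 f), by simp only [Hom.map_act, p.2]⟩
  ifun_idx := by fun_prop
  ifun_act := by fun_prop
  act_of_ne p f h := by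
    ext
    · exact F.act_of_ne _ _ h
    · exact G.act_of_ne _ _ fun e => h ((idx_eq_of_map_eq p.2).symm.trans e)
  idx_act p f h := F.idx_act _ _ h
  act_id p := by
    ext
    · exact F.act_id _
    · change G.act p.1.2 (X.id (F.idx p.1.1)) = _
      rw [← idx_eq_of_map_eq p.2, G.act_id]
  act_act p f g h h' := by
    ext
    · exact F.act_act _ _ _ h h'
    · exact G.act_act _ _ _ ((idx_eq_of_map_eq p.2).trans h) h'
  glue A S R hS h1 h2 h3 := by
    obtain ⟨a, ⟨ha, ha'⟩, -⟩ := F.glue A S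
      ⟨fun q => ∃ p : {p : F.El × G.El // φ.toFun p.1 = ψ.toFun p.2}, R.Mem (q.1, p) ∧ p.1.1 = q.2,
        by fun_prop⟩ hS
      (by rintro f _ ⟨p, hp, rfl⟩; exact h1 _ _ hp)
      (fun f hf => let ⟨p, hp⟩ := h2 f hf; ⟨_, p, hp, rfl⟩)
      (by
        rintro f f' _ _ g g' ⟨p, hp, rfl⟩ ⟨p', hp', rfl⟩ hg hg' e
        exact congrArg (fun p => p.1.1) (h3 _ _ _ _ _ _ hp hp' hg hg' e))
    obtain ⟨b, ⟨hb, hb'⟩, -⟩ := G.glue A S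
      ⟨fun q => ∃ p : {p : F.El × G.El // φ.toFun p.1 = ψ.toFun p.2}, R.Mem (q.1, p) ∧ p.1.2 = q.2,
        by fun_prop⟩ hS
      (by
        rintro f _ ⟨p, hp, rfl⟩
        exact ⟨(h1 _ _ hp).1, (idx_eq_of_map_eq p.2).trans (h1 _ _ hp).2⟩)
      (fun f hf => let ⟨p, hp⟩ := h2 f hf; ⟨_, p, hp, rfl⟩)
      (by
        rintro f f' _ _ g g' ⟨p, hp, rfl⟩ ⟨p', hp', rfl⟩ hg hg' e
        exact congrArg (fun p => p.1.2) (h3 _ _ _ _ _ _ hp hp' hg hg' e))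
    -- The coordinates are glued separately; their images in H agree on the cover, hence are equal
    -- because H is separated.
    have hab : φ.toFun a = ψ.toFun b := by
      refine H.separated hS (by simpa using ha) (by simpa using hb) fun f hf => ?_
      obtain ⟨p, hp⟩ := h2 f hf
      rw [← φ.map_act, ← ψ.map_act, ha' f _ ⟨p, hp, rfl⟩, hb' f _ ⟨p, hp, rfl⟩, p.2]
    refine ⟨⟨(a, b), hab⟩, ⟨ha, fun f p hp => ?_⟩, ?_⟩
    · ext
      · exact ha' f _ ⟨p, hp, rfl⟩
      · exact hb' f _ ⟨p, hp, rfl⟩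
    · rintro p ⟨hp, hp'⟩
      ext
      · refine F.separated hS hp ha fun f hf => ?_
        obtain ⟨q, hq⟩ := h2 f hf
        rw [ha' f _ ⟨q, hq, rfl⟩, ← hp' f q hq]
      · refine G.separated hS ((idx_eq_of_map_eq p.2).trans hp) hb fun f hf => ?_
        obtain ⟨q, hq⟩ := h2 f hf
        rw [hb' f _ ⟨q, hq, rfl⟩, ← hp' f q hq]

/-- The first projection of the pullback. -/
noncomputable def pullbackFst : pullback φ ψ ⟶ F where
  toFun p := p.1.1
  ifun := by change IFun M fun p : {p : F.El × G.El // φ.toFun p.1 = ψ.toFun p.2} => _; fun_prop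
  idx_map p := rfl
  map_act' p f h := rfl

/-- The second projection of the pullback. -/
noncomputable def pullbackSnd : pullback φ ψ ⟶ G where
  toFun p := p.1.2
  ifun := by change IFun M fun p : {p : F.El × G.El // φ.toFun p.1 = ψ.toFun p.2} => _; fun_prop
  idx_map p := idx_eq_of_map_eq (φ := φ) (ψ := ψ) p.2
  map_act' p f h := rfl

variable {φ ψ} in
/-- The map to a pullback. -/
noncomputable def pullbackLift {K : ISheaf X} (a : K ⟶ F) (b : K ⟶ G) (h : a ≫ φ = b ≫ ψ) :
    K ⟶ pullback φ ψ where
  toFun x := ⟨(a.toFun x, b.toFun x), congr_toFun h x⟩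
  ifun := by
    change IFun M fun x => (_ : {p : F.El × G.El // φ.toFun p.1 = ψ.toFun p.2})
    fun_prop
  idx_map x := a.idx_map x
  map_act' x f h := Subtype.ext (Prod.ext (a.map_act x f) (b.map_act x f))

theorem isPullback_pullback : IsPullback (pullbackFst φ ψ) (pullbackSnd φ ψ) φ ψ where
  w := hom_ext fun p => p.2
  isLimit' := ⟨Limits.PullbackCone.IsLimit.mk _ (fun s => pullbackLift s.fst s.snd s.condition)
    (fun _ => rfl) (fun _ => rfl) (fun _ _ h1 h2 => hom_ext fun x =>
      Subtype.ext (Prod.ext (congr_toFun h1 x) (congr_toFun h2 x)))⟩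

-- Comparison with the explicit pullback shows that the elements of any pullback are the compatible
-- pairs. Abstract pullback squares can thus be used elementwise.
variable {φ ψ} in
theorem existsUnique_of_isPullback {P : ISheaf X} {p : P ⟶ F} {q : P ⟶ G}
    (h : IsPullback p q φ ψ) {x : F.El} {y : G.El} (hxy : φ.toFun x = ψ.toFun y) :
    ∃! z, p.toFun z = x ∧ q.toFun z = y := by
  let e := (isPullback_pullback φ ψ).isoIsPullback _ _ h
  have h1 : e.hom ≫ p = pullbackFst φ ψ := (isPullback_pullback φ ψ).isoIsPullback_hom_fst _ _ h
  have h2 : e.hom ≫ q = pullbackSnd φ ψ := (isPullback_pullback φ ψ).isoIsPullback_hom_snd _ _ h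
  have h3 : e.inv ≫ pullbackFst φ ψ = p := (isPullback_pullback φ ψ).isoIsPullback_inv_fst _ _ h
  have h4 : e.inv ≫ pullbackSnd φ ψ = q := (isPullback_pullback φ ψ).isoIsPullback_inv_snd _ _ h
  refine ⟨e.hom.toFun ⟨(x, y), hxy⟩, ⟨congr_toFun h1 _, congr_toFun h2 _⟩, ?_⟩
  rintro z ⟨rfl, rfl⟩
  have h5 : e.inv.toFun z = ⟨(p.toFun z, q.toFun z), hxy⟩ :=
    Subtype.ext (Prod.ext (congr_toFun h3 z) (congr_toFun h4 z))
  rw [← h5]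
  exact (congr_toFun e.inv_hom_id z).symm

end Pullback

/-- The two projections of the kernel pair have equal composites with φ, hence are equal; evaluating
them at (x, y) gives the claim. -/
theorem injective_of_mono {F G : ISheaf X} (φ : F ⟶ G) [Mono φ] :
    Function.Injective φ.toFun := fun x y h => by
  have := (isPullback_pullback φ φ).w
  rw [cancel_mono] at this
  exact congr_toFun this ⟨(x, y), h⟩

end ISheaf

end MTT

namespace MTT

open CategoryTheory

variable {M : Struc.{u}} [hM : Fact M.IsModel]

namespace ISheaf

variable {X : ISite M}

/-! ### Matching families -/

section Matching

variable {E : Type u} [Coded M E] {idx : E → X.Ob} {act : E → X.Ar → E}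
  (act_id : ∀ x, act x (X.id (idx x)) = x) {S : IPow M X.Ar} {R : IPow M (X.Ar × E)}
  (h1 : ∀ f x, R.Mem (f, x) → S.Mem f ∧ idx x = X.dom f)
  (h3 : ∀ f f' x x' g g', R.Mem (f, x) → R.Mem (f', x') → X.cod g = X.dom f →
    X.cod g' = X.dom f' → X.comp f g = X.comp f' g' → act x g = act x' g')

include act_id h1 h3

/-- The matching condition is applied to the two factorisations (f ∘ g) = f ∘ g = (f ∘ g) ∘ id. -/
theorem matching_act {f g : X.Ar} {x y : E} (hx : R.Mem (f, x)) (hy : R.Mem (X.comp f g, y))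
    (hg : X.cod g = X.dom f) : y = act x g := by
  have hy' := (h1 _ _ hy).2
  have := h3 _ _ _ _ g (X.id (idx y)) hx hy hg (by rw [X.cod_id, hy']) (by rw [hy', X.comp_id])
  rw [this, act_id]

/-- Families are given as relations in `glue`; that they are single-valued follows from matching
along identities and so is not required separately. -/
theorem matching_unique {f : X.Ar} {x y : E} (hx : R.Mem (f, x)) (hy : R.Mem (f, y)) : x = y := by
  have := h3 _ _ _ _ (X.id (X.dom f)) (X.id (X.dom f)) hx hy (X.cod_id _) (X.cod_id _) rfl
  rw [← act_id x, ← act_id y, (h1 _ _ hx).2, (h1 _ _ hy).2, this]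

end Matching

/-! #### Exponentials -/

section Exponential

variable (F G : ISheaf X)

/-- The graph `θ.2` is a transformation from `y(A) × F` to `G`, with `A = θ.1`. -/
structure IsTransformation (θ : X.Ob × IPow M (X.Ar × F.El × G.El)) : Prop where
  lies : ∀ k x y, θ.2.Mem (k, x, y) →
    X.cod k = θ.1 ∧ F.idx x = X.dom k ∧ G.idx y = X.dom k
  exists_mem : ∀ k x, X.cod k = θ.1 → F.idx x = X.dom k → ∃ y, θ.2.Mem (k, x, y)
  unique : ∀ k x y y', θ.2.Mem (k, x, y) → θ.2.Mem (k, x, y') → y = y'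
  natural : ∀ k x y l, θ.2.Mem (k, x, y) → X.cod l = X.dom k →
    θ.2.Mem (X.comp k l, F.act x l, G.act y l)

/-- Unfolded as a conjunction of quantified statements, the notion falls under the closure rules for
internal predicates. -/
theorem isTransformation_iff (θ : X.Ob × IPow M (X.Ar × F.El × G.El)) :
    IsTransformation F G θ ↔
      (∀ k x y, θ.2.Mem (k, x, y) → X.cod k = θ.1 ∧ F.idx x = X.dom k ∧ G.idx y = X.dom k) ∧
      (∀ k x, X.cod k = θ.1 → F.idx x = X.dom k → ∃ y, θ.2.Mem (k, x, y)) ∧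
      (∀ k x y y', θ.2.Mem (k, x, y) → θ.2.Mem (k, x, y') → y = y') ∧
      ∀ k x y l, θ.2.Mem (k, x, y) → X.cod l = X.dom k →
        θ.2.Mem (X.comp k l, F.act x l, G.act y l) :=
  ⟨fun ⟨h1, h2, h3, h4⟩ => ⟨h1, h2, h3, h4⟩, fun ⟨h1, h2, h3, h4⟩ => ⟨h1, h2, h3, h4⟩⟩

instance : IsInternal M (IsTransformation F G) := ⟨by
  change IFun M fun θ => IsTransformation F G θ
  simp only [isTransformation_iff, forall_iff_not_exists, imp_iff_not_or]
  fun_prop⟩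

variable {F G}

open Classical in
/-- The restriction of a transformation from `y(A) × F` to `G` along an arrow to `A`. -/
noncomputable def restrict (θ : X.Ob × IPow M (X.Ar × F.El × G.El)) (h : X.Ar) :
    X.Ob × IPow M (X.Ar × F.El × G.El) :=
  (if θ.1 = X.cod h then X.dom h else θ.1,
    ⟨fun q => (θ.1 = X.cod h ∧ X.cod q.1 = X.dom h ∧ θ.2.Mem (X.comp h q.1, q.2)) ∨
      (¬ θ.1 = X.cod h ∧ θ.2.Mem q), by fun_prop⟩)

variable (F G) in
theorem ifun_restrict : IFun M fun p : (X.Ob × IPow M (X.Ar × F.El × G.El)) × X.Ar =>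
    restrict p.1 p.2 := by
  unfold restrict
  fun_prop

@[fun_prop]
theorem ifun_restrict_comp {α : Type*} [Coded M α]
    {f : α → X.Ob × IPow M (X.Ar × F.El × G.El)} {g : α → X.Ar} (hf : IFun M f) (hg : IFun M g) :
    IFun M fun a => restrict (f a) (g a) :=
  (ifun_restrict F G).comp (hf.prodMk hg)

section

variable {θ : X.Ob × IPow M (X.Ar × F.El × G.El)} {h : X.Ar}

theorem restrict_of_ne (H : ¬ θ.1 = X.cod h) : restrict θ h = θ := by
  simp [restrict, H]

theorem restrict_fst (H : θ.1 = X.cod h) : (restrict θ h).1 = X.dom h := if_pos H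

theorem restrict_mem (H : θ.1 = X.cod h) {k : X.Ar} {x : F.El} {y : G.El} :
    (restrict θ h).2.Mem (k, x, y) ↔ X.cod k = X.dom h ∧ θ.2.Mem (X.comp h k, x, y) := by
  simp [restrict, H]

theorem IsTransformation.restrict (H : IsTransformation F G θ) :
    IsTransformation F G (restrict θ h) := by
  by_cases e : θ.1 = X.cod h
  · refine ⟨fun k x y => ?_, fun k x => ?_, fun k x y y' => ?_, fun k x y l => ?_⟩ <;>
      simp only [restrict_mem e, restrict_fst e]
    · rintro ⟨h1, h2⟩
      have := (H.lies _ _ _ h2).2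
      rw [X.dom_comp _ _ h1] at this
      exact ⟨h1, this⟩
    · intro h1 h2
      obtain ⟨y, hy⟩ := H.exists_mem (X.comp h k) x (by rw [X.cod_comp _ _ h1, e])
        (by rw [X.dom_comp _ _ h1, h2])
      exact ⟨y, h1, hy⟩
    · rintro ⟨-, h1⟩ ⟨-, h2⟩
      exact H.unique _ _ _ _ h1 h2
    · rintro ⟨h1, h2⟩ h3
      refine ⟨(X.cod_comp _ _ h3).trans h1, ?_⟩
      rw [← X.assoc _ _ _ h1 h3]
      exact H.natural _ _ _ _ h2 (by rw [X.dom_comp _ _ h1, h3])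
  · rwa [restrict_of_ne e]

end

theorem restrict_id {θ : X.Ob × IPow M (X.Ar × F.El × G.El)} (H : IsTransformation F G θ) :
    restrict θ (X.id θ.1) = θ := by
  have h := (X.cod_id θ.1).symm
  refine Prod.ext ((restrict_fst h).trans (X.dom_id _)) (IPow.ext ?_)
  rintro ⟨k, x, y⟩
  simp only [restrict_mem h, X.dom_id]
  constructor
  · rintro ⟨h1, h2⟩
    rwa [← h1, X.id_comp] at h2
  · intro h1
    have h2 := (H.lies _ _ _ h1).1
    exact ⟨h2, by rwa [← h2, X.id_comp]⟩

section

variable (A : X.Ob) (R : IPow M (X.Ar × {θ // IsTransformation F G θ}))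

/-- The amalgamation of a matching family of transformations. -/
def amalgam : X.Ob × IPow M (X.Ar × F.El × G.El) :=
  (A, ⟨fun q => X.cod q.1 = A ∧ F.idx q.2.1 = X.dom q.1 ∧ G.idx q.2.2 = X.dom q.1 ∧
    -- The value at (k, x) is the y whose restrictions are the local values: whenever k ∘ l lies in
    -- the cover, the transformation there, evaluated at the identity, sends x · l to y · l.
    ∀ l a, X.cod l = X.dom q.1 → R.Mem (X.comp q.1 l, a) →
      a.1.2.Mem (X.id (X.dom l), F.act q.2.1 l, G.act q.2.2 l), by
    simp only [forall_iff_not_exists, imp_iff_not_or]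
    fun_prop⟩)

variable {A R}

theorem mem_amalgam {h : X.Ar} {x : F.El} {y : G.El} : (amalgam A R).2.Mem (h, x, y) ↔
    X.cod h = A ∧ F.idx x = X.dom h ∧ G.idx y = X.dom h ∧
    ∀ l a, X.cod l = X.dom h → R.Mem (X.comp h l, a) →
      a.1.2.Mem (X.id (X.dom l), F.act x l, G.act y l) := Iff.rfl

variable {S : IPow M X.Ar} (hS : X.Cov A S)
  (h1 : ∀ f a, R.Mem (f, a) → S.Mem f ∧ a.1.1 = X.dom f) (h2 : ∀ f, S.Mem f → ∃ a, R.Mem (f, a))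
  (h4 : ∀ f g a b, R.Mem (f, a) → R.Mem (X.comp f g, b) → X.cod g = X.dom f →
    b.1 = restrict a.1 g)

-- A value at (h, x) is obtained by gluing in G the local values over the pulled back cover h*S, and
-- it is unique because G is separated.
include hS h1 h2 h4 in
theorem isTransformation_amalgam : IsTransformation F G (amalgam A R) := by
  refine ⟨fun k x y h => ?_, fun h x hh hx => ?_, fun h x y y' hy hy' => ?_,
    fun h x y l hy hl => ?_⟩
  · rw [mem_amalgam] at h
    exact ⟨h.1, h.2.1, h.2.2.1⟩
  · have hh : X.cod h = A := hh
    have hi : ∀ l, X.cod l = X.dom h → X.dom (X.comp h l) = X.dom l := fun l => X.dom_comp h l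
    obtain ⟨y, ⟨hy, hy'⟩, -⟩ := G.glue (X.dom h) (X.pull h S)
      ⟨fun q => X.cod q.1 = X.dom h ∧ ∃ a, R.Mem (X.comp h q.1, a) ∧
        a.1.2.Mem (X.id (X.dom q.1), F.act x q.1, q.2), by fun_prop⟩ (X.cov_pull hS hh)
      (by
        rintro l y ⟨hl, a, ha, hy⟩
        exact ⟨⟨hl, (h1 _ _ ha).1⟩, by rw [(a.2.lies _ _ _ hy).2.2, X.dom_id]⟩)
      (by
        rintro l ⟨hl, hs⟩
        obtain ⟨a, ha⟩ := h2 _ hs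
        obtain ⟨y, hy⟩ := a.2.exists_mem (X.id (X.dom l)) (F.act x l)
          (by rw [X.cod_id, (h1 _ _ ha).2, hi l hl])
          (by rw [F.idx_act _ _ (hx.trans hl.symm), X.dom_id])
        exact ⟨y, hl, a, ha, hy⟩)
      (by
        rintro l l' y y' g g' ⟨hl, a, ha, hy⟩ ⟨hl', a', ha', hy'⟩ hg hg' e
        have hd : X.dom g = X.dom g' := by rw [← X.dom_comp _ _ hg, e, X.dom_comp _ _ hg']
        have h5 := a.2.natural _ _ _ g hy (by rw [X.dom_id, hg])
        have h6 := a'.2.natural _ _ _ g' hy' (by rw [X.dom_id, hg'])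
        rw [← hg, X.id_comp, F.act_act _ _ _ (hx.trans hl.symm) hg] at h5
        rw [← hg', X.id_comp, F.act_act _ _ _ (hx.trans hl'.symm) hg', ← e] at h6
        -- The local values match because both transformations restrict to the one b attached to the
        -- common composite h ∘ l ∘ g, and b is single-valued.
        obtain ⟨b, hb⟩ := h2 (X.comp (X.comp h l) g) (X.cov_comp _ _ _ _ hS (h1 _ _ ha).1
          (by rw [hi l hl, hg]))
        have h7 := h4 _ _ _ _ ha hb (by rw [hi l hl, hg])
        have h8 := h4 (X.comp h l') g' a' b ha' (by
          rwa [X.assoc _ _ _ hl' hg', ← e, ← X.assoc _ _ _ hl hg]) (by rw [hi l' hl', hg'])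
        have h9 := (restrict_mem ((h1 _ _ ha).2.trans ((hi l hl).trans hg.symm))
          (k := X.id (X.dom g)) (x := F.act x (X.comp l g)) (y := G.act y g)).2
          ⟨X.cod_id _, by rwa [X.comp_id]⟩
        have h10 := (restrict_mem ((h1 _ _ ha').2.trans ((hi l' hl').trans hg'.symm))
          (k := X.id (X.dom g')) (x := F.act x (X.comp l g)) (y := G.act y' g')).2
          ⟨X.cod_id _, by rwa [X.comp_id]⟩
        rw [← h7] at h9
        rw [← h8, ← hd] at h10
        exact b.2.unique _ _ _ _ h9 h10)
    refine ⟨y, mem_amalgam.2 ⟨hh, hx, hy, fun l a hl ha => ?_⟩⟩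
    obtain ⟨y', h5⟩ := a.2.exists_mem (X.id (X.dom l)) (F.act x l)
      (by rw [X.cod_id, (h1 _ _ ha).2, hi l hl])
      (by rw [F.idx_act _ _ (hx.trans hl.symm), X.dom_id])
    rwa [hy' l y' ⟨hl, a, ha, h5⟩]
  · rw [mem_amalgam] at hy hy'
    refine G.separated (X.cov_pull hS hy.1) hy.2.2.1 hy'.2.2.1 ?_
    rintro l ⟨hl, hs⟩
    obtain ⟨a, ha⟩ := h2 _ hs
    exact a.2.unique _ _ _ _ (hy.2.2.2 l a hl ha) (hy'.2.2.2 l a hl ha)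
  · rw [mem_amalgam] at hy ⊢
    obtain ⟨h5, h6, h7, h8⟩ := hy
    have hd := X.dom_comp _ _ hl
    refine ⟨(X.cod_comp _ _ hl).trans h5, ?_, ?_, fun j a hj ha => ?_⟩
    · rw [hd, F.idx_act _ _ (h6.trans hl.symm)]
    · rw [hd, G.idx_act _ _ (h7.trans hl.symm)]
    · rw [hd] at hj
      rw [X.assoc _ _ _ hl hj] at ha
      have := h8 _ a ((X.cod_comp _ _ hj).trans hl) ha
      rwa [X.dom_comp _ _ hj, ← F.act_act _ _ _ (h6.trans hl.symm) hj,
        ← G.act_act _ _ _ (h7.trans hl.symm) hj] at this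

include hS h1 h2 h4 in
theorem restrict_amalgam {f : X.Ar} {a : {θ // IsTransformation F G θ}} (ha : R.Mem (f, a)) :
    restrict (amalgam A R) f = a.1 := by
  have hA : (amalgam A R).1 = X.cod f := (X.cov_cod _ _ _ hS (h1 _ _ ha).1).symm
  have hT := isTransformation_amalgam hS h1 h2 h4
  -- One inclusion of graphs suffices, since both graphs are total and single-valued. It comes from
  -- testing the amalgam at l = id.
  have key : ∀ g x y, X.cod g = X.dom f → (amalgam A R).2.Mem (X.comp f g, x, y) →
      a.1.2.Mem (g, x, y) := by
    intro g x y hg h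
    rw [mem_amalgam] at h
    obtain ⟨h5, h6, h7, h8⟩ := h
    obtain ⟨b, hb⟩ := h2 _ (X.cov_comp _ _ _ _ hS (h1 _ _ ha).1 hg)
    rw [X.dom_comp _ _ hg] at h6 h7 h8
    have h9 := h8 (X.id (X.dom g)) b (X.cod_id _) (by
      rwa [← X.dom_comp _ _ hg, X.comp_id])
    rw [h4 _ _ _ _ ha hb hg, restrict_mem ((h1 _ _ ha).2.trans hg.symm), X.dom_id, X.comp_id,
      ← h6, F.act_id, h6, ← h7, G.act_id] at h9
    exact h9.2
  refine Prod.ext ((restrict_fst hA).trans (h1 _ _ ha).2.symm) (IPow.ext ?_)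
  rintro ⟨g, x, y⟩
  rw [restrict_mem hA]
  constructor
  · rintro ⟨hg, h⟩
    exact key g x y hg h
  · intro h
    obtain ⟨h5, h6, -⟩ := a.2.lies _ _ _ h
    have hg : X.cod g = X.dom f := h5.trans (h1 _ _ ha).2
    obtain ⟨y', hy'⟩ := hT.exists_mem (X.comp f g) x ((X.cod_comp _ _ hg).trans hA.symm)
      (h6.trans (X.dom_comp _ _ hg).symm)
    refine ⟨hg, ?_⟩
    rwa [a.2.unique _ _ _ _ h (key _ _ _ hg hy')]

-- Naturality puts the graph of θ inside that of the amalgam; equality again follows from totality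
-- and single-valuedness.
include hS h1 h2 h4 in
theorem eq_amalgam {θ : X.Ob × IPow M (X.Ar × F.El × G.El)} (hθ : IsTransformation F G θ)
    (hA : θ.1 = A) (h : ∀ f a, R.Mem (f, a) → restrict θ f = a.1) : θ = amalgam A R := by
  have hT := isTransformation_amalgam hS h1 h2 h4
  have key : ∀ f x y, θ.2.Mem (f, x, y) → (amalgam A R).2.Mem (f, x, y) := by
    intro f x y hy
    obtain ⟨h5, h6, h7⟩ := hθ.lies _ _ _ hy
    refine mem_amalgam.2 ⟨h5.trans hA, h6, h7, fun l a hl ha => ?_⟩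
    rw [← h _ _ ha, restrict_mem (by rw [X.cod_comp _ _ hl, h5]), X.cod_id, X.dom_comp _ _ hl,
      ← X.dom_comp _ _ hl, X.comp_id]
    exact ⟨rfl, hθ.natural _ _ _ _ hy hl⟩
  refine Prod.ext hA (IPow.ext ?_)
  rintro ⟨f, x, y⟩
  refine ⟨key f x y, fun hy => ?_⟩
  obtain ⟨h5, h6, h7⟩ := hT.lies _ _ _ hy
  obtain ⟨y', hy'⟩ := hθ.exists_mem f x (h5.trans hA.symm) h6
  rwa [hT.unique _ _ _ _ hy (key _ _ _ hy')]

end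

variable (F G) in
/-- The exponential of two sheaves. -/
@[reducible]
noncomputable def exp : ISheaf X where
  El := {θ // IsTransformation F G θ}
  idx θ := θ.1.1
  act θ h := ⟨restrict θ.1 h, θ.2.restrict⟩
  ifun_idx := by fun_prop
  ifun_act := by fun_prop
  act_of_ne θ h H := Subtype.ext (restrict_of_ne H)
  idx_act θ h H := restrict_fst H
  act_id θ := Subtype.ext (restrict_id θ.2)
  act_act θ f g hf hg := by
    have h1 : (restrict θ.1 f).1 = X.cod g := (restrict_fst hf).trans hg.symm
    have h2 : θ.1.1 = X.cod (X.comp f g) := hf.trans (X.cod_comp _ _ hg).symm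
    refine Subtype.ext (Prod.ext ?_ (IPow.ext ?_))
    · simp only [restrict_fst h1, restrict_fst h2, X.dom_comp _ _ hg]
    · rintro ⟨k, x, y⟩
      simp only [restrict_mem h1, restrict_mem h2, restrict_mem hf, X.dom_comp _ _ hg]
      constructor
      · rintro ⟨h3, -, h5⟩
        exact ⟨h3, by rwa [X.assoc _ _ _ hg h3]⟩
      · rintro ⟨h3, h4⟩
        exact ⟨h3, (X.cod_comp _ _ h3).trans hg, by rwa [← X.assoc _ _ _ hg h3]⟩
  glue A S R hS h1 h2 h3 := by
    have hid : ∀ θ : {θ // IsTransformation F G θ},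
        (⟨restrict θ.1 (X.id θ.1.1), θ.2.restrict⟩ : {θ // IsTransformation F G θ}) = θ :=
      fun θ => Subtype.ext (restrict_id θ.2)
    have h4 : ∀ f g a b, R.Mem (f, a) → R.Mem (X.comp f g, b) → X.cod g = X.dom f →
        b.1 = restrict a.1 g := fun f g a b ha hb hg =>
      congrArg Subtype.val (matching_act (act := fun θ h => ⟨restrict θ.1 h, θ.2.restrict⟩)
        hid h1 h3 ha hb hg)
    refine ⟨⟨amalgam A R, isTransformation_amalgam hS h1 h2 h4⟩,
      ⟨rfl, fun f a ha => Subtype.ext (restrict_amalgam hS h1 h2 h4 ha)⟩, ?_⟩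
    rintro θ ⟨hA, hθ⟩
    exact Subtype.ext (eq_amalgam hS h1 h2 h4 θ.2 hA fun f a ha =>
      congrArg Subtype.val (hθ f a ha))

theorem exp_act_val (θ : (exp F G).El) (h : X.Ar) : ((exp F G).act θ h).1 = restrict θ.1 h := rfl

/-- The product F × G^F is taken as the pullback over the terminal sheaf, and the evaluation of (x,
θ) is the value of θ at (id, x). -/
theorem exists_eval (p : (pullback (toTerminal F) (toTerminal (exp F G))).El) :
    ∃ y, p.1.2.1.2.Mem (X.id (F.idx p.1.1), p.1.1, y) :=
  p.1.2.2.exists_mem _ _ ((X.cod_id _).trans p.2) (X.dom_id _).symm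

instance : IsInternal M fun p : F.El × {θ // IsTransformation F G θ} => F.idx p.1 = p.2.1.1 :=
  ⟨by fun_prop⟩

-- The value is picked by external choice, but uniqueness makes its graph a membership statement
-- about θ, which is internal.
variable (F G) in
theorem ifun_eval : IFun M fun p : {p : F.El × {θ // IsTransformation F G θ} //
    F.idx p.1 = p.2.1.1} => (exists_eval p).choose := by
  have h : ∀ p y, ((exists_eval (F := F) (G := G) p).choose = y) =
      p.1.2.1.2.Mem (X.id (F.idx p.1.1), p.1.1, y) := fun p y => propext
    ⟨fun h => h ▸ (exists_eval p).choose_spec,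
      fun h => p.1.2.2.unique _ _ _ _ (exists_eval p).choose_spec h⟩
  refine .of_graph ?_
  simp only [h]
  fun_prop

variable (F G) in
/-- The evaluation map of an exponential. -/
noncomputable def eval : pullback (toTerminal F) (toTerminal (exp F G)) ⟶ G where
  toFun p := (exists_eval p).choose
  ifun := ifun_eval F G
  idx_map p := by
    have := (p.1.2.2.lies _ _ _ (exists_eval p).choose_spec).2.2
    rwa [X.dom_id] at this
  map_act' p f h := by
    -- Both sides are values of θ at (f, x · f): one by the definition of the restriction of θ, the
    -- other by naturality.
    refine p.1.2.2.unique f (F.act p.1.1 f) _ _ ?_ ?_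
    · have hf : p.1.2.1.1 = X.cod f := p.2.symm.trans h
      have h1 := (exists_eval ((pullback (toTerminal F) (toTerminal (exp F G))).act p f)).choose_spec
      have h2 := ((restrict_mem hf).1 h1).2
      change p.1.2.1.2.Mem (X.comp f (X.id (F.idx (F.act p.1.1 f))), _, _) at h2
      have e : X.comp f (X.id (F.idx (F.act p.1.1 f))) = f := by rw [F.idx_act _ _ h, X.comp_id]
      rwa [e] at h2
    · have hf : F.idx p.1.1 = X.cod f := h
      have h1 := p.1.2.2.natural _ _ _ f (exists_eval p).choose_spec (by rw [X.dom_id, hf])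
      simpa only [hf, X.id_comp] using h1

theorem eval_eq_iff {p : (pullback (toTerminal F) (toTerminal (exp F G))).El} {y : G.El} :
    (eval F G).toFun p = y ↔ p.1.2.1.2.Mem (X.id (F.idx p.1.1), p.1.1, y) :=
  ⟨fun h => h ▸ (exists_eval p).choose_spec,
    fun h => p.1.2.2.unique _ _ _ _ (exists_eval p).choose_spec h⟩

section Transpose

variable {Y : ISheaf X} (g : pullback (toTerminal F) (toTerminal Y) ⟶ G)

/-- The values of the transpose of a map. -/
def transposeFun (y : Y.El) : X.Ob × IPow M (X.Ar × F.El × G.El) :=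
  (Y.idx y, ⟨fun q => X.cod q.1 = Y.idx y ∧
    ∃ p : {p : F.El × Y.El // (toTerminal F).toFun p.1 = (toTerminal Y).toFun p.2},
      p.1.1 = q.2.1 ∧ p.1.2 = Y.act y q.1 ∧ F.idx p.1.1 = X.dom q.1 ∧ g.toFun p = q.2.2, by
    fun_prop⟩)

/-- The transpose of g sends y to the transformation (k, x) ↦ g(x, y · k). The definition quantifies
over elements of the product so that its internality is evident; this is the form used for
computing. -/
theorem mem_transposeFun {y : Y.El} {k : X.Ar} {x : F.El} {z : G.El} :
    (transposeFun g y).2.Mem (k, x, z) ↔ X.cod k = Y.idx y ∧ F.idx x = X.dom k ∧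
      ∃ h : F.idx x = Y.idx (Y.act y k), g.toFun ⟨(x, Y.act y k), h⟩ = z := by
  constructor
  · rintro ⟨h, ⟨⟨x', y'⟩, hp⟩, e1, e2, e3, e4⟩
    dsimp only at e1 e2 e3 e4
    subst e1 e2
    exact ⟨h, e3, hp, e4⟩
  · rintro ⟨h, h1, hp, e⟩
    exact ⟨h, ⟨⟨x, Y.act y k⟩, hp⟩, rfl, rfl, h1, e⟩

theorem isTransformation_transposeFun (y : Y.El) : IsTransformation F G (transposeFun g y) := by
  refine ⟨fun k x z => ?_, fun k x hk hx => ?_, fun k x z z' => ?_, fun k x z l => ?_⟩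
  · rw [mem_transposeFun]
    rintro ⟨h1, h2, h3, rfl⟩
    refine ⟨h1, h2, ?_⟩
    rw [g.idx_map]
    exact h2
  · exact ⟨_, (mem_transposeFun g).2
      ⟨hk, hx, hx.trans (Y.idx_act _ _ (Eq.symm hk)).symm, rfl⟩⟩
  · simp only [mem_transposeFun]
    rintro ⟨-, -, -, rfl⟩ ⟨-, -, -, rfl⟩
    rfl
  · simp only [mem_transposeFun]
    rintro ⟨h1, h2, h3, rfl⟩ hl
    have e := Y.act_act y k l h1.symm hl
    have h4 : F.idx (F.act x l) = X.dom (X.comp k l) := by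
      rw [X.dom_comp _ _ hl, F.idx_act _ _ (h2.trans hl.symm)]
    refine ⟨(X.cod_comp _ _ hl).trans h1, h4, ?_, ?_⟩
    · rw [h4, Y.idx_act _ _ (h1.symm.trans (X.cod_comp _ _ hl).symm)]
    · rw [← g.map_act]
      congr 1
      exact Subtype.ext (Prod.ext rfl e.symm)

/-- The transpose of a map. -/
noncomputable def transpose : Y ⟶ exp F G where
  toFun y := ⟨transposeFun g y, isTransformation_transposeFun g y⟩
  ifun := by
    change IFun M fun y => (_ : {θ // IsTransformation F G θ})
    unfold transposeFun
    fun_prop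
  idx_map y := rfl
  map_act' y f h := by
    refine Subtype.ext (Prod.ext ?_ (IPow.ext ?_))
    · exact (Y.idx_act _ _ h).trans (restrict_fst (θ := transposeFun g y) h).symm
    · rintro ⟨k, x, z⟩
      rw [exp_act_val, restrict_mem (θ := transposeFun g y) h]
      simp only [mem_transposeFun, Y.idx_act _ _ h]
      refine and_congr_right fun hk => ?_
      simp only [X.cod_comp _ _ hk, X.dom_comp _ _ hk, h, true_and, Y.act_act _ _ _ h hk]

/-- Uniqueness is a Yoneda argument: the value of h(y) at (k, x) is the value of h(y) · k = h(y · k)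
at (id, x), that is, the evaluation at (x, h(y · k)), which is prescribed to be g(x, y · k). -/
theorem existsUnique_transpose : ∃! h : Y ⟶ exp F G, ∀ (x : F.El) (y : Y.El)
    (e : F.idx x = Y.idx y), (eval F G).toFun ⟨(x, h.toFun y), e.trans (h.idx_map y).symm⟩ =
      g.toFun ⟨(x, y), e⟩ := by
  refine ⟨transpose g, fun x y e => ?_, fun h H => hom_ext fun y => ?_⟩
  · rw [eval_eq_iff]
    have e' := Y.act_id y
    rw [← e] at e'
    refine (mem_transposeFun g).2 ⟨(X.cod_id _).trans e, (X.dom_id _).symm, e'.symm ▸ e, ?_⟩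
    congr 1
    exact Subtype.ext (Prod.ext rfl e')
  · have hT := isTransformation_transposeFun g y
    refine Subtype.ext (Prod.ext (h.idx_map y) (IPow.ext ?_))
    have key : ∀ k x z, (h.toFun y).1.2.Mem (k, x, z) ↔ (transposeFun g y).2.Mem (k, x, z) := by
      intro k x z
      -- The computation makes sense only for k and x of the right kind; both graphs contain no
      -- other triples, which removes the restriction afterwards.
      have aux : X.cod k = Y.idx y → F.idx x = X.dom k →
          ((h.toFun y).1.2.Mem (k, x, z) ↔ (transposeFun g y).2.Mem (k, x, z)) := by
        intro h1 h2
        have e : F.idx x = Y.idx (Y.act y k) := h2.trans (Y.idx_act _ _ h1.symm).symm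
        have h3 := H x (Y.act y k) e
        have h4 : (h.toFun y).1.1 = X.cod k := (h.idx_map y).trans h1.symm
        rw [mem_transposeFun, and_iff_right h1, and_iff_right h2, exists_prop_of_true e, ← h3,
          eval_eq_iff]
        simp only [h.map_act]
        rw [restrict_mem h4, X.cod_id, h2, X.comp_id]
        simp
      constructor
      · intro hz
        obtain ⟨h1, h2, -⟩ := (h.toFun y).2.lies _ _ _ hz
        exact (aux (h1.trans (h.idx_map y)) h2).1 hz
      · intro hz
        obtain ⟨h1, h2, -⟩ := hT.lies _ _ _ hz
        exact (aux h1 h2).2 hz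
    exact fun q => key q.1 q.2.1 q.2.2

end Transpose

end Exponential

end ISheaf

end MTT

namespace MTT

open CategoryTheory

variable {M : Struc.{u}} [hM : Fact M.IsModel]

@[fun_prop]
theorem ISite.ifun_pull_comp (X : ISite M) {α : Type*} [Coded M α] {f : α → X.Ar}
    {g : α → IPow M X.Ar} (hf : IFun M f) (hg : IFun M g) : IFun M fun a => X.pull (f a) (g a) := by
  unfold ISite.pull
  fun_prop

namespace ISheaf

variable {X : ISite M}

/-! #### The subobject classifier -/

/-- `ω.2` is a closed sieve on the object `ω.1`. -/
structure IsClosedSieve (ω : X.Ob × IPow M X.Ar) : Prop where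
  cod : ∀ f, ω.2.Mem f → X.cod f = ω.1
  comp : ∀ f h, ω.2.Mem f → X.cod h = X.dom f → ω.2.Mem (X.comp f h)
  closed : ∀ h, X.cod h = ω.1 → X.Cov (X.dom h) (X.pull h ω.2) → ω.2.Mem h

theorem isClosedSieve_iff (ω : X.Ob × IPow M X.Ar) : IsClosedSieve ω ↔
    (∀ f, ω.2.Mem f → X.cod f = ω.1) ∧
    (∀ f h, ω.2.Mem f → X.cod h = X.dom f → ω.2.Mem (X.comp f h)) ∧
    (∀ h, X.cod h = ω.1 → X.Cov (X.dom h) (X.pull h ω.2) → ω.2.Mem h) :=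
  ⟨fun ⟨h1, h2, h3⟩ => ⟨h1, h2, h3⟩, fun ⟨h1, h2, h3⟩ => ⟨h1, h2, h3⟩⟩

variable (X) in
instance : IsInternal M (IsClosedSieve (X := X)) := ⟨by
  change IFun M fun ω => IsClosedSieve ω
  simp only [isClosedSieve_iff, forall_iff_not_exists, imp_iff_not_or]
  fun_prop⟩

theorem IsClosedSieve.ext {ω σ : X.Ob × IPow M X.Ar} (hω : IsClosedSieve ω) (hσ : IsClosedSieve σ)
    (h : ω.1 = σ.1) (h' : ∀ f, X.cod f = ω.1 → (ω.2.Mem f ↔ σ.2.Mem f)) : ω = σ := by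
  refine Prod.ext h (IPow.ext fun f => ⟨fun hf => (h' f (hω.cod f hf)).1 hf, fun hf => ?_⟩)
  exact (h' f ((hσ.cod f hf).trans h.symm)).2 hf

open Classical in
/-- The restriction of a sieve along an arrow. -/
noncomputable def sieveRestrict (ω : X.Ob × IPow M X.Ar) (h : X.Ar) : X.Ob × IPow M X.Ar :=
  (if ω.1 = X.cod h then X.dom h else ω.1,
    ⟨fun k => (ω.1 = X.cod h ∧ X.cod k = X.dom h ∧ ω.2.Mem (X.comp h k)) ∨
      (¬ ω.1 = X.cod h ∧ ω.2.Mem k), by fun_prop⟩)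

@[fun_prop]
theorem ifun_sieveRestrict_comp {α : Type*} [Coded M α]
    {f : α → X.Ob × IPow M X.Ar} {g : α → X.Ar} (hf : IFun M f) (hg : IFun M g) :
    IFun M fun a => sieveRestrict (f a) (g a) := by
  unfold sieveRestrict
  fun_prop

section

variable {ω : X.Ob × IPow M X.Ar} {h : X.Ar}

theorem sieveRestrict_of_ne (H : ¬ ω.1 = X.cod h) : sieveRestrict ω h = ω := by
  simp [sieveRestrict, H]

theorem sieveRestrict_fst (H : ω.1 = X.cod h) : (sieveRestrict ω h).1 = X.dom h := if_pos H

theorem sieveRestrict_mem (H : ω.1 = X.cod h) {k : X.Ar} :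
    (sieveRestrict ω h).2.Mem k ↔ X.cod k = X.dom h ∧ ω.2.Mem (X.comp h k) := by
  simp [sieveRestrict, H]

/-- An arrow h is in ω exactly when the restriction of ω along h contains an identity. Questions
about sieves thereby reduce to identities. -/
theorem sieveRestrict_mem_id (H : ω.1 = X.cod h) {A : X.Ob} (hA : A = X.dom h) :
    (sieveRestrict ω h).2.Mem (X.id A) ↔ ω.2.Mem h := by
  rw [sieveRestrict_mem H, hA, X.comp_id, X.cod_id, and_iff_right rfl]

theorem IsClosedSieve.sieveRestrict (H : IsClosedSieve ω) : IsClosedSieve (sieveRestrict ω h) := by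
  by_cases e : ω.1 = X.cod h
  · refine ⟨fun f => ?_, fun f g => ?_, fun f => ?_⟩ <;>
      simp only [sieveRestrict_mem e, sieveRestrict_fst e]
    · exact fun hf => hf.1
    · rintro ⟨h1, h2⟩ h3
      refine ⟨(X.cod_comp _ _ h3).trans h1, ?_⟩
      rw [← X.assoc _ _ _ h1 h3]
      exact H.comp _ _ h2 (h3.trans (X.dom_comp _ _ h1).symm)
    · intro h1 h2
      refine ⟨h1, H.closed _ ((X.cod_comp _ _ h1).trans e.symm) ?_⟩
      rw [X.dom_comp _ _ h1]
      convert h2 using 1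
      refine IPow.ext fun k => ?_
      simp only [ISite.pull, X.dom_comp _ _ h1, sieveRestrict_mem e]
      refine and_congr_right fun hk => ?_
      rw [X.cod_comp _ _ hk, and_iff_right h1, X.assoc _ _ _ h1 hk]
  · rwa [sieveRestrict_of_ne e]

theorem sieveRestrict_id (H : IsClosedSieve ω) : sieveRestrict ω (X.id ω.1) = ω := by
  have h := (X.cod_id ω.1).symm
  refine IsClosedSieve.ext H.sieveRestrict H ((sieveRestrict_fst h).trans (X.dom_id _)) fun f hf => ?_
  rw [sieveRestrict_fst h, X.dom_id] at hf
  rw [sieveRestrict_mem h, X.dom_id, and_iff_right hf, ← hf, X.id_comp]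

end

section

variable (A : X.Ob) (S : IPow M X.Ar) (R : IPow M (X.Ar × {ω : X.Ob × IPow M X.Ar // IsClosedSieve ω}))

/-- The amalgamation of a matching family of closed sieves. -/
def sieveAmalgam : X.Ob × IPow M X.Ar :=
  (A, ⟨fun h => X.cod h = A ∧ ∀ l, X.cod l = X.dom h → S.Mem (X.comp h l) →
      ∃ ω, R.Mem (X.comp h l, ω) ∧ ω.1.2.Mem (X.id (X.dom l)), by
    simp only [forall_iff_not_exists, imp_iff_not_or]
    fun_prop⟩)

variable {A S R}

theorem mem_sieveAmalgam {h : X.Ar} : (sieveAmalgam A S R).2.Mem h ↔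
    X.cod h = A ∧ ∀ l, X.cod l = X.dom h → S.Mem (X.comp h l) →
      ∃ ω, R.Mem (X.comp h l, ω) ∧ ω.1.2.Mem (X.id (X.dom l)) := Iff.rfl

variable (hS : X.Cov A S)
  (h1 : ∀ f a, R.Mem (f, a) → S.Mem f ∧ a.1.1 = X.dom f) (h2 : ∀ f, S.Mem f → ∃ a, R.Mem (f, a))
  (h4 : ∀ f g a b, R.Mem (f, a) → R.Mem (X.comp f g, b) → X.cod g = X.dom f →
    b.1 = sieveRestrict a.1 g)

-- Below a member f of the cover the amalgam is the local sieve: one direction tests the amalgam at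
-- an identity, the other uses compatibility and closure under composition.
include hS h1 h2 h4 in
theorem mem_sieveAmalgam_comp_iff {f : X.Ar} {a : {ω : X.Ob × IPow M X.Ar // IsClosedSieve ω}}
    (ha : R.Mem (f, a)) {k : X.Ar} (hk : X.cod k = X.dom f) :
    (sieveAmalgam A S R).2.Mem (X.comp f k) ↔ a.1.2.Mem k := by
  have hdk := X.dom_comp _ _ hk
  have hs := (h1 _ _ ha).1
  rw [mem_sieveAmalgam, X.cod_comp _ _ hk, and_iff_right (X.cov_cod _ _ _ hS hs)]
  constructor
  · intro h
    obtain ⟨ω, hω, hω'⟩ := h (X.id (X.dom k)) (by rw [X.cod_id, hdk])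
      (by rw [← hdk, X.comp_id]; exact X.cov_comp _ _ _ _ hS hs hk)
    rw [← hdk, X.comp_id] at hω
    rw [X.dom_id] at hω'
    rwa [h4 _ _ _ _ ha hω hk, sieveRestrict_mem_id ((h1 _ _ ha).2.trans hk.symm) rfl] at hω'
  · intro h l hl hs'
    obtain ⟨ω, hω⟩ := h2 _ hs'
    rw [hdk] at hl
    refine ⟨ω, hω, ?_⟩
    rw [X.assoc _ _ _ hk hl] at hω
    have hkl := (X.cod_comp _ _ hl).trans hk
    rw [h4 _ _ _ _ ha hω hkl, sieveRestrict_mem_id ((h1 _ _ ha).2.trans hkl.symm)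
      (X.dom_comp _ _ hl).symm]
    exact a.2.comp _ _ h hl

-- For closedness, suppose the pullback of the amalgam along h covers, and let h ∘ l be in S. The
-- local sieve at h ∘ l, pulled back along an identity, contains a pullback of that cover; being
-- closed, it contains the identity.
include hS h1 h2 h4 in
theorem isClosedSieve_sieveAmalgam : IsClosedSieve (sieveAmalgam A S R) := by
  refine ⟨fun f hf => hf.1, fun f g hf hg => ?_, fun h hh hc => ?_⟩
  · rw [mem_sieveAmalgam] at hf ⊢
    refine ⟨(X.cod_comp _ _ hg).trans hf.1, fun l hl hs => ?_⟩
    rw [X.dom_comp _ _ hg] at hl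
    rw [X.assoc _ _ _ hg hl] at hs ⊢
    have := hf.2 _ ((X.cod_comp _ _ hl).trans hg) hs
    rwa [X.dom_comp _ _ hl] at this
  · refine mem_sieveAmalgam.2 ⟨hh, fun l hl hs => ?_⟩
    obtain ⟨ω, hω⟩ := h2 _ hs
    have hdl := X.dom_comp _ _ hl
    refine ⟨ω, hω, ω.2.closed _ (by rw [X.cod_id, (h1 _ _ hω).2, hdl]) ?_⟩
    rw [X.dom_id]
    refine X.cov_mono (X.cov_pull hc hl) (fun f hf => ?_) (fun f g hf hg => ?_) (fun f hf => ?_)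
    · rw [hf.1, X.dom_id]
    · refine ⟨(X.cod_comp _ _ hg).trans hf.1, ?_⟩
      rw [← X.assoc _ _ _ hf.1 hg]
      exact ω.2.comp _ _ hf.2 (hg.trans (X.dom_comp _ _ hf.1).symm)
    · obtain ⟨hf1, hf2, hf3⟩ := hf
      refine ⟨by rw [hf1, X.dom_id], ?_⟩
      rw [← hf1, X.id_comp, ← mem_sieveAmalgam_comp_iff hS h1 h2 h4 hω (hf1.trans hdl.symm),
        X.assoc _ _ _ hl hf1]
      exact hf3

include hS h1 h2 h4 in
theorem sieveRestrict_sieveAmalgam {f : X.Ar} {a : {ω : X.Ob × IPow M X.Ar // IsClosedSieve ω}}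
    (ha : R.Mem (f, a)) : sieveRestrict (sieveAmalgam A S R) f = a.1 := by
  have hA : (sieveAmalgam A S R).1 = X.cod f := (X.cov_cod _ _ _ hS (h1 _ _ ha).1).symm
  refine IsClosedSieve.ext (isClosedSieve_sieveAmalgam hS h1 h2 h4).sieveRestrict a.2
    ((sieveRestrict_fst hA).trans (h1 _ _ ha).2.symm) fun k hk => ?_
  rw [sieveRestrict_fst hA] at hk
  rw [sieveRestrict_mem hA, and_iff_right hk, mem_sieveAmalgam_comp_iff hS h1 h2 h4 ha hk]

-- Here closedness forces uniqueness: if k is in the amalgam, then the pullback of ω along k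
-- contains the cover k*S, so k is in ω.
include hS h1 h2 h4 in
theorem eq_sieveAmalgam {ω : X.Ob × IPow M X.Ar} (hω : IsClosedSieve ω) (hA : ω.1 = A)
    (h : ∀ f a, R.Mem (f, a) → sieveRestrict ω f = a.1) : ω = sieveAmalgam A S R := by
  refine IsClosedSieve.ext hω (isClosedSieve_sieveAmalgam hS h1 h2 h4) hA fun k hk => ?_
  have key : ∀ l a, X.cod l = X.dom k → R.Mem (X.comp k l, a) →
      (a.1.2.Mem (X.id (X.dom l)) ↔ ω.2.Mem (X.comp k l)) := fun l a hl ha => by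
    rw [← h _ _ ha, sieveRestrict_mem_id (hk.symm.trans (X.cod_comp _ _ hl).symm)
      (X.dom_comp _ _ hl).symm]
  rw [mem_sieveAmalgam, and_iff_right (hk.trans hA)]
  constructor
  · intro hk' l hl hs
    obtain ⟨a, ha⟩ := h2 _ hs
    exact ⟨a, ha, (key l a hl ha).2 (hω.comp _ _ hk' hl)⟩
  · intro H
    refine hω.closed _ hk (X.cov_mono (X.cov_pull hS (hk.trans hA)) (fun f hf => hf.1)
      (fun f g hf hg => ?_) fun l hl => ?_)
    · refine ⟨(X.cod_comp _ _ hg).trans hf.1, ?_⟩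
      rw [← X.assoc _ _ _ hf.1 hg]
      exact hω.comp _ _ hf.2 (hg.trans (X.dom_comp _ _ hf.1).symm)
    · obtain ⟨a, ha, ha'⟩ := H l hl.1 hl.2
      exact ⟨hl.1, (key l a hl.1 ha).1 ha'⟩

end

variable (X) in
/-- The sheaf of closed sieves. -/
@[reducible]
noncomputable def omega : ISheaf X where
  El := {ω : X.Ob × IPow M X.Ar // IsClosedSieve ω}
  idx ω := ω.1.1
  act ω h := ⟨sieveRestrict ω.1 h, ω.2.sieveRestrict⟩
  ifun_idx := by fun_prop
  ifun_act := by fun_prop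
  act_of_ne ω h H := Subtype.ext (sieveRestrict_of_ne H)
  idx_act ω h H := sieveRestrict_fst H
  act_id ω := Subtype.ext (sieveRestrict_id ω.2)
  act_act ω f g hf hg := by
    have h1 : (sieveRestrict ω.1 f).1 = X.cod g := (sieveRestrict_fst hf).trans hg.symm
    have h2 : ω.1.1 = X.cod (X.comp f g) := hf.trans (X.cod_comp _ _ hg).symm
    refine Subtype.ext (IsClosedSieve.ext ω.2.sieveRestrict.sieveRestrict ω.2.sieveRestrict ?_ ?_)
    · simp only [sieveRestrict_fst h1, sieveRestrict_fst h2, X.dom_comp _ _ hg]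
    · intro k hk
      rw [sieveRestrict_fst h1] at hk
      rw [sieveRestrict_mem h1, sieveRestrict_mem h2, sieveRestrict_mem hf, X.dom_comp _ _ hg,
        X.cod_comp _ _ hk, and_iff_right hg, X.assoc _ _ _ hg hk]
  glue A S R hS h1 h2 h3 := by
    have hid : ∀ ω : {ω : X.Ob × IPow M X.Ar // IsClosedSieve ω},
        (⟨sieveRestrict ω.1 (X.id ω.1.1), ω.2.sieveRestrict⟩ : {ω // IsClosedSieve ω}) = ω :=
      fun ω => Subtype.ext (sieveRestrict_id ω.2)
    have h4 : ∀ f g a b, R.Mem (f, a) → R.Mem (X.comp f g, b) → X.cod g = X.dom f →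
        b.1 = sieveRestrict a.1 g := fun f g a b ha hb hg =>
      congrArg Subtype.val (matching_act (act := fun ω h => ⟨sieveRestrict ω.1 h, ω.2.sieveRestrict⟩)
        hid h1 h3 ha hb hg)
    refine ⟨⟨sieveAmalgam A S R, isClosedSieve_sieveAmalgam hS h1 h2 h4⟩,
      ⟨rfl, fun f a ha => Subtype.ext (sieveRestrict_sieveAmalgam hS h1 h2 h4 ha)⟩, ?_⟩
    rintro ω ⟨hA, hω⟩
    exact Subtype.ext (eq_sieveAmalgam hS h1 h2 h4 ω.2 hA fun f a ha =>
      congrArg Subtype.val (hω f a ha))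

/-- The maximal sieve. -/
def maxSieve (A : X.Ob) : X.Ob × IPow M X.Ar := (A, ⟨fun f => X.cod f = A, by fun_prop⟩)

theorem isClosedSieve_maxSieve (A : X.Ob) : IsClosedSieve (maxSieve A) :=
  ⟨fun _ h => h, fun _ _ h h' => (X.cod_comp _ _ h').trans h, fun _ h _ => h⟩

theorem eq_maxSieve_iff {ω : X.Ob × IPow M X.Ar} (hω : IsClosedSieve ω) :
    ω = maxSieve ω.1 ↔ ω.2.Mem (X.id ω.1) := by
  constructor
  · intro h
    rw [h]
    exact X.cod_id _
  · intro h
    refine IsClosedSieve.ext hω (isClosedSieve_maxSieve _) rfl fun f hf => iff_of_true ?_ hf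
    have := hω.comp _ f h (by rw [X.dom_id, hf])
    rwa [← hf, X.id_comp] at this

variable (X) in
/-- The generic subobject. -/
noncomputable def truth : terminal X ⟶ omega X where
  toFun A := ⟨maxSieve A, isClosedSieve_maxSieve A⟩
  ifun := by
    change IFun M fun A : X.Ob => (⟨maxSieve A, _⟩ : {ω : X.Ob × IPow M X.Ar // IsClosedSieve ω})
    unfold maxSieve
    fun_prop
  idx_map A := rfl
  map_act' A f h := by
    have h : (maxSieve A).1 = X.cod f := h
    have h' : A = X.cod f := h
    refine Subtype.ext (IsClosedSieve.ext (isClosedSieve_maxSieve _)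
      (isClosedSieve_maxSieve _).sieveRestrict ?_ fun k hk => ?_)
    · exact (if_pos h').trans (sieveRestrict_fst h).symm
    · rw [sieveRestrict_mem h]
      have hk' : X.cod k = X.dom f := hk.trans (if_pos h')
      exact iff_of_true hk ⟨hk', (X.cod_comp _ _ hk').trans h.symm⟩

section Classify

variable {U Z : ISheaf X} (m : U ⟶ Z)

/-- The sieve of the arrows that carry an element into the image of a map. -/
def imageSieve (z : Z.El) : X.Ob × IPow M X.Ar :=
  (Z.idx z, ⟨fun k => X.cod k = Z.idx z ∧ ∃ u, m.toFun u = Z.act z k, by fun_prop⟩)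

variable {m}

/-- If z · h lies locally in the image, the local preimages match because m is injective. They glue
to an element of U, whose image is z · h because Z is separated. -/
theorem isClosedSieve_imageSieve (hm : Function.Injective m.toFun) (z : Z.El) :
    IsClosedSieve (imageSieve m z) := by
  refine ⟨fun f hf => hf.1, fun f h hf hh => ?_, fun h hh hc => ?_⟩
  · obtain ⟨hf, u, hu⟩ := hf
    refine ⟨(X.cod_comp _ _ hh).trans hf, U.act u h, ?_⟩
    rw [m.map_act, hu, Z.act_act _ _ _ hf.symm hh]
  · have hh : X.cod h = Z.idx z := hh
    have hz := Z.idx_act _ _ hh.symm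
    obtain ⟨u, ⟨hu, hu'⟩, -⟩ := U.glue _ _ ⟨fun q => X.cod q.1 = X.dom h ∧
      m.toFun q.2 = Z.act (Z.act z h) q.1, by fun_prop⟩ hc
      (by
        rintro f u ⟨hf, hu⟩
        have hu : m.toFun u = Z.act (Z.act z h) f := hu
        have hf : X.cod f = X.dom h := hf
        refine ⟨⟨hf, (X.cod_comp _ _ hf).trans hh, u, ?_⟩, ?_⟩
        · rw [hu, Z.act_act _ _ _ hh.symm hf]
        · rw [← m.idx_map, hu, Z.idx_act _ _ (hz.trans hf.symm)])
      (by
        rintro f ⟨hf, -, u, hu⟩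
        refine ⟨u, hf, ?_⟩
        rw [hu, Z.act_act _ _ _ hh.symm hf])
      (by
        rintro f f' u u' g g' ⟨hf, hu⟩ ⟨hf', hu'⟩ hg hg' e
        refine hm ?_
        have hu : m.toFun u = Z.act (Z.act z h) f := hu
        have hu' : m.toFun u' = Z.act (Z.act z h) f' := hu'
        have hf : X.cod f = X.dom h := hf
        have hf' : X.cod f' = X.dom h := hf'
        rw [m.map_act, m.map_act, hu, hu', Z.act_act _ _ _ (hz.trans hf.symm) hg,
          Z.act_act _ _ _ (hz.trans hf'.symm) hg', e])
    refine ⟨hh, u, Z.separated hc (by rw [m.idx_map, hu]) hz ?_⟩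
    rintro f ⟨hf, -, u', hu''⟩
    rw [← Z.act_act _ _ _ hh.symm hf] at hu''
    rw [← m.map_act, hu' f u' ⟨hf, hu''⟩, hu'']

variable (m) in
/-- The classifying map of a subsheaf. -/
noncomputable def classify [Mono m] : Z ⟶ omega X where
  toFun z := ⟨imageSieve m z, isClosedSieve_imageSieve (injective_of_mono m) z⟩
  ifun := by
    change IFun M fun z => (⟨imageSieve m z, _⟩ : {ω : X.Ob × IPow M X.Ar // IsClosedSieve ω})
    unfold imageSieve
    fun_prop
  idx_map A := rfl
  map_act' z f h := by
    have hz := isClosedSieve_imageSieve (injective_of_mono m)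
    have h' : (imageSieve m z).1 = X.cod f := h
    refine Subtype.ext (IsClosedSieve.ext (hz _) (hz _).sieveRestrict ?_ fun k hk => ?_)
    · exact (Z.idx_act _ _ h).trans (sieveRestrict_fst h').symm
    · rw [sieveRestrict_mem h']
      have hk' : X.cod k = X.dom f := hk.trans (Z.idx_act _ _ h)
      have hk : X.cod k = Z.idx (Z.act z f) := hk
      change (_ ∧ _) ↔ _ ∧ (_ ∧ _)
      rw [and_iff_right hk, and_iff_right hk', and_iff_right ((X.cod_comp _ _ hk').trans h.symm),
        Z.act_act _ _ _ h hk']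

theorem imageSieve_mem_id {z : Z.El} :
    (imageSieve m z).2.Mem (X.id (Z.idx z)) ↔ ∃ u, m.toFun u = z := by
  change (_ ∧ _) ↔ _
  rw [X.cod_id, and_iff_right rfl, Z.act_id]

/-- A sieve is maximal exactly when it contains the identity, and the image sieve of z contains the
identity exactly when z itself is in the image. -/
theorem classify_eq_truth_iff [Mono m] {z : Z.El} {A : X.Ob} :
    (classify m).toFun z = (truth X).toFun A ↔ A = Z.idx z ∧ ∃ u, m.toFun u = z := by
  have hz := isClosedSieve_imageSieve (injective_of_mono m) z
  rw [← imageSieve_mem_id, ← show (imageSieve m z).1 = Z.idx z from rfl, ← eq_maxSieve_iff hz,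
    Subtype.ext_iff]
  change imageSieve m z = maxSieve A ↔ _
  constructor
  · intro h
    have h' : (imageSieve m z).1 = A := congrArg Prod.fst h
    exact ⟨h'.symm, by rw [h', h]⟩
  · rintro ⟨rfl, h⟩
    exact h

theorem isPullback_classify [Mono m] : IsPullback m (toTerminal U) (classify m) (truth X) := by
  have hw : m ≫ classify m = toTerminal U ≫ truth X :=
    hom_ext fun u => classify_eq_truth_iff.2 ⟨(m.idx_map u).symm, u, rfl⟩
  refine ⟨⟨hw⟩, ⟨Limits.PullbackCone.IsLimit.mk _ (fun s => ?_) ?_ ?_ ?_⟩⟩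
  · have h : ∀ x, ∃ u, m.toFun u = s.fst.toFun x := fun x =>
      (classify_eq_truth_iff.1 (congr_toFun s.condition x)).2
    refine { toFun := fun x => (h x).choose, ifun := ?_, idx_map := ?_, map_act' := ?_ }
    · have h' : ∀ x u, ((h x).choose = u) = (m.toFun u = s.fst.toFun x) := fun x u =>
        propext ⟨fun e => e ▸ (h x).choose_spec, fun e =>
          injective_of_mono m ((h x).choose_spec.trans e.symm)⟩
      refine .of_graph ?_
      simp only [h']
      fun_prop
    · intro x
      rw [← m.idx_map, (h x).choose_spec, s.fst.idx_map]
    · intro x f _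
      refine injective_of_mono m ?_
      rw [(h _).choose_spec, m.map_act, (h x).choose_spec, s.fst.map_act]
  · intro s
    exact hom_ext fun x => ((classify_eq_truth_iff.1 (congr_toFun s.condition x)).2).choose_spec
  · intro s
    exact (isTerminalTerminal X).hom_ext _ _
  · intro s k hk _
    refine hom_ext fun x => injective_of_mono m ?_
    exact (congr_toFun hk x).trans
      ((classify_eq_truth_iff.1 (congr_toFun s.condition x)).2).choose_spec.symm

/-- An arrow f is in χ(z) iff the identity is in χ(z) · f = χ(z · f), iff χ(z · f) is true, iff z ·
f is in the image of m. So χ is determined by the square. -/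
theorem eq_classify [Mono m] {χ : Z ⟶ omega X}
    (h : IsPullback m (toTerminal U) χ (truth X)) : χ = classify m := by
  have key : ∀ z, (χ.toFun z).1.2.Mem (X.id (Z.idx z)) ↔ ∃ u, m.toFun u = z := by
    intro z
    have hi : (χ.toFun z).1.1 = Z.idx z := χ.idx_map z
    rw [← hi, ← eq_maxSieve_iff (χ.toFun z).2]
    constructor
    · intro e
      obtain ⟨u, hu, -⟩ := existsUnique_of_isPullback h (x := z) (y := (χ.toFun z).1.1)
        (Subtype.ext e)
      exact ⟨u, hu.1⟩
    · rintro ⟨u, rfl⟩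
      have e : (χ.toFun (m.toFun u)).1 = maxSieve (U.idx u) :=
        congrArg Subtype.val (congr_toFun h.w u)
      have e' : (χ.toFun (m.toFun u)).1.1 = U.idx u := congrArg Prod.fst e
      rw [e', e]
  refine hom_ext fun z => Subtype.ext (IsClosedSieve.ext (χ.toFun z).2
    ((classify m).toFun z).2 (χ.idx_map z) fun f hf => ?_)
  have hi : (χ.toFun z).1.1 = Z.idx z := χ.idx_map z
  have hzf : Z.idx z = X.cod f := hi.symm.trans hf.symm
  have h1 := key (Z.act z f)
  rw [χ.map_act] at h1
  have h2 := (sieveRestrict_mem_id (ω := (χ.toFun z).1) hf.symm (Z.idx_act _ _ hzf)).symm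
  refine h2.trans (h1.trans ?_)
  change _ ↔ (_ ∧ _)
  rw [and_iff_right hzf.symm]

end Classify

variable (X) in
/-- The subobject classifier of the category of sheaves. -/
noncomputable def classifier : Subobject.Classifier (ISheaf X) :=
  Subobject.Classifier.mkOfTerminalΩ₀ (terminal X) (isTerminalTerminal X) (omega X) (truth X)
    (fun m _ => classify m) (fun _ _ => isPullback_classify) (fun _ _ _ h => eq_classify h)

end ISheaf

end MTT

universe u₁ v₁ u₂ v₂
namespace MTT

open CategoryTheory CategoryTheory.Limits

/-! ### Elementary toposes -/

/-- The universal property says that `ev` is terminal among the objects Y equipped with a map A × Y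
→ B, and a functor with such terminal objects for all B is a left adjoint. -/
theorem isLeftAdjoint_prod_of_exists {C : Type u₁} [Category.{v₁} C] [HasBinaryProducts C] (A : C)
    (h : ∀ B : C, ∃ (E : C) (ev : A ⨯ E ⟶ B), ∀ (Y : C) (g : A ⨯ Y ⟶ B),
      ∃! k : Y ⟶ E, prod.map (𝟙 A) k ≫ ev = g) : (prod.functor.obj A).IsLeftAdjoint := by
  have : ∀ B, HasTerminal (CostructuredArrow (prod.functor.obj A) B) := fun B => by
    obtain ⟨E, ev, H⟩ := h B
    choose k hk hk' using H
    let T : CostructuredArrow (prod.functor.obj A) B := CostructuredArrow.mk (Y := E) ev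
    have : IsTerminal T := IsTerminal.ofUniqueHom
      (fun Y => CostructuredArrow.homMk (k Y.left Y.hom) (hk Y.left Y.hom))
      (fun Y m => CostructuredArrow.hom_ext _ _ (hk' Y.left Y.hom _ (CostructuredArrow.w m)))
    exact this.hasTerminal
  exact isLeftAdjoint_of_costructuredArrowTerminals _

theorem exists_exponential_of_isLeftAdjoint {C : Type u₁} [Category.{v₁} C] [HasBinaryProducts C]
    (A : C) (h : (prod.functor.obj A).IsLeftAdjoint) (B : C) :
    ∃ (E : C) (ev : A ⨯ E ⟶ B), ∀ (Y : C) (g : A ⨯ Y ⟶ B),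
      ∃! k : Y ⟶ E, prod.map (𝟙 A) k ≫ ev = g := by
  let adj := Adjunction.ofIsLeftAdjoint (prod.functor.obj A)
  refine ⟨(prod.functor.obj A).rightAdjoint.obj B, adj.counit.app B, fun Y g =>
    ⟨adj.homEquiv Y B g, ?_, fun k hk => ?_⟩⟩
  · exact ((adj.homEquiv_counit _ _ _).symm.trans ((adj.homEquiv Y B).symm_apply_apply g))
  · rw [← hk]
    exact ((adj.homEquiv Y B).apply_symm_apply k).symm.trans
      (congrArg _ (adj.homEquiv_counit _ _ _))

theorem IsElementaryTopos.of_equivalence {C : Type u₁} [Category.{v₁} C] {D : Type u₂}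
    [Category.{v₂} D] (e : C ≌ D) (h : IsElementaryTopos D) : IsElementaryTopos C := by
  obtain ⟨h1, h2, ⟨⟨h3⟩⟩⟩ := h
  have : HasFiniteLimits C := ⟨fun J _ _ => Adjunction.hasLimitsOfShape_of_equivalence e.functor⟩
  refine ⟨this, fun A => ?_, ⟨⟨h3.ofEquivalence e.symm⟩⟩⟩
  have := h2 (e.functor.obj A)
  -- Up to isomorphism, A × − is the functor eA × − conjugated by the equivalence e, hence a
  -- composite of left adjoints.
  have i : prod.functor.obj A ≅ e.functor ⋙ prod.functor.obj (e.functor.obj A) ⋙ e.inverse :=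
    (Functor.rightUnitor _).symm ≪≫ Functor.isoWhiskerLeft _ e.unitIso ≪≫
      (Functor.associator _ _ _).symm ≪≫
      Functor.isoWhiskerRight (prodComparisonNatIso e.functor A) e.inverse ≪≫
      Functor.associator _ _ _
  exact Functor.isLeftAdjoint_of_iso i.symm

variable {M : Struc.{u}} [hM : Fact M.IsModel]

namespace ISheaf

variable (X : ISite M)

instance : HasFiniteLimits (ISheaf X) :=
  have : HasTerminal (ISheaf X) := (isTerminalTerminal X).hasTerminal
  have : HasPullbacks (ISheaf X) :=
    @hasPullbacks_of_hasLimit_cospan _ _ fun {_ _ _ f g} => (isPullback_pullback f g).hasPullback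
  hasFiniteLimits_of_hasTerminal_and_pullbacks

theorem isElementaryTopos : IsElementaryTopos (ISheaf X) := by
  refine ⟨inferInstance, fun F => isLeftAdjoint_prod_of_exists F fun G => ?_,
    ⟨⟨classifier X⟩⟩⟩
  -- The exponential was built for the explicit product over the terminal sheaf; i and j are the
  -- mutually inverse comparisons with the chosen product.
  let i (Y : ISheaf X) : F ⨯ Y ⟶ pullback (toTerminal F) (toTerminal Y) :=
    pullbackLift prod.fst prod.snd ((isTerminalTerminal X).hom_ext _ _)
  let j (Y : ISheaf X) : pullback (toTerminal F) (toTerminal Y) ⟶ F ⨯ Y :=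
    prod.lift (pullbackFst _ _) (pullbackSnd _ _)
  have hij (Y : ISheaf X) : i Y ≫ j Y = 𝟙 _ := by
    ext
    · simp only [j, Category.assoc, prod.lift_fst, Category.id_comp]
      rfl
    · simp only [j, Category.assoc, prod.lift_snd, Category.id_comp]
      rfl
  have hji (Y : ISheaf X) : j Y ≫ i Y = 𝟙 _ := (isPullback_pullback _ _).hom_ext
    ((Category.assoc _ _ _).trans ((prod.lift_fst _ _).trans (Category.id_comp _).symm))
    ((Category.assoc _ _ _).trans ((prod.lift_snd _ _).trans (Category.id_comp _).symm))
  refine ⟨exp F G, i _ ≫ eval F G, fun Y g => ?_⟩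
  obtain ⟨h, h1, h2⟩ := existsUnique_transpose (j Y ≫ g)
  have key (k : Y ⟶ exp F G) : (∀ (x : F.El) (y : Y.El) (e : F.idx x = Y.idx y),
      (eval F G).toFun ⟨(x, k.toFun y), e.trans (k.idx_map y).symm⟩ =
        (j Y ≫ g).toFun ⟨(x, y), e⟩) ↔ prod.map (𝟙 F) k ≫ i _ ≫ eval F G = g := by
    have hk (z : (F ⨯ Y).El) (e) : (prod.map (𝟙 F) k ≫ i _).toFun z =
        ⟨((prod.fst : F ⨯ Y ⟶ F).toFun z, k.toFun ((prod.snd : F ⨯ Y ⟶ Y).toFun z)), e⟩ := by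
      refine Subtype.ext (Prod.ext ?_ ?_)
      · have : prod.map (𝟙 F) k ≫ prod.fst = prod.fst := by simp
        exact congr_toFun this z
      · have : prod.map (𝟙 F) k ≫ prod.snd = prod.snd ≫ k := by simp
        exact congr_toFun this z
    constructor
    · intro H
      refine hom_ext fun z => ?_
      have e : F.idx ((prod.fst : F ⨯ Y ⟶ F).toFun z) = Y.idx ((prod.snd : F ⨯ Y ⟶ Y).toFun z) :=
        ((prod.fst : F ⨯ Y ⟶ F).idx_map z).trans ((prod.snd : F ⨯ Y ⟶ Y).idx_map z).symm
      rw [← Category.assoc, comp_toFun, hk z (e.trans (k.idx_map _).symm), H _ _ e]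
      exact congr_toFun ((Category.assoc _ _ _).symm.trans
        ((congrArg (· ≫ g) (hij Y)).trans (Category.id_comp g))) z
    · intro H x y e
      have hx : (prod.fst : F ⨯ Y ⟶ F).toFun ((j Y).toFun ⟨(x, y), e⟩) = x :=
        congr_toFun (prod.lift_fst (pullbackFst _ _) (pullbackSnd _ _)) ⟨(x, y), e⟩
      have hy : (prod.snd : F ⨯ Y ⟶ Y).toFun ((j Y).toFun ⟨(x, y), e⟩) = y :=
        congr_toFun (prod.lift_snd (pullbackFst _ _) (pullbackSnd _ _)) ⟨(x, y), e⟩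
      rw [← H, comp_toFun, ← Category.assoc, comp_toFun, hk _ (by
        rw [hx, hy]
        exact e.trans (k.idx_map y).symm)]
      congr 1
      exact Subtype.ext (Prod.ext hx.symm (congrArg k.toFun hy.symm))
  exact ⟨h, (key h).1 h1, fun k hk => h2 k ((key k).2 hk)⟩

end ISheaf

end MTT

namespace MTT

open CategoryTheory

/-! ### Equivalences given by relations -/

namespace CatData

section

variable {U : Type u} {X Y : CatData U}

theorem IsCategory.isId_unique (hX : X.IsCategory) {i j A : U} (hi : X.IsId i A)
    (hj : X.IsId j A) : i = j :=
  (hX.comp_exists _ _ _ _ _ hj.1 hi.1).unique (hj.2.1 _ hi.1.1) (hi.2.2 _ hj.1.2)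

theorem IsCategory.isId_id (hX : X.IsCategory) (A : X.Obj) :
    X.IsId (hX.category.id A).1 A.1 :=
  (hX.id_exists A.1 A.2).choose_spec

theorem IsCategory.comp_comp (hX : X.IsCategory) {A B C : X.Obj} (f : hX.category.Hom A B)
    (g : hX.category.Hom B C) : X.Comp g.1 f.1 (hX.category.comp f g).1 :=
  (hX.exists_comp f g).choose_spec

theorem IsCategory.comp_eq (hX : X.IsCategory) {A B C : X.Obj} {f : hX.category.Hom A B}
    {g : hX.category.Hom B C} {k : hX.category.Hom A C} (h : X.Comp g.1 f.1 k.1) :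
    hX.category.comp f g = k :=
  hX.comp_unique (hX.comp_comp f g) h

/-- An arrow that is an isomorphism, as an isomorphism. -/
noncomputable def IsCategory.iso (hX : X.IsCategory) {A B : X.Obj} {f : U}
    (h : X.IsIsoArrow f A.1 B.1) : letI := hX.category; A ≅ B :=
  letI := hX.category
  { hom := ⟨f, h.1⟩
    inv := ⟨h.2.choose, h.2.choose_spec.choose_spec.choose_spec.1⟩
    hom_inv_id := by
      obtain ⟨h1, h2, h3, h4, h5⟩ := h.2.choose_spec.choose_spec.choose_spec
      refine hX.comp_eq (k := hX.category.id A) ?_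
      rwa [hX.isId_unique (hX.isId_id A) h2]
    inv_hom_id := by
      obtain ⟨h1, h2, h3, h4, h5⟩ := h.2.choose_spec.choose_spec.choose_spec
      refine hX.comp_eq (k := hX.category.id B) ?_
      rwa [hX.isId_unique (hX.isId_id B) h3] }

/-- A functor given by relations, as a functor. -/
noncomputable def IsFunctor.functor (hX : X.IsCategory) (hY : Y.IsCategory) {Fo Fa : U → U → Prop}
    (h : IsFunctor X Y Fo Fa) : letI := hX.category; letI := hY.category; X.Obj ⥤ Y.Obj :=
  letI := hX.category
  letI := hY.category
  { obj A := ⟨(h.obj.2 A.1 A.2).choose, (h.obj.1 _ _ (h.obj.2 A.1 A.2).choose_spec.1).2⟩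
    map {A B} f := ⟨(h.arr.2 f.1 (hX.dom.1 _ _ f.2.1).1).choose,
      h.hom _ _ _ _ _ _ f.2 (h.arr.2 f.1 (hX.dom.1 _ _ f.2.1).1).choose_spec.1
        (h.obj.2 A.1 A.2).choose_spec.1 (h.obj.2 B.1 B.2).choose_spec.1⟩
    map_id A := Subtype.ext (hY.isId_unique (h.id _ _ _ _ (hX.isId_id A)
      (h.arr.2 _ (hX.dom.1 _ _ (hX.category.id A).2.1).1).choose_spec.1
      (h.obj.2 A.1 A.2).choose_spec.1) (hY.isId_id _))
    map_comp f g := (hY.comp_eq (h.comp _ _ _ _ _ _ (hX.comp_comp f g)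
      (h.arr.2 _ (hX.dom.1 _ _ g.2.1).1).choose_spec.1
      (h.arr.2 _ (hX.dom.1 _ _ f.2.1).1).choose_spec.1
      (h.arr.2 _ (hX.dom.1 _ _ (hX.category.comp f g).2.1).1).choose_spec.1)).symm }

theorem IsFunctor.functor_obj (hX : X.IsCategory) (hY : Y.IsCategory) {Fo Fa : U → U → Prop}
    (h : IsFunctor X Y Fo Fa) (A : X.Obj) :
    letI := hX.category; letI := hY.category; Fo A.1 ((h.functor hX hY).obj A).1 :=
  (h.obj.2 A.1 A.2).choose_spec.1

theorem IsFunctor.functor_map (hX : X.IsCategory) (hY : Y.IsCategory) {Fo Fa : U → U → Prop}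
    (h : IsFunctor X Y Fo Fa) {A B : X.Obj} (f : hX.category.Hom A B) :
    letI := hX.category; letI := hY.category; Fa f.1 ((h.functor hX hY).map f).1 :=
  (h.arr.2 f.1 (hX.dom.1 _ _ f.2.1).1).choose_spec.1

/-- The functors are arbitrary ones whose values satisfy the relations, so the lemma applies both to
identities and to composites presented by relational composition. -/
theorem IsNatIso.nonempty_iso (hX : X.IsCategory) (hY : Y.IsCategory)
    {Fo Fa Go Ga η : U → U → Prop} (h : IsNatIso X Y Fo Fa Go Ga η) :
    letI := hX.category
    letI := hY.category
    ∀ (F G : X.Obj ⥤ Y.Obj), (∀ A : X.Obj, Fo A.1 (F.obj A).1) →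
    (∀ {A B : X.Obj} (f : A ⟶ B), Fa f.1 (F.map f).1) → (∀ A : X.Obj, Go A.1 (G.obj A).1) →
    (∀ {A B : X.Obj} (f : A ⟶ B), Ga f.1 (G.map f).1) → Nonempty (F ≅ G) := by
  let := hX.category
  let := hY.category
  intro F G h1 h2 h3 h4
  have h5 (A : X.Obj) := (h.fn.2 A.1 A.2).choose_spec.1
  refine ⟨NatIso.ofComponents (fun A => hY.iso (h.iso _ _ _ _ (h5 A) (h1 A) (h3 A))) ?_⟩
  intro A B f
  obtain ⟨k, hk, hk'⟩ := h.natural _ _ _ _ _ _ _ f.2 (h2 f) (h4 f) (h5 A) (h5 B)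
  have e1 := hY.hom_unique (F.map f).2 (h.iso _ _ _ _ (h5 B) (h1 B) (h3 B)).1 hk
  exact (hY.comp_eq (k := ⟨k, e1⟩) hk).trans (hY.comp_eq (k := ⟨k, e1⟩) hk').symm

end

/-- If the objects and arrows of `Y` are represented by objects and arrows of a category, then `Y`
is a category, and the representation is a fully faithful functor. -/
theorem exists_functor_of_representation {U : Type u} (Y : CatData U) {D : Type u₁}
    [Category.{v₁} D] (Φ : Y.Obj → D) (ψ : ∀ P Q : Y.Obj, {a // Y.Hom a P.1 Q.1} ≃ (Φ P ⟶ Φ Q))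
    (hdom : IsFunRel Y.Dom Y.Ar Y.Ob) (hcod : IsFunRel Y.Cod Y.Ar Y.Ob)
    (hhom : ∀ g f h, Y.Comp g f h → ∃ A B C, Y.Hom f A B ∧ Y.Hom g B C ∧ Y.Hom h A C)
    (hcomp : ∀ (P Q R : Y.Obj) (f : {a // Y.Hom a P.1 Q.1}) (g : {a // Y.Hom a Q.1 R.1})
      (h : {a // Y.Hom a P.1 R.1}), Y.Comp g.1 f.1 h.1 ↔ ψ _ _ f ≫ ψ _ _ g = ψ _ _ h) :
    ∃ hY : Y.IsCategory, letI := hY.category; ∃ F : Y.Obj ⥤ D,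
      (∀ A, F.obj A = Φ A) ∧ F.Full ∧ F.Faithful := by
  have hob : ∀ {f A B}, Y.Hom f A B → ∃ (P Q : Y.Obj), P.1 = A ∧ Q.1 = B := fun {f A B} h =>
    ⟨⟨A, (hdom.1 _ _ h.1).2⟩, ⟨B, (hcod.1 _ _ h.2).2⟩, rfl, rfl⟩
  have hhom_eq : ∀ {f A B A' B'}, Y.Hom f A B → Y.Hom f A' B' → A = A' ∧ B = B' := fun h h' =>
    ⟨(hdom.2 _ (hdom.1 _ _ h.1).1).unique h.1 h'.1, (hcod.2 _ (hcod.1 _ _ h.2).1).unique h.2 h'.2⟩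
  have hcat : Y.IsCategory := by
    refine ⟨hdom, hcod, hhom, ?_, ?_, ?_⟩
    · intro f g A B C hf hg
      obtain ⟨P, Q, rfl, rfl⟩ := hob hf
      obtain ⟨-, R, -, rfl⟩ := hob hg
      refine ⟨((ψ P R).symm (ψ P Q ⟨f, hf⟩ ≫ ψ Q R ⟨g, hg⟩)).1, ?_, ?_⟩
      · exact (hcomp P Q R ⟨f, hf⟩ ⟨g, hg⟩ _).2 ((ψ P R).apply_symm_apply _).symm
      · intro h hh
        obtain ⟨A, B, C, h1, h2, h3⟩ := hhom _ _ _ hh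
        obtain ⟨rfl, rfl⟩ := hhom_eq hf h1
        obtain ⟨-, rfl⟩ := hhom_eq hg h2
        have := (hcomp P Q R ⟨f, hf⟩ ⟨g, hg⟩ ⟨h, h3⟩).1 hh
        rw [this, Equiv.symm_apply_apply]
    · intro f g h p q r hp hq hr
      obtain ⟨A, B, C, hf, hg, hp'⟩ := hhom _ _ _ hp
      obtain ⟨B', C', D, hg', hh, hq'⟩ := hhom _ _ _ hq
      obtain ⟨rfl, rfl⟩ := hhom_eq hg hg'
      obtain ⟨A', C', D', h1, h2, hr'⟩ := hhom _ _ _ hr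
      obtain ⟨rfl, rfl⟩ := hhom_eq hp' h1
      obtain ⟨-, rfl⟩ := hhom_eq hh h2
      obtain ⟨P, Q, rfl, rfl⟩ := hob hf
      obtain ⟨R, S, rfl, rfl⟩ := hob hh
      have e1 := (hcomp _ _ _ ⟨f, hf⟩ ⟨g, hg⟩ ⟨p, hp'⟩).1 hp
      have e2 := (hcomp _ _ _ ⟨g, hg⟩ ⟨h, hh⟩ ⟨q, hq'⟩).1 hq
      have e3 := (hcomp _ _ _ ⟨p, hp'⟩ ⟨h, hh⟩ ⟨r, hr'⟩).1 hr
      refine (hcomp _ _ _ ⟨f, hf⟩ ⟨q, hq'⟩ ⟨r, hr'⟩).2 ?_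
      rw [← e3, ← e1, ← e2, Category.assoc]
    · intro A hA
      refine ⟨((ψ ⟨A, hA⟩ ⟨A, hA⟩).symm (𝟙 _)).1, ((ψ ⟨A, hA⟩ ⟨A, hA⟩).symm (𝟙 _)).2, ?_, ?_⟩
      · intro f hf
        obtain ⟨B, hB, -⟩ := hcod.2 f (hdom.1 _ _ hf).1
        refine (hcomp ⟨A, hA⟩ ⟨A, hA⟩ ⟨B, (hcod.1 _ _ hB).2⟩ _ ⟨f, hf, hB⟩ ⟨f, hf, hB⟩).2 ?_
        rw [Equiv.apply_symm_apply, Category.id_comp]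
      · intro f hf
        obtain ⟨B, hB, -⟩ := hdom.2 f (hcod.1 _ _ hf).1
        refine (hcomp ⟨B, (hdom.1 _ _ hB).2⟩ ⟨A, hA⟩ ⟨A, hA⟩ ⟨f, hB, hf⟩ _ ⟨f, hB, hf⟩).2 ?_
        rw [Equiv.apply_symm_apply, Category.comp_id]
  let := hcat.category
  let F : Y.Obj ⥤ D :=
    { obj := Φ
      map {P Q} f := ψ P Q f
      map_id P := by
        have := (hcomp _ _ _ _ _ _).1 (hcat.comp_comp (hcat.category.id P) (hcat.category.id P))
        have e : hcat.category.comp (hcat.category.id P) (hcat.category.id P) = hcat.category.id P :=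
          hcat.category.id_comp _
        rw [e] at this
        -- Composing the identity of Y with the arrow that represents 𝟙 shows that its image
        -- followed by 𝟙 is 𝟙; surjectivity of ψ is what preserves identities.
        have h1 := (hcomp _ _ _ _ ((ψ P P).symm (𝟙 _)) _).1
          (hcat.comp_comp (hcat.category.id P) ((ψ P P).symm (𝟙 _)))
        have e' : hcat.category.comp (hcat.category.id P) ((ψ P P).symm (𝟙 _)) =
          (ψ P P).symm (𝟙 _) := hcat.category.id_comp _
        rw [e', Equiv.apply_symm_apply, Category.comp_id] at h1
        exact h1
      map_comp f g := ((hcomp _ _ _ _ _ _).1 (hcat.comp_comp f g)).symm }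
  exact ⟨hcat, F, fun _ => rfl, ⟨fun {P Q} f => ⟨(ψ P Q).symm f, (ψ P Q).apply_symm_apply f⟩⟩,
    ⟨fun {P Q} _ _ h => (ψ P Q).injective h⟩⟩

end CatData

theorem Struc.Equivalent.nonempty_equivalence {M : Struc.{u}} {X Y : CatData M.V}
    (h : Struc.Equivalent X Y) (hX : X.IsCategory) (hY : Y.IsCategory) :
    letI := hX.category; letI := hY.category; Nonempty (X.Obj ≌ Y.Obj) := by
  let := hX.category
  let := hY.category
  obtain ⟨Fo, Fa, Go, Ga, η, ε, -, hF, hG, hη, hε⟩ := h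
  obtain ⟨i⟩ := hη.nonempty_iso hX hX (𝟭 _) (hF.functor hX hY ⋙ hG.functor hY hX) (fun _ => rfl)
    (fun _ => rfl) (fun A => ⟨_, hF.functor_obj hX hY A, hG.functor_obj hY hX _⟩)
    (fun f => ⟨_, hF.functor_map hX hY f, hG.functor_map hY hX _⟩)
  obtain ⟨j⟩ := hε.nonempty_iso hY hY (hG.functor hY hX ⋙ hF.functor hX hY) (𝟭 _)
    (fun A => ⟨_, hG.functor_obj hY hX A, hF.functor_obj hX hY _⟩)
    (fun f => ⟨_, hG.functor_map hY hX f, hF.functor_map hX hY _⟩) (fun _ => rfl)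
    (fun _ => rfl)
  exact ⟨CategoryTheory.Equivalence.mk _ _ i j⟩

end MTT

namespace MTT

open CategoryTheory Struc

/-! ### The internal site of a small site of the model -/

section

variable {M : Struc.{u}} [hM : Fact M.IsModel]

open Coded

/-- The type of the members of a set. -/
def Elt (x : M.V) : Type u := {z : M.V // M.Mem z x}

instance (x : M.V) : Coded M (Elt x) where
  code z := z.1
  code_injective := Subtype.val_injective
  range := x
  mem_range z := ⟨fun h => ⟨⟨z, h⟩, rfl⟩, by rintro ⟨w, rfl⟩; exact w.2⟩

theorem isPair_elt {x y p : M.V} {a : Elt x} {b : Elt y} :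
    M.IsPair p a.1 b.1 ↔ p = code (a, b) := isPair_iff (a := a) (b := b)

theorem rel_elt {x y s : M.V} {a : Elt x} {b : Elt y} :
    M.Rel (M.elts s) a.1 b.1 ↔ M.Mem (code (a, b)) s := rel_elts_iff (a := a) (b := b)

theorem ifun_mem {α : Type*} [Coded M α] (s : M.V) : IFun M fun a : α => M.Mem (code a) s :=
  IPred.ifun ⟨s, fun _ => Iff.rfl⟩

/-- Composition in a small category and the action of a presheaf are partial. With a default value
off the domain they become total internal maps, as internal sites and sheaves require. -/
theorem exists_ifun_of_partial {α β : Type*} [Coded M α] [Coded M β] {Q : α → β → Prop}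
    {D : α → Prop} {d : α → β} (hQ : IFun M fun p : α × β => Q p.1 p.2) (hD : IFun M D)
    (hd : IFun M d) (h : ∀ a, D a → ∃! b, Q a b) :
    ∃ f : α → β, IFun M f ∧ (∀ a, D a → ∀ b, Q a b ↔ f a = b) ∧ ∀ a, ¬ D a → f a = d a := by
  classical
  let f : α → β := fun a => if ha : D a then (h a ha).choose else d a
  have h1 : ∀ a, D a → ∀ b, Q a b ↔ f a = b := fun a ha b => by
    simp only [f, dif_pos ha]
    exact ⟨fun hb => (h a ha).unique (h a ha).choose_spec.1 hb,
      fun e => e ▸ (h a ha).choose_spec.1⟩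
  have h2 : ∀ a, ¬ D a → f a = d a := fun a ha => dif_neg ha
  refine ⟨f, .of_graph ?_, h1, h2⟩
  have h3 : ∀ p : α × β, (f p.1 = p.2) = ((D p.1 ∧ Q p.1 p.2) ∨ (¬ D p.1 ∧ d p.1 = p.2)) := by
    intro p
    by_cases hp : D p.1
    · simp [hp, h1]
    · simp [hp, h2]
  simp only [h3]
  fun_prop

/-- With the converse `exists_isFun_of_ifun`, this is the dictionary between functions that are sets
of the model and internal maps. -/
theorem exists_ifun_of_isFun {f A B : M.V} (h : M.IsFun (M.elts f) (M.elts A) (M.elts B)) :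
    ∃ g : Elt A → Elt B, IFun M g ∧ ∀ a b, M.Rel (M.elts f) a.1 b.1 ↔ g a = b := by
  have H : ∀ a : Elt A, ∃ b : Elt B, M.Rel (M.elts f) a.1 b.1 := fun a => by
    obtain ⟨b, hb, -⟩ := h.2.2 a.1 a.2
    exact ⟨⟨b, (h.2.1 _ _ hb).2⟩, hb⟩
  choose g hg using H
  have hg' : ∀ (a : Elt A) (b : Elt B), M.Rel (M.elts f) a.1 b.1 ↔ g a = b := fun a b =>
    ⟨fun hb => Subtype.ext ((h.2.2 a.1 a.2).unique (hg a) hb), fun e => e ▸ hg a⟩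
  refine ⟨g, .of_graph ?_, hg'⟩
  have e : ∀ p : Elt A × Elt B, (g p.1 = p.2) = M.Mem (code p) f := fun p =>
    propext ((hg' p.1 p.2).symm.trans rel_elt)
  simp only [e]
  exact ifun_mem f

theorem exists_isFun_of_ifun {A B : M.V} {g : Elt A → Elt B} (hg : IFun M g) :
    ∃ f : M.V, M.IsFun (M.elts f) (M.elts A) (M.elts B) ∧
      ∀ a b, M.Rel (M.elts f) a.1 b.1 ↔ g a = b := by
  obtain ⟨f, hf⟩ := IPred.exists_set hg
  have h : ∀ a b, M.Rel (M.elts f) a.1 b.1 ↔ g a = b := fun a b => by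
    rw [rel_elt, hf]
    simp [code_eq_code]
  have h' : ∀ a b, M.Rel (M.elts f) a b → M.Mem a A ∧ M.Mem b B := by
    rintro a b ⟨p, hp, hpf⟩
    obtain ⟨q, -, rfl⟩ := (hf p).1 hpf
    obtain ⟨rfl, rfl⟩ := IsPair.inj hM.out hp (isPair_code q.1 q.2)
    exact ⟨q.1.2, q.2.2⟩
  refine ⟨f, ⟨fun p hp => ?_, h', fun a ha => ?_⟩, h⟩
  · obtain ⟨q, -, rfl⟩ := (hf p).1 hp
    exact ⟨_, _, isPair_code q.1 q.2⟩
  · refine ⟨_, (h ⟨a, ha⟩ _).2 rfl, fun b hb => ?_⟩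
    have := (h ⟨a, ha⟩ ⟨b, (h' _ _ hb).2⟩).1 hb
    exact (congrArg Subtype.val this).symm

theorem isFun_ext {f f' A B : M.V} (h : M.IsFun (M.elts f) (M.elts A) (M.elts B))
    (h' : M.IsFun (M.elts f') (M.elts A) (M.elts B))
    (e : ∀ (a : Elt A) (b : Elt B), M.Rel (M.elts f) a.1 b.1 ↔ M.Rel (M.elts f') a.1 b.1) :
    f = f' := by
  have aux : ∀ {f f' : M.V}, M.IsFun (M.elts f) (M.elts A) (M.elts B) →
      (∀ (a : Elt A) (b : Elt B), M.Rel (M.elts f) a.1 b.1 → M.Rel (M.elts f') a.1 b.1) →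
      ∀ z, M.Mem z f → M.Mem z f' := by
    intro f f' h e z hz
    obtain ⟨a, b, hab⟩ := h.1 z hz
    obtain ⟨ha, hb⟩ := h.2.1 a b ⟨z, hab, hz⟩
    obtain ⟨p, hp, hp'⟩ := e ⟨a, ha⟩ ⟨b, hb⟩ ⟨z, hab, hz⟩
    rwa [hab.unique hM.out hp]
  exact hM.out.ext fun z => ⟨aux h (fun a b => (e a b).1) z, aux h' (fun a b => (e a b).2) z⟩

/-- Any set of codes is itself the code of an internal subset. In this way sieves of the model
become elements of a coded power type. -/
theorem exists_code_eq_of_subset {α : Type*} [Coded M α] {x : M.V}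
    (h : ∀ z, M.Mem z x → ∃ a : α, code a = z) : ∃ S : IPow M α, code S = x := by
  refine ⟨⟨fun a => M.Mem (code a) x, ifun_mem x⟩, hM.out.ext fun z => ?_⟩
  rw [mem_code_pow]
  constructor
  · rintro ⟨a, ha, rfl⟩
    exact ha
  · intro hz
    obtain ⟨a, rfl⟩ := h z hz
    exact ⟨a, hz, rfl⟩

namespace Struc.SmallCat

variable (C : M.SmallCat)

theorem exists_dom : ∃ g : Elt C.C₁ → Elt C.C₀, IFun M g ∧
    ∀ f A, C.data.Dom f.1 A.1 ↔ g f = A :=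
  exists_ifun_of_isFun C.cat.1

theorem exists_cod : ∃ g : Elt C.C₁ → Elt C.C₀, IFun M g ∧
    ∀ f A, C.data.Cod f.1 A.1 ↔ g f = A :=
  exists_ifun_of_isFun C.cat.2.1

/-- The domain of an arrow. -/
noncomputable def domFun : Elt C.C₁ → Elt C.C₀ := C.exists_dom.choose

/-- The codomain of an arrow. -/
noncomputable def codFun : Elt C.C₁ → Elt C.C₀ := C.exists_cod.choose

theorem ifun_domFun : IFun M C.domFun := C.exists_dom.choose_spec.1

theorem ifun_codFun : IFun M C.codFun := C.exists_cod.choose_spec.1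

@[fun_prop]
theorem ifun_domFun_comp {α : Type*} [Coded M α] {f : α → Elt C.C₁} (hf : IFun M f) :
    IFun M fun a => C.domFun (f a) := C.ifun_domFun.comp hf

@[fun_prop]
theorem ifun_codFun_comp {α : Type*} [Coded M α] {f : α → Elt C.C₁} (hf : IFun M f) :
    IFun M fun a => C.codFun (f a) := C.ifun_codFun.comp hf

omit hM in
theorem isCategory : C.data.IsCategory := C.cat.2.2.2

variable {C}

theorem dom_iff {f : Elt C.C₁} {A : Elt C.C₀} : C.data.Dom f.1 A.1 ↔ C.domFun f = A :=
  C.exists_dom.choose_spec.2 f A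

theorem cod_iff {f : Elt C.C₁} {A : Elt C.C₀} : C.data.Cod f.1 A.1 ↔ C.codFun f = A :=
  C.exists_cod.choose_spec.2 f A

theorem exists_of_dom {f A : M.V} (h : C.data.Dom f A) :
    ∃ f' : Elt C.C₁, f'.1 = f ∧ (C.domFun f').1 = A := by
  obtain ⟨h1, h2⟩ := C.isCategory.dom.1 _ _ h
  exact ⟨⟨f, h1⟩, rfl, congrArg Subtype.val (dom_iff (A := ⟨A, h2⟩).1 h)⟩

theorem exists_of_cod {f A : M.V} (h : C.data.Cod f A) :
    ∃ f' : Elt C.C₁, f'.1 = f ∧ (C.codFun f').1 = A := by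
  obtain ⟨h1, h2⟩ := C.isCategory.cod.1 _ _ h
  exact ⟨⟨f, h1⟩, rfl, congrArg Subtype.val (cod_iff (A := ⟨A, h2⟩).1 h)⟩

theorem dom_self (f : Elt C.C₁) : C.data.Dom f.1 (C.domFun f).1 := dom_iff.2 rfl

theorem cod_self (f : Elt C.C₁) : C.data.Cod f.1 (C.codFun f).1 := cod_iff.2 rfl

theorem exists_of_comp {g f h : M.V} (H : C.data.Comp g f h) : ∃ g' f' h' : Elt C.C₁,
    g'.1 = g ∧ f'.1 = f ∧ h'.1 = h ∧ C.codFun f' = C.domFun g' := by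
  obtain ⟨A, B, D, hf, hg, hh⟩ := C.isCategory.comp_hom _ _ _ H
  obtain ⟨f', rfl, hf'⟩ := exists_of_cod hf.2
  obtain ⟨g', rfl, hg'⟩ := exists_of_dom hg.1
  obtain ⟨h', rfl, -⟩ := exists_of_dom hh.1
  exact ⟨g', f', h', rfl, rfl, rfl, Subtype.ext (hf'.trans hg'.symm)⟩

theorem comp_iff_mem {g f h : Elt C.C₁} :
    C.data.Comp g.1 f.1 h.1 ↔ M.Mem (code ((g, f), h)) C.m := by
  change (∃ q, M.IsPair q g.1 f.1 ∧ M.Rel _ q h.1) ↔ _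
  simp only [isPair_elt, exists_eq_left]
  exact rel_elts_iff (a := (g, f)) (b := h)

variable (C) in
theorem exists_comp : ∃ c : Elt C.C₁ × Elt C.C₁ → Elt C.C₁, IFun M c ∧
    ∀ g f h, C.data.Comp g.1 f.1 h.1 ↔ C.codFun f = C.domFun g ∧ c (g, f) = h := by
  obtain ⟨c, hc, hc', -⟩ := exists_ifun_of_partial (α := Elt C.C₁ × Elt C.C₁) (β := Elt C.C₁)
    (Q := fun p h => M.Mem (code (p, h)) C.m) (D := fun p => C.codFun p.2 = C.domFun p.1)
    (d := fun p => p.1) (ifun_mem C.m) (by fun_prop) (by fun_prop) (by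
      rintro ⟨g, f⟩ hgf
      have hgf : C.codFun f = C.domFun g := hgf
      obtain ⟨h, hh, hh'⟩ := C.isCategory.comp_exists f.1 g.1 _ _ _
        ⟨dom_self f, cod_self f⟩ ⟨hgf ▸ dom_self g, cod_self g⟩
      obtain ⟨-, -, h', -, -, rfl, -⟩ := exists_of_comp hh
      exact ⟨h', comp_iff_mem.1 hh, fun k hk => Subtype.ext (hh' _ (comp_iff_mem.2 hk))⟩)
  refine ⟨c, hc, fun g f h => ?_⟩
  constructor
  · intro H
    obtain ⟨g', f', h', e1, e2, -, e⟩ := exists_of_comp H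
    obtain rfl := Subtype.ext e1
    obtain rfl := Subtype.ext e2
    exact ⟨e, (hc' (g', f') e h).1 (comp_iff_mem.1 H)⟩
  · rintro ⟨e, rfl⟩
    exact comp_iff_mem.2 ((hc' (g, f) e _).2 rfl)

variable (C) in
/-- The composite of two arrows. -/
noncomputable def compFun (g f : Elt C.C₁) : Elt C.C₁ := C.exists_comp.choose (g, f)

variable (C) in
@[fun_prop]
theorem ifun_compFun_comp {α : Type*} [Coded M α] {f g : α → Elt C.C₁} (hf : IFun M f)
    (hg : IFun M g) : IFun M fun a => C.compFun (f a) (g a) :=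
  C.exists_comp.choose_spec.1.comp (hf.prodMk hg)

theorem comp_iff {g f h : Elt C.C₁} : C.data.Comp g.1 f.1 h.1 ↔
    C.codFun f = C.domFun g ∧ C.compFun g f = h :=
  C.exists_comp.choose_spec.2 g f h

theorem comp_self {g f : Elt C.C₁} (h : C.codFun f = C.domFun g) :
    C.data.Comp g.1 f.1 (C.compFun g f).1 := comp_iff.2 ⟨h, rfl⟩

-- Being an identity is tested by arrows of the small category only, so it is a condition quantified
-- over a coded type and the identity map is internal.
variable (C) in
theorem exists_id : ∃ i : Elt C.C₀ → Elt C.C₁, IFun M i ∧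
    ∀ A j, C.data.IsId j.1 A.1 ↔ i A = j := by
  have hid : ∀ A : Elt C.C₀, ∃ i : Elt C.C₁, C.data.IsId i.1 A.1 := fun A => by
    obtain ⟨i, hi⟩ := C.isCategory.id_exists A.1 A.2
    obtain ⟨i', rfl, -⟩ := exists_of_dom hi.1.1
    exact ⟨i', hi⟩
  choose i hi using hid
  have h : ∀ A j, C.data.IsId j.1 A.1 ↔ i A = j := fun A j =>
    ⟨fun h => Subtype.ext (C.isCategory.isId_unique (hi A) h), fun h => h ▸ hi A⟩
  refine ⟨i, .of_graph ?_, h⟩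
  have h' : ∀ p : Elt C.C₀ × Elt C.C₁, (i p.1 = p.2) =
      ((C.domFun p.2 = p.1 ∧ C.codFun p.2 = p.1) ∧
      (∀ f, C.domFun f = p.1 → C.compFun f p.2 = f) ∧
      (∀ f, C.codFun f = p.1 → C.compFun p.2 f = f)) := by
    intro p
    rw [← h, CatData.IsId, CatData.Hom, dom_iff, cod_iff]
    refine propext (and_congr_right fun hp => and_congr ?_ ?_)
    · constructor
      · intro H f hf
        exact (comp_iff.1 (H f.1 (dom_iff.2 hf))).2
      · intro H f hf
        obtain ⟨f', rfl, hf'⟩ := exists_of_dom hf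
        have hf' := Subtype.ext hf'
        exact comp_iff.2 ⟨hp.2.trans hf'.symm, H f' hf'⟩
    · constructor
      · intro H f hf
        exact (comp_iff.1 (H f.1 (cod_iff.2 hf))).2
      · intro H f hf
        obtain ⟨f', rfl, hf'⟩ := exists_of_cod hf
        have hf' := Subtype.ext hf'
        exact comp_iff.2 ⟨hf'.trans hp.1.symm, H f' hf'⟩
  simp only [h', forall_iff_not_exists, imp_iff_not_or]
  fun_prop

variable (C) in
/-- The identity arrows. -/
noncomputable def idFun : Elt C.C₀ → Elt C.C₁ := C.exists_id.choose

theorem isId_iff {A : Elt C.C₀} {i : Elt C.C₁} : C.data.IsId i.1 A.1 ↔ C.idFun A = i :=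
  C.exists_id.choose_spec.2 A i

theorem isId_self (A : Elt C.C₀) : C.data.IsId (C.idFun A).1 A.1 := isId_iff.2 rfl

theorem hom_comp {g f : Elt C.C₁} (h : C.codFun f = C.domFun g) :
    C.domFun (C.compFun g f) = C.domFun f ∧ C.codFun (C.compFun g f) = C.codFun g := by
  have := C.isCategory.hom_unique ⟨dom_self f, cod_self f⟩ ⟨h ▸ dom_self g, cod_self g⟩
    (comp_self h)
  exact ⟨dom_iff.1 this.1, cod_iff.1 this.2⟩

variable {J : M.V}

theorem isSieve_of_rel (hJ : IsTopology C J) {A S : M.V} (h : M.Rel (M.elts J) A S) :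
    IsSieve C S A := by
  obtain ⟨p, hp, hpJ⟩ := h
  obtain ⟨A', S', hp', -, hS⟩ := hJ.sieve p hpJ
  obtain ⟨rfl, rfl⟩ := IsPair.inj hM.out hp hp'
  exact hS

theorem exists_sieve_of_rel (hJ : IsTopology C J) {A S : M.V} (h : M.Rel (M.elts J) A S) :
    ∃ (A' : Elt C.C₀) (S' : IPow M (Elt C.C₁)), A'.1 = A ∧ code S' = S := by
  have hS := isSieve_of_rel hJ h
  obtain ⟨p, hp, hpJ⟩ := h
  obtain ⟨A', S', hp', hA, -⟩ := hJ.sieve p hpJ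
  obtain ⟨rfl, rfl⟩ := IsPair.inj hM.out hp hp'
  obtain ⟨S', hS'⟩ := exists_code_eq_of_subset (α := Elt C.C₁) (x := S) fun z hz => by
    obtain ⟨f, hf, -⟩ := exists_of_cod (hS.1 z hz)
    exact ⟨f, hf⟩
  exact ⟨⟨A, hA⟩, S', rfl, hS'⟩

theorem mem_code_elt {x : M.V} {S : IPow M (Elt x)} {a : Elt x} :
    M.Mem a.1 (code S) ↔ S.Mem a := code_mem_code_pow

theorem isPullbackSieve_code {g : Elt C.C₁} {S T : IPow M (Elt C.C₁)}
    (h : ∀ k, T.Mem k ↔ C.codFun k = C.domFun g ∧ S.Mem (C.compFun g k)) :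
    IsPullbackSieve C g.1 (code S) (code T) := by
  intro z
  rw [mem_code_pow]
  constructor
  · rintro ⟨k, hk, rfl⟩
    obtain ⟨h1, h2⟩ := (h k).1 hk
    exact ⟨_, comp_self h1, mem_code_elt.2 h2⟩
  · rintro ⟨k, hk, hk'⟩
    obtain ⟨-, f, k', -, rfl, rfl, -⟩ := exists_of_comp hk
    obtain ⟨h1, rfl⟩ := comp_iff.1 hk
    exact ⟨f, (h f).2 ⟨h1, mem_code_elt.1 hk'⟩, rfl⟩

theorem isSieve_code {A : Elt C.C₀} {S : IPow M (Elt C.C₁)} : IsSieve C (code S) A.1 ↔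
    (∀ f, S.Mem f → C.codFun f = A) ∧
      ∀ f h, S.Mem f → C.codFun h = C.domFun f → S.Mem (C.compFun f h) := by
  constructor
  · rintro ⟨h1, h2⟩
    exact ⟨fun f hf => cod_iff.1 (h1 _ (mem_code_elt.2 hf)), fun f h hf hh =>
      mem_code_elt.1 (h2 _ _ _ (mem_code_elt.2 hf) (comp_self hh))⟩
  · rintro ⟨h1, h2⟩
    refine ⟨fun f hf => ?_, fun f g h hf hc => ?_⟩
    · obtain ⟨f, hf', rfl⟩ := mem_code_pow.1 hf
      exact cod_iff.2 (h1 f hf')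
    · obtain ⟨f, g, h, rfl, rfl, rfl, -⟩ := exists_of_comp hc
      obtain ⟨h3, rfl⟩ := comp_iff.1 hc
      exact mem_code_elt.2 (h2 f g (mem_code_elt.1 hf) h3)

/-- The internal site given by a small site. -/
@[reducible]
noncomputable def site (C : M.SmallCat) {J : M.V} (hJ : IsTopology C J) : ISite M where
  Ob := Elt C.C₀
  Ar := Elt C.C₁
  dom := C.domFun
  cod := C.codFun
  id := C.idFun
  comp := C.compFun
  ifun_dom := C.ifun_domFun
  ifun_cod := C.ifun_codFun
  ifun_id := C.exists_id.choose_spec.1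
  ifun_comp := by fun_prop
  dom_id A := dom_iff.1 (isId_self A).1.1
  cod_id A := cod_iff.1 (isId_self A).1.2
  dom_comp g h H := (hom_comp H).1
  cod_comp g h H := (hom_comp H).2
  comp_id g := (comp_iff.1 ((isId_self _).2.1 _ (dom_self g))).2
  id_comp g := (comp_iff.1 ((isId_self _).2.2 _ (cod_self g))).2
  assoc g h k H H' := (comp_iff.1 (C.isCategory.assoc _ _ _ _ _ _ (comp_self H') (comp_self H)
    (comp_self ((hom_comp H').2.trans H)))).2
  Cov A S := M.Rel (M.elts J) A.1 (code S)
  ifun_cov := by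
    have h : ∀ p : Elt C.C₀ × IPow M (Elt C.C₁),
        M.Rel (M.elts J) p.1.1 (code p.2) = M.Mem (code p) J := fun p =>
      propext (rel_elts_iff (a := p.1) (b := p.2))
    simp only [h]
    exact ifun_mem J
  cov_cod A S f h hf := (isSieve_code.1 (isSieve_of_rel hJ h)).1 f hf
  cov_comp A S f h H hf hh := (isSieve_code.1 (isSieve_of_rel hJ H)).2 f h hf hh
  cov_max A S h := by
    refine hJ.maximal _ _ A.2 fun f => ?_
    rw [mem_code_pow]
    constructor
    · rintro ⟨f, hf, rfl⟩
      exact cod_iff.2 ((h f).1 hf)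
    · intro hf
      obtain ⟨f, rfl, hf'⟩ := exists_of_cod hf
      exact ⟨f, (h f).2 (cod_iff.1 hf), rfl⟩
  cov_pullback S T g hS hT := hJ.stable _ _ g.1 _ _ hS ⟨dom_self g, cod_self g⟩
    (isPullbackSieve_code hT)
  cov_trans A S R hS h1 h2 h3 := by
    refine hJ.transitive _ _ _ hS (isSieve_code.2 ⟨h1, h2⟩) fun f B T hf hB hT => ?_
    obtain ⟨f, rfl, rfl⟩ := exists_of_dom hB
    -- T is an arbitrary set of the model, but as a pullback sieve it consists of arrows of the
    -- category and so is coded.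
    obtain ⟨T, rfl⟩ := exists_code_eq_of_subset (α := Elt C.C₁) (x := T) fun z hz => by
      obtain ⟨k, hk, -⟩ := (hT z).1 hz
      obtain ⟨-, z, -, -, rfl, -⟩ := exists_of_comp hk
      exact ⟨z, rfl⟩
    refine h3 f T (mem_code_elt.1 hf) fun k => ?_
    rw [← mem_code_elt, hT]
    constructor
    · rintro ⟨l, hl, hl'⟩
      obtain ⟨-, -, l, -, -, rfl, -⟩ := exists_of_comp hl
      obtain ⟨h4, rfl⟩ := comp_iff.1 hl
      exact ⟨h4, mem_code_elt.1 hl'⟩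
    · rintro ⟨h4, h5⟩
      exact ⟨_, comp_self h4, mem_code_elt.2 h5⟩

end Struc.SmallCat

end

end MTT

namespace MTT

open CategoryTheory Struc Coded

/-! ### Sheaves in the model and internal sheaves -/

variable {M : Struc.{u}} [hM : Fact M.IsModel]

/-- The graph is a diagonal in the model. This handles the change from a coded type to the type of
members of its range. -/
theorem ifun_of_code_eq {α β : Type*} [Coded M α] [Coded M β] {f : α → β}
    (h : ∀ a, code (M := M) (f a) = code a) : IFun M f := by
  refine .of_formula (.bex 3 1 (.isPair 0 3 3)) [range α] fun p => ?_
  have h' (a : α) : M.IsPair (code p) (code a) (code a) ↔ p = (a, f a) := by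
    rw [← code_eq_code (M := M), ← isPair_iff, h]
  simp [assign, BddFormula.holds_isPair hM.out, exists_mem_range, h', Prod.ext_iff, eq_comm]

theorem Struc.IsTriple.inj {p a b c a' b' c' : M.V} (h : M.IsTriple p a b c)
    (h' : M.IsTriple p a' b' c') : a = a' ∧ b = b' ∧ c = c' := by
  obtain ⟨q, h1, h2⟩ := h
  obtain ⟨q', h1', h2'⟩ := h'
  obtain ⟨rfl, rfl⟩ := IsPair.inj hM.out h2 h2'
  exact ⟨rfl, IsPair.inj hM.out h1 h1'⟩

theorem Struc.IsTriple.unique {p p' a b c : M.V} (h : M.IsTriple p a b c)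
    (h' : M.IsTriple p' a b c) : p = p' := by
  obtain ⟨q, h1, h2⟩ := h
  obtain ⟨q', h1', h2'⟩ := h'
  obtain rfl := h1.unique hM.out h1'
  exact h2.unique hM.out h2'

theorem exists_isTriple (a b c : M.V) : ∃ p, M.IsTriple p a b c := by
  obtain ⟨q, hq⟩ := hM.out.exists_isPair b c
  obtain ⟨p, hp⟩ := hM.out.exists_isPair a q
  exact ⟨p, q, hq, hp⟩

/-- The sheaf condition for a presheaf given by its set of elements, indexing and action. -/
def SheafCondition (C : M.SmallCat) (J F₀ γ e : M.V) : Prop :=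
  ∀ A S x, M.Rel (M.elts J) A S → M.IsFun (M.elts x) (M.elts S) (M.elts F₀) →
    (∀ f s B, M.Rel (M.elts x) f s → C.data.Dom f B → M.Rel (M.elts γ) s B) →
    (∀ f f' g g' k s s' t t', C.data.Comp f g k → C.data.Comp f' g' k →
      M.Rel (M.elts x) f s → M.Rel (M.elts x) f' s' → Act e s g t → Act e s' g' t' → t = t') →
    ∃! s, M.Rel (M.elts γ) s A ∧ ∀ f t, M.Rel (M.elts x) f t → Act e s f t

namespace Struc.IsPresheafTriple

variable {C : M.SmallCat} {J F₀ γ e : M.V} (h : IsPresheafTriple C F₀ γ e)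

/-- The indexing map of a presheaf. -/
noncomputable def idxFun : Elt F₀ → Elt C.C₀ := (exists_ifun_of_isFun h.index).choose

theorem ifun_idxFun : IFun M h.idxFun := (exists_ifun_of_isFun h.index).choose_spec.1

@[fun_prop]
theorem ifun_idxFun_comp {α : Type*} [Coded M α] {f : α → Elt F₀} (hf : IFun M f) :
    IFun M fun a => h.idxFun (f a) := h.ifun_idxFun.comp hf

theorem idx_iff {s : Elt F₀} {A : Elt C.C₀} : M.Rel (M.elts γ) s.1 A.1 ↔ h.idxFun s = A :=
  (exists_ifun_of_isFun h.index).choose_spec.2 s A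

theorem idx_self (s : Elt F₀) : M.Rel (M.elts γ) s.1 (h.idxFun s).1 := h.idx_iff.2 rfl

include h in
omit hM in
theorem exists_of_rel {s A : M.V} (H : M.Rel (M.elts γ) s A) :
    ∃ (s' : Elt F₀) (A' : Elt C.C₀), s'.1 = s ∧ A'.1 = A := by
  obtain ⟨h1, h2⟩ := h.index.2.1 _ _ H
  exact ⟨⟨s, h1⟩, ⟨A, h2⟩, rfl, rfl⟩

theorem exists_of_act {s f t : M.V} (H : Act e s f t) : ∃ (s' : Elt F₀) (f' : Elt C.C₁)
    (t' : Elt F₀), s'.1 = s ∧ f'.1 = f ∧ t'.1 = t ∧ h.idxFun s' = C.codFun f' := by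
  obtain ⟨q, hq, hqt⟩ := H
  obtain ⟨⟨s', f', A, hq', hs, hf, hA, hA'⟩, ht⟩ := h.action.2.1 _ _ hqt
  obtain ⟨rfl, rfl⟩ := IsPair.inj hM.out hq hq'
  obtain ⟨s', A, rfl, rfl⟩ := h.exists_of_rel hA
  refine ⟨s', ⟨f, hf⟩, ⟨t, ht⟩, rfl, rfl, rfl, ?_⟩
  rw [h.idx_iff.1 hA]
  exact ((SmallCat.cod_iff (f := ⟨f, hf⟩)).1 hA').symm

omit h in
theorem act_iff_mem {s t : Elt F₀} {f : Elt C.C₁} :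
    Act e s.1 f.1 t.1 ↔ M.Mem (code ((s, f), t)) e := by
  change (∃ q, M.IsPair q s.1 f.1 ∧ M.Rel _ q t.1) ↔ _
  simp only [isPair_elt, exists_eq_left]
  exact rel_elts_iff (a := (s, f)) (b := t)

theorem exists_act : ∃ c : Elt F₀ × Elt C.C₁ → Elt F₀, IFun M c ∧
    (∀ s f, h.idxFun s ≠ C.codFun f → c (s, f) = s) ∧
    ∀ s f t, Act e s.1 f.1 t.1 ↔ h.idxFun s = C.codFun f ∧ c (s, f) = t := by
  -- The default value is the element s itself, which is the convention of `ISheaf.act_of_ne`.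
  obtain ⟨c, hc, hc', hc''⟩ := exists_ifun_of_partial (α := Elt F₀ × Elt C.C₁) (β := Elt F₀)
    (Q := fun p t => M.Mem (code (p, t)) e) (D := fun p => h.idxFun p.1 = C.codFun p.2)
    (d := fun p => p.1) (ifun_mem e) (by fun_prop) (by fun_prop) (by
      rintro ⟨s, f⟩ hsf
      have hsf : h.idxFun s = C.codFun f := hsf
      obtain ⟨t, ht, ht'⟩ := h.action.2.2 (code (s, f))
        ⟨s.1, f.1, _, isPair_code s f, s.2, f.2, h.idx_self s, hsf ▸ SmallCat.cod_self f⟩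
      obtain ⟨t, rfl⟩ : ∃ t' : Elt F₀, t'.1 = t := ⟨⟨t, (h.action.2.1 _ _ ht).2⟩, rfl⟩
      refine ⟨t, (rel_elts_iff (a := (s, f)) (b := t)).1 ht, ?_⟩
      exact fun k hk => Subtype.ext (ht' _ ((rel_elts_iff (a := (s, f)) (b := k)).2 hk)))
  refine ⟨c, hc, fun s f H => hc'' (s, f) H, fun s f t => ?_⟩
  constructor
  · intro H
    obtain ⟨s', f', t', e1, e2, -, H'⟩ := h.exists_of_act H
    obtain rfl := Subtype.ext e1
    obtain rfl := Subtype.ext e2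
    exact ⟨H', (hc' (s', f') H' t).1 (act_iff_mem.1 H)⟩
  · rintro ⟨H, rfl⟩
    exact act_iff_mem.2 ((hc' (s, f) H _).2 rfl)

/-- The action of a presheaf. -/
noncomputable def actFun (s : Elt F₀) (f : Elt C.C₁) : Elt F₀ := h.exists_act.choose (s, f)

@[fun_prop]
theorem ifun_actFun_comp {α : Type*} [Coded M α] {f : α → Elt F₀} {g : α → Elt C.C₁}
    (hf : IFun M f) (hg : IFun M g) : IFun M fun a => h.actFun (f a) (g a) :=
  h.exists_act.choose_spec.1.comp (hf.prodMk hg)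

theorem act_iff {s t : Elt F₀} {f : Elt C.C₁} :
    Act e s.1 f.1 t.1 ↔ h.idxFun s = C.codFun f ∧ h.actFun s f = t :=
  h.exists_act.choose_spec.2.2 s f t

theorem act_self {s : Elt F₀} {f : Elt C.C₁} (H : h.idxFun s = C.codFun f) :
    Act e s.1 f.1 (h.actFun s f).1 := h.act_iff.2 ⟨H, rfl⟩

variable (hJ : IsTopology C J)

/-- The internal sheaf given by a sheaf of the model. -/
@[reducible]
noncomputable def sheaf (hs : SheafCondition C J F₀ γ e) : ISheaf (C.site hJ) where
  El := Elt F₀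
  idx := h.idxFun
  act := h.actFun
  ifun_idx := h.ifun_idxFun
  ifun_act := by fun_prop
  act_of_ne s f H := h.exists_act.choose_spec.2.1 s f H
  idx_act s f H := h.idx_iff.1 (h.restrict _ _ _ _ (h.act_self H) (SmallCat.dom_self f))
  act_id s := (h.act_iff.1 (h.id _ _ _ (h.idx_self s) (SmallCat.isId_self _))).2
  act_act s f g H H' := (h.act_iff.1 (h.comp _ _ _ _ _ _ (SmallCat.comp_self H') (h.act_self H)
    (h.act_self ((h.idx_iff.1 (h.restrict _ _ _ _ (h.act_self H)
      (SmallCat.dom_self f))).trans H'.symm)))).2.symm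
  glue A S R hS h1 h2 h3 := by
    have hR : ∀ f s, M.Rel (M.elts (code R)) f s ↔
        ∃ (f' : Elt C.C₁) (s' : Elt F₀), f'.1 = f ∧ s'.1 = s ∧ R.Mem (f', s') := by
      intro f s
      constructor
      · rintro ⟨p, hp, hpR⟩
        obtain ⟨⟨f', s'⟩, hq, rfl⟩ := mem_code_pow.1 hpR
        obtain ⟨rfl, rfl⟩ := IsPair.inj hM.out hp (isPair_code f' s')
        exact ⟨f', s', rfl, rfl, hq⟩
      · rintro ⟨f, s, rfl, rfl, H⟩
        exact ⟨_, isPair_code f s, code_mem_code_pow.2 H⟩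
    -- Matching makes R single-valued, so its code is a function in the model and the model's sheaf
    -- condition applies to it.
    have hu : ∀ f s s', R.Mem (f, s) → R.Mem (f, s') → s = s' := by
      intro f s s' H H'
      refine ISheaf.matching_unique ?_ h1 h3 H H'
      exact fun s => (h.act_iff.1 (h.id _ _ _ (h.idx_self s) (SmallCat.isId_self _))).2
    obtain ⟨s, ⟨hs1, hs2⟩, hs3⟩ := hs A.1 (code S) (code R) hS
      ⟨fun p hp => by
        obtain ⟨⟨f', s'⟩, hq, rfl⟩ := mem_code_pow.1 hp
        exact ⟨_, _, isPair_code f' s'⟩,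
      fun f s H => by
        obtain ⟨f, s, rfl, rfl, K⟩ := (hR f s).1 H
        exact ⟨code_mem_code_pow.2 (h1 _ _ K).1, s.2⟩,
      fun f hf => by
        obtain ⟨f, hf', rfl⟩ := mem_code_pow.1 hf
        obtain ⟨s, hs⟩ := h2 f hf'
        refine ⟨s.1, (hR _ _).2 ⟨f, s, rfl, rfl, hs⟩, fun t ht => ?_⟩
        obtain ⟨f', t, e, rfl, ht'⟩ := (hR _ _).1 ht
        obtain rfl : f' = f := Subtype.ext e
        exact congrArg Subtype.val (hu _ _ _ ht' hs)⟩
      (by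
        intro f s B H hB
        obtain ⟨f, s, rfl, rfl, K⟩ := (hR f s).1 H
        obtain ⟨f', e, rfl⟩ := SmallCat.exists_of_dom hB
        obtain rfl : f' = f := Subtype.ext e
        exact h.idx_iff.2 (h1 _ _ K).2)
      (by
        intro f f' g g' k s s' t t' hk hk' H H' ht ht'
        obtain ⟨f, s, rfl, rfl, K⟩ := (hR f s).1 H
        obtain ⟨f', s', rfl, rfl, K'⟩ := (hR f' s').1 H'
        obtain ⟨-, g, k, -, rfl, rfl, -⟩ := SmallCat.exists_of_comp hk
        obtain ⟨-, g', -, -, rfl, -, -⟩ := SmallCat.exists_of_comp hk'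
        obtain ⟨-, -, t, -, -, rfl, -⟩ := h.exists_of_act ht
        obtain ⟨-, -, t', -, -, rfl, -⟩ := h.exists_of_act ht'
        obtain ⟨e1, e2⟩ := SmallCat.comp_iff.1 hk
        obtain ⟨e3, e4⟩ := SmallCat.comp_iff.1 hk'
        rw [← (h.act_iff.1 ht).2, ← (h.act_iff.1 ht').2]
        exact congrArg Subtype.val (h3 _ _ _ _ _ _ K K' e1 e3 (e2.trans e4.symm)))
    obtain ⟨s, -, rfl, -⟩ := h.exists_of_rel hs1
    refine ⟨s, ⟨h.idx_iff.1 hs1, fun f x H => ?_⟩, fun t ht => Subtype.ext (hs3 _ ⟨?_, ?_⟩)⟩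
    · exact (h.act_iff.1 (hs2 f.1 x.1 ((hR _ _).2 ⟨f, x, rfl, rfl, H⟩))).2
    · exact h.idx_iff.2 ht.1
    · intro f x H
      obtain ⟨f, x, rfl, rfl, K⟩ := (hR f x).1 H
      refine h.act_iff.2 ⟨?_, ht.2 f x K⟩
      exact ht.1.trans ((C.site hJ).cov_cod A S f hS (h1 _ _ K).1).symm

end Struc.IsPresheafTriple

end MTT

namespace MTT

open CategoryTheory Struc Coded

/-! ### The category of sheaves of the model is equivalent to the category of internal sheaves -/

variable {M : Struc.{u}} [hM : Fact M.IsModel]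

/-- The set of elements, the indexing and the action of a sheaf. -/
structure Presentation (C : M.SmallCat) (J P : M.V) where
  F₀ : M.V
  γ : M.V
  e : M.V
  isTriple : M.IsTriple P F₀ γ e
  isPresheaf : IsPresheafTriple C F₀ γ e
  sheafCondition : SheafCondition C J F₀ γ e

variable {C : M.SmallCat} {J : M.V}

omit hM in
theorem nonempty_presentation_iff {P : M.V} : Nonempty (Presentation C J P) ↔ IsSheaf C J P :=
  ⟨fun ⟨p⟩ => ⟨_, _, _, p.isTriple, p.isPresheaf, p.sheafCondition⟩,
    fun ⟨_, _, _, h1, h2, h3⟩ => ⟨⟨_, _, _, h1, h2, h3⟩⟩⟩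

/-- The presentation of a sheaf. -/
noncomputable def presentation {P : M.V} (h : IsSheaf C J P) : Presentation C J P :=
  (nonempty_presentation_iff.2 h).some

namespace Presentation

variable (hJ : IsTopology C J)

/-- The internal sheaf given by a presentation. -/
@[reducible]
noncomputable def toSheaf {P : M.V} (p : Presentation C J P) : ISheaf (C.site hJ) :=
  p.isPresheaf.sheaf hJ p.sheafCondition

variable {P Q : M.V} (p : Presentation C J P) (q : Presentation C J Q)

/-- The set `η` is the graph of the map `φ`. -/
structure IsGraph (η : M.V) (φ : p.toSheaf hJ ⟶ q.toSheaf hJ) : Prop where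
  isFun : M.IsFun (M.elts η) (M.elts p.F₀) (M.elts q.F₀)
  rel_iff : ∀ (s : Elt p.F₀) (t : Elt q.F₀), M.Rel (M.elts η) s.1 t.1 ↔ φ.toFun s = t

variable {p q hJ} in
theorem IsGraph.isTransform {η : M.V} {φ : p.toSheaf hJ ⟶ q.toSheaf hJ}
    (h : p.IsGraph hJ q η φ) : IsTransform (M := M) P Q η := by
  refine ⟨_, _, _, _, _, _, p.isTriple, q.isTriple, h.isFun, fun s t A hst hA => ?_,
    fun s t f s' t' hst hs ht => ?_⟩
  · obtain ⟨s, A, rfl, rfl⟩ := p.isPresheaf.exists_of_rel hA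
    obtain ⟨t, rfl⟩ : ∃ t' : Elt q.F₀, t'.1 = t := ⟨⟨t, (h.isFun.2.1 _ _ hst).2⟩, rfl⟩
    refine q.isPresheaf.idx_iff.2 ?_
    rw [← p.isPresheaf.idx_iff.1 hA, ← (h.rel_iff s t).1 hst]
    exact φ.idx_map s
  · obtain ⟨s, f, s', rfl, rfl, rfl, -⟩ := p.isPresheaf.exists_of_act hs
    obtain ⟨t, f', t', rfl, e, rfl, -⟩ := q.isPresheaf.exists_of_act ht
    obtain rfl := Subtype.ext e
    refine (h.rel_iff _ _).2 ?_
    rw [← (p.isPresheaf.act_iff.1 hs).2, ← (q.isPresheaf.act_iff.1 ht).2, ← (h.rel_iff s t).1 hst]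
    exact φ.map_act s f'

theorem exists_isGraph {η : M.V} (h : IsTransform (M := M) P Q η) : ∃ φ, p.IsGraph hJ q η φ := by
  obtain ⟨F₀, γ, e, G₀, γ', e', hP, hQ, h1, h2, h3⟩ := h
  obtain ⟨rfl, rfl, rfl⟩ := hP.inj p.isTriple
  obtain ⟨rfl, rfl, rfl⟩ := hQ.inj q.isTriple
  obtain ⟨g, hg, hg'⟩ := exists_ifun_of_isFun h1
  exact ⟨⟨g, hg, fun s => q.isPresheaf.idx_iff.1
      (h2 _ _ _ ((hg' s _).2 rfl) (p.isPresheaf.idx_self s)),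
    fun s f hs => (hg' _ _).1 (h3 _ _ _ _ _ ((hg' s _).2 rfl) (p.isPresheaf.act_self hs)
      (q.isPresheaf.act_self ((q.isPresheaf.idx_iff.1
        (h2 _ _ _ ((hg' s _).2 rfl) (p.isPresheaf.idx_self s))).trans hs)))⟩, h1, hg'⟩

theorem exists_isTransform (φ : p.toSheaf hJ ⟶ q.toSheaf hJ) : ∃ η, p.IsGraph hJ q η φ := by
  obtain ⟨η, h1, h2⟩ := exists_isFun_of_ifun φ.ifun
  exact ⟨η, h1, h2⟩

variable {p q hJ}

theorem IsGraph.unique {η η' : M.V} {φ : p.toSheaf hJ ⟶ q.toSheaf hJ} (h : p.IsGraph hJ q η φ)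
    (h' : p.IsGraph hJ q η' φ) : η = η' :=
  isFun_ext h.isFun h'.isFun fun a b => (h.rel_iff a b).trans (h'.rel_iff a b).symm

theorem IsGraph.map_unique {η : M.V} {φ φ' : p.toSheaf hJ ⟶ q.toSheaf hJ}
    (h : p.IsGraph hJ q η φ) (h' : p.IsGraph hJ q η φ') : φ = φ' :=
  ISheaf.hom_ext fun s => (h.rel_iff s _).1 ((h'.rel_iff s _).2 rfl)

end Presentation

/-- The set `a` is the map `η : P → Q` of sheaves. -/
structure IsSheafArrow (C : M.SmallCat) (J a P Q η : M.V) : Prop where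
  isTriple : M.IsTriple a P Q η
  dom : IsSheaf C J P
  cod : IsSheaf C J Q
  isTransform : IsTransform (M := M) P Q η

omit hM in
theorem isPresheaf_of_isSheaf {P : M.V} (h : IsSheaf C J P) : IsPresheaf C P := by
  obtain ⟨F₀, γ, e, h1, h2, -⟩ := h
  exact ⟨F₀, γ, e, h1, h2⟩

omit hM in
theorem sheafCat_ob {P : M.V} : (sheafCat C J).Ob P ↔ IsSheaf C J P :=
  ⟨fun h => h.2, fun h => ⟨isPresheaf_of_isSheaf h, h⟩⟩

/-- The triple determines its ends, so the clauses defining the full subcategory amount to both ends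
being sheaves. -/
theorem sheafCat_ar {a : M.V} :
    (sheafCat C J).Ar a ↔ ∃ P Q η, IsSheafArrow C J a P Q η := by
  constructor
  · rintro ⟨⟨P, Q, η, h⟩, h'⟩
    exact ⟨P, Q, η, h.1, h' P (.inl ⟨Q, η, h⟩), h' Q (.inr ⟨P, η, h⟩), h.2.2.2⟩
  · rintro ⟨P, Q, η, h⟩
    refine ⟨⟨P, Q, η, h.1, isPresheaf_of_isSheaf h.2, isPresheaf_of_isSheaf h.3, h.4⟩, ?_⟩
    rintro A (⟨Q', η', h'⟩ | ⟨P', η', h'⟩)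
    · obtain ⟨rfl, -⟩ := h.1.inj h'.1
      exact h.2
    · obtain ⟨-, rfl, -⟩ := h.1.inj h'.1
      exact h.3

theorem sheafCat_dom {a P : M.V} :
    (sheafCat C J).Dom a P ↔ ∃ Q η, IsSheafArrow C J a P Q η := by
  constructor
  · rintro ⟨⟨Q, η, h⟩, h'⟩
    obtain ⟨P', Q', η', H⟩ := sheafCat_ar.1 h'
    obtain ⟨rfl, -⟩ := h.1.inj H.1
    exact ⟨_, _, H⟩
  · rintro ⟨Q, η, h⟩
    exact ⟨⟨Q, η, h.1, isPresheaf_of_isSheaf h.2, isPresheaf_of_isSheaf h.3, h.4⟩,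
      sheafCat_ar.2 ⟨_, _, _, h⟩⟩

theorem sheafCat_cod {a Q : M.V} :
    (sheafCat C J).Cod a Q ↔ ∃ P η, IsSheafArrow C J a P Q η := by
  constructor
  · rintro ⟨⟨P, η, h⟩, h'⟩
    obtain ⟨P', Q', η', H⟩ := sheafCat_ar.1 h'
    obtain ⟨-, rfl, -⟩ := h.1.inj H.1
    exact ⟨_, _, H⟩
  · rintro ⟨P, η, h⟩
    exact ⟨⟨P, η, h.1, isPresheaf_of_isSheaf h.2, isPresheaf_of_isSheaf h.3, h.4⟩,
      sheafCat_ar.2 ⟨_, _, _, h⟩⟩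

theorem sheafCat_hom {a P Q : M.V} :
    (sheafCat C J).Hom a P Q ↔ ∃ η, IsSheafArrow C J a P Q η := by
  rw [CatData.Hom, sheafCat_dom, sheafCat_cod]
  constructor
  · rintro ⟨⟨Q', η, h⟩, ⟨P', η', h'⟩⟩
    obtain ⟨-, rfl, -⟩ := h.1.inj h'.1
    exact ⟨_, h⟩
  · rintro ⟨η, h⟩
    exact ⟨⟨_, _, h⟩, ⟨_, _, h⟩⟩

theorem sheafCat_comp {b a c : M.V} : (sheafCat C J).Comp b a c ↔ ∃ P Q R η θ ζ,
    IsSheafArrow C J a P Q η ∧ IsSheafArrow C J b Q R θ ∧ IsSheafArrow C J c P R ζ ∧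
      ∀ s t, M.Rel (M.elts ζ) s t ↔ ∃ r, M.Rel (M.elts η) s r ∧ M.Rel (M.elts θ) r t := by
  have aux : ∀ {a P Q η}, (sheafCat C J).Ar a → M.IsTriple a P Q η → IsSheafArrow C J a P Q η := by
    intro a P Q η h h'
    obtain ⟨P', Q', η', H⟩ := sheafCat_ar.1 h
    obtain ⟨rfl, rfl, rfl⟩ := h'.inj H.1
    exact H
  have aux' : ∀ {a P Q η}, IsSheafArrow C J a P Q η → M.IsTriple a P Q η ∧ IsPresheaf C P ∧
      IsPresheaf C Q ∧ IsTransform P Q η := fun h =>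
    ⟨h.1, isPresheaf_of_isSheaf h.2, isPresheaf_of_isSheaf h.3, h.4⟩
  constructor
  · rintro ⟨⟨P, Q, R, η, θ, ζ, h1, h2, h3, h⟩, hb, ha, hc⟩
    exact ⟨P, Q, R, η, θ, ζ, aux ha h1.1, aux hb h2.1, aux hc h3.1, h⟩
  · rintro ⟨P, Q, R, η, θ, ζ, h1, h2, h3, h⟩
    exact ⟨⟨P, Q, R, η, θ, ζ, aux' h1, aux' h2, aux' h3, h⟩, sheafCat_ar.2 ⟨_, _, _, h2⟩,
      sheafCat_ar.2 ⟨_, _, _, h1⟩, sheafCat_ar.2 ⟨_, _, _, h3⟩⟩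

/-- The internal sheaf given by an object of the category of sheaves. -/
@[reducible]
noncomputable def sheafCatObj (hJ : IsTopology C J) (P : (sheafCat C J).Obj) :
    ISheaf (C.site hJ) :=
  (presentation P.2.2).toSheaf hJ

theorem exists_map_of_arrow (hJ : IsTopology C J) (P Q : (sheafCat C J).Obj)
    (a : {a // (sheafCat C J).Hom a P.1 Q.1}) : ∃ φ : sheafCatObj hJ P ⟶ sheafCatObj hJ Q,
      ∃ η, IsSheafArrow C J a.1 P.1 Q.1 η ∧
        (presentation P.2.2).IsGraph hJ (presentation Q.2.2) η φ := by
  obtain ⟨η, h⟩ := sheafCat_hom.1 a.2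
  obtain ⟨φ, hφ⟩ := Presentation.exists_isGraph hJ (presentation P.2.2) (presentation Q.2.2) h.4
  exact ⟨φ, η, h, hφ⟩

/-- The map of internal sheaves given by an arrow of the category of sheaves. -/
noncomputable def sheafCatMap (hJ : IsTopology C J) (P Q : (sheafCat C J).Obj) :
    {a // (sheafCat C J).Hom a P.1 Q.1} ≃ (sheafCatObj hJ P ⟶ sheafCatObj hJ Q) :=
  Equiv.ofBijective (fun a => (exists_map_of_arrow hJ P Q a).choose) (by
    constructor
    · intro a b hab
      obtain ⟨η, h, h'⟩ := (exists_map_of_arrow hJ P Q a).choose_spec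
      obtain ⟨θ, k, k'⟩ := (exists_map_of_arrow hJ P Q b).choose_spec
      change (exists_map_of_arrow hJ P Q a).choose = (exists_map_of_arrow hJ P Q b).choose at hab
      rw [hab] at h'
      obtain rfl := h'.unique k'
      exact Subtype.ext (h.1.unique k.1)
    · intro φ
      obtain ⟨η, hη⟩ := Presentation.exists_isTransform hJ _ _ φ
      obtain ⟨a, ha⟩ := exists_isTriple (M := M) P.1 Q.1 η
      have ha' : IsSheafArrow C J a P.1 Q.1 η := ⟨ha, P.2.2, Q.2.2, hη.isTransform⟩
      refine ⟨⟨a, sheafCat_hom.2 ⟨η, ha'⟩⟩, ?_⟩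
      obtain ⟨θ, k, k'⟩ := (exists_map_of_arrow hJ P Q ⟨a, sheafCat_hom.2 ⟨η, ha'⟩⟩).choose_spec
      obtain ⟨-, -, rfl⟩ := ha.inj k.1
      exact k'.map_unique hη)

theorem sheafCatMap_isGraph (hJ : IsTopology C J) {P Q : (sheafCat C J).Obj}
    (a : {a // (sheafCat C J).Hom a P.1 Q.1}) {η : M.V} (h : IsSheafArrow C J a.1 P.1 Q.1 η) :
    (presentation P.2.2).IsGraph hJ (presentation Q.2.2) η (sheafCatMap hJ P Q a) := by
  obtain ⟨θ, k, k'⟩ := (exists_map_of_arrow hJ P Q a).choose_spec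
  obtain ⟨-, -, rfl⟩ := h.1.inj k.1
  exact k'

/-- Composition in the model is relational composition of the graphs, and graphs of internal maps
compose in the same way. -/
theorem sheafCatMap_comp (hJ : IsTopology C J) (P Q R : (sheafCat C J).Obj)
    (f : {a // (sheafCat C J).Hom a P.1 Q.1}) (g : {a // (sheafCat C J).Hom a Q.1 R.1})
    (h : {a // (sheafCat C J).Hom a P.1 R.1}) : (sheafCat C J).Comp g.1 f.1 h.1 ↔
      sheafCatMap hJ _ _ f ≫ sheafCatMap hJ _ _ g = sheafCatMap hJ _ _ h := by
  obtain ⟨η, hη⟩ := sheafCat_hom.1 f.2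
  obtain ⟨θ, hθ⟩ := sheafCat_hom.1 g.2
  obtain ⟨ζ, hζ⟩ := sheafCat_hom.1 h.2
  have k1 := sheafCatMap_isGraph hJ f hη
  have k2 := sheafCatMap_isGraph hJ g hθ
  have k3 := sheafCatMap_isGraph hJ h hζ
  have key : (sheafCat C J).Comp g.1 f.1 h.1 ↔
      ∀ s t, M.Rel (M.elts ζ) s t ↔ ∃ r, M.Rel (M.elts η) s r ∧ M.Rel (M.elts θ) r t := by
    rw [sheafCat_comp]
    constructor
    · rintro ⟨P', Q', R', η', θ', ζ', h1, h2, h3, H⟩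
      obtain ⟨-, -, rfl⟩ := h1.1.inj hη.1
      obtain ⟨-, -, rfl⟩ := h2.1.inj hθ.1
      obtain ⟨-, -, rfl⟩ := h3.1.inj hζ.1
      exact H
    · intro H
      exact ⟨_, _, _, _, _, _, hη, hθ, hζ, H⟩
  rw [key]
  constructor
  · intro H
    exact ISheaf.hom_ext fun s => ((k3.rel_iff s _).1 ((H _ _).2
      ⟨_, (k1.rel_iff s _).2 rfl, (k2.rel_iff _ _).2 rfl⟩)).symm
  · intro H s t
    constructor
    · intro hst
      obtain ⟨hs, ht⟩ := k3.isFun.2.1 _ _ hst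
      have := (k3.rel_iff ⟨s, hs⟩ ⟨t, ht⟩).1 hst
      rw [← H] at this
      exact ⟨_, (k1.rel_iff ⟨s, hs⟩ _).2 rfl, (k2.rel_iff _ ⟨t, ht⟩).2 this⟩
    · rintro ⟨r, hr, hr'⟩
      obtain ⟨hs, h1⟩ := k1.isFun.2.1 _ _ hr
      obtain ⟨-, ht⟩ := k2.isFun.2.1 _ _ hr'
      have e1 := (k1.rel_iff ⟨s, hs⟩ ⟨r, h1⟩).1 hr
      have e2 := (k2.rel_iff ⟨r, h1⟩ ⟨t, ht⟩).1 hr'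
      refine (k3.rel_iff ⟨s, hs⟩ ⟨t, ht⟩).2 ?_
      rw [← H, ← e2, ← e1]
      rfl

theorem exists_functor_sheafCat (hJ : IsTopology C J) : ∃ hY : (sheafCat C J).IsCategory,
    letI := hY.category
    ∃ F : (sheafCat C J).Obj ⥤ ISheaf (C.site hJ),
      (∀ P, F.obj P = sheafCatObj hJ P) ∧ F.Full ∧ F.Faithful := by
  refine CatData.exists_functor_of_representation _ (sheafCatObj hJ) (sheafCatMap hJ) ?_ ?_ ?_
    (sheafCatMap_comp hJ)
  · refine ⟨fun a P h => ?_, fun a h => ?_⟩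
    · obtain ⟨Q, η, h⟩ := sheafCat_dom.1 h
      exact ⟨sheafCat_ar.2 ⟨_, _, _, h⟩, sheafCat_ob.2 h.2⟩
    · obtain ⟨P, Q, η, h⟩ := sheafCat_ar.1 h
      refine ⟨P, sheafCat_dom.2 ⟨_, _, h⟩, fun P' h' => ?_⟩
      obtain ⟨Q', η', h'⟩ := sheafCat_dom.1 h'
      exact (h'.1.inj h.1).1
  · refine ⟨fun a Q h => ?_, fun a h => ?_⟩
    · obtain ⟨P, η, h⟩ := sheafCat_cod.1 h
      exact ⟨sheafCat_ar.2 ⟨_, _, _, h⟩, sheafCat_ob.2 h.3⟩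
    · obtain ⟨P, Q, η, h⟩ := sheafCat_ar.1 h
      refine ⟨Q, sheafCat_cod.2 ⟨_, _, h⟩, fun Q' h' => ?_⟩
      obtain ⟨P', η', h'⟩ := sheafCat_cod.1 h'
      exact (h'.1.inj h.1).2.1
  · intro g f h H
    obtain ⟨P, Q, R, η, θ, ζ, h1, h2, h3, -⟩ := sheafCat_comp.1 H
    exact ⟨P, Q, R, sheafCat_hom.2 ⟨_, h1⟩, sheafCat_hom.2 ⟨_, h2⟩, sheafCat_hom.2 ⟨_, h3⟩⟩

end MTT

/-! ### Essential surjectivity and transfer of the topos structure -/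

namespace MTT

open CategoryTheory Struc Coded

variable {M : Struc.{u}} [hM : Fact M.IsModel]

/-- The graph of the inverse is the converse of the graph of φ, hence internal. -/
theorem ISheaf.isIso_of_bijective {X : ISite M} {F G : ISheaf X} (φ : F ⟶ G)
    (h : Function.Bijective φ.toFun) : IsIso φ := by
  let i := Equiv.ofBijective _ h
  have hi : ∀ b, φ.toFun (i.symm b) = b := i.apply_symm_apply
  let ψ : G ⟶ F :=
    { toFun := i.symm
      ifun := by
        refine .of_graph ?_
        have : ∀ p : G.El × F.El, (i.symm p.1 = p.2) = (p.1 = φ.toFun p.2) := fun p =>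
          propext i.symm_apply_eq
        simp only [this]
        fun_prop
      idx_map b := by rw [← φ.idx_map, hi]
      map_act' b f _ := h.1 (by rw [φ.map_act, hi, hi]) }
  exact ⟨ψ, ISheaf.hom_ext fun x => i.symm_apply_apply x, ISheaf.hom_ext hi⟩

variable {C : M.SmallCat} {J : M.V} {hJ : IsTopology C J}

namespace ISheaf

/-- The sets `γ` and `e` are the graphs of the indexing and the action of an internal sheaf. -/
structure IsPresentedBy (F : ISheaf (C.site hJ)) (γ e : M.V) : Prop where
  mem_idx : ∀ z, M.Mem z γ ↔ ∃ p : F.El × Elt C.C₀, F.idx p.1 = p.2 ∧ code p = z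
  mem_act : ∀ z, M.Mem z e ↔ ∃ p : (F.El × Elt C.C₁) × F.El,
    (F.idx p.1.1 = C.codFun p.1.2 ∧ F.act p.1.1 p.1.2 = p.2) ∧ code p = z

theorem exists_isPresentedBy (F : ISheaf (C.site hJ)) : ∃ γ e, F.IsPresentedBy γ e := by
  obtain ⟨γ, hγ⟩ := IPred.exists_set (M := M) (α := F.El × Elt C.C₀)
    (P := fun p => F.idx p.1 = p.2) (IFun.ipred (by fun_prop))
  obtain ⟨e, he⟩ := IPred.exists_set (M := M) (α := (F.El × Elt C.C₁) × F.El)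
    (P := fun p => F.idx p.1.1 = C.codFun p.1.2 ∧ F.act p.1.1 p.1.2 = p.2)
    (IFun.ipred (by fun_prop))
  exact ⟨γ, e, fun z => by rw [hγ], fun z => by rw [he]⟩

namespace IsPresentedBy

variable {F : ISheaf (C.site hJ)} {γ e : M.V} (h : F.IsPresentedBy γ e)

include h

theorem idx_iff {s : F.El} {A : Elt C.C₀} : M.Rel (M.elts γ) (code s) A.1 ↔ F.idx s = A := by
  refine (rel_elts_iff (a := s) (b := A)).trans ?_
  rw [h.mem_idx]
  simp [code_eq_code]

theorem exists_of_rel {s A : M.V} (H : M.Rel (M.elts γ) s A) :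
    ∃ (s' : F.El) (A' : Elt C.C₀), code s' = s ∧ A'.1 = A := by
  obtain ⟨p, hp, hpγ⟩ := H
  obtain ⟨q, -, rfl⟩ := (h.mem_idx _).1 hpγ
  obtain ⟨rfl, rfl⟩ := IsPair.inj hM.out hp (isPair_code q.1 q.2)
  exact ⟨_, _, rfl, rfl⟩

theorem act_iff {s t : F.El} {f : Elt C.C₁} :
    Act e (code s) f.1 (code t) ↔ F.idx s = C.codFun f ∧ F.act s f = t := by
  have : Act e (code s) f.1 (code t) ↔ M.Rel (M.elts e) (code (s, f)) (code t) := by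
    change (∃ q, M.IsPair q (code s) (code f) ∧ _) ↔ _
    simp only [isPair_iff, exists_eq_left]
  rw [this, rel_elts_iff, h.mem_act]
  simp [code_eq_code]

theorem exists_of_act {s f t : M.V} (H : Act e s f t) : ∃ (s' : F.El) (f' : Elt C.C₁)
    (t' : F.El), code s' = s ∧ f'.1 = f ∧ code t' = t := by
  obtain ⟨q, hq, p, hp, hpe⟩ := H
  obtain ⟨r, -, rfl⟩ := (h.mem_act _).1 hpe
  obtain ⟨rfl, rfl⟩ := IsPair.inj hM.out hp (isPair_code r.1 r.2)
  obtain ⟨rfl, rfl⟩ := IsPair.inj hM.out hq (isPair_code r.1.1 r.1.2)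
  exact ⟨_, _, _, rfl, rfl, rfl⟩

theorem isPresheafTriple : IsPresheafTriple C (range F.El) γ e where
  index := by
    refine ⟨fun p hp => ?_, fun s A H => ?_, fun s hs => ?_⟩
    · obtain ⟨q, -, rfl⟩ := (h.mem_idx p).1 hp
      exact ⟨_, _, isPair_code q.1 q.2⟩
    · obtain ⟨s, A, rfl, rfl⟩ := h.exists_of_rel H
      exact ⟨code_mem_range s, A.2⟩
    · obtain ⟨s, rfl⟩ := (mem_range _).1 hs
      refine ⟨(F.idx s).1, h.idx_iff.2 rfl, fun A hA => ?_⟩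
      obtain ⟨-, A, -, rfl⟩ := h.exists_of_rel hA
      exact congrArg Subtype.val (h.idx_iff.1 hA).symm
  action := by
    refine ⟨fun p hp => ?_, fun q t H => ?_, ?_⟩
    · obtain ⟨q, -, rfl⟩ := (h.mem_act p).1 hp
      exact ⟨_, _, isPair_code q.1 q.2⟩
    · obtain ⟨p, hp, hpe⟩ := H
      obtain ⟨r, hr, rfl⟩ := (h.mem_act _).1 hpe
      obtain ⟨rfl, rfl⟩ := IsPair.inj hM.out hp (isPair_code r.1 r.2)
      exact ⟨⟨code r.1.1, r.1.2.1, (F.idx r.1.1).1, isPair_code r.1.1 r.1.2, code_mem_range _,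
        r.1.2.2, h.idx_iff.2 rfl, SmallCat.cod_iff.2 hr.1.symm⟩, code_mem_range _⟩
    · rintro q ⟨s, f, A, hq, hs, hf, hA, hA'⟩
      obtain ⟨s, A, rfl, rfl⟩ := h.exists_of_rel hA
      obtain ⟨f, rfl⟩ : ∃ f' : Elt C.C₁, f'.1 = f := ⟨⟨f, hf⟩, rfl⟩
      have hsf : F.idx s = C.codFun f := (h.idx_iff.1 hA).trans (SmallCat.cod_iff.1 hA').symm
      have act' : ∀ t, Act e (code s) f.1 t ↔ M.Rel (M.elts e) q t := fun t =>
        ⟨fun ⟨q', hq', ht⟩ => by rwa [hq.unique hM.out hq'], fun ht => ⟨q, hq, ht⟩⟩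
      refine ⟨code (F.act s f), (act' _).1 (h.act_iff.2 ⟨hsf, rfl⟩), fun t ht => ?_⟩
      obtain ⟨-, -, t, -, -, rfl⟩ := h.exists_of_act ((act' _).2 ht)
      rw [(h.act_iff.1 ((act' _).2 ht)).2]
  restrict s g t B H hB := by
    obtain ⟨s, g, t, rfl, rfl, rfl⟩ := h.exists_of_act H
    obtain ⟨g', e1, rfl⟩ := SmallCat.exists_of_dom hB
    obtain rfl := Subtype.ext e1
    obtain ⟨h1, rfl⟩ := h.act_iff.1 H
    exact h.idx_iff.2 (F.idx_act _ _ h1)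
  comp s g k l t r hc hg hk := by
    obtain ⟨s, g, t, rfl, rfl, rfl⟩ := h.exists_of_act hg
    obtain ⟨-, k, r, -, rfl, rfl⟩ := h.exists_of_act hk
    obtain ⟨-, -, l, -, -, rfl, -⟩ := SmallCat.exists_of_comp hc
    obtain ⟨h1, rfl⟩ := h.act_iff.1 hg
    obtain ⟨h2, rfl⟩ := h.act_iff.1 hk
    obtain ⟨h3, rfl⟩ := SmallCat.comp_iff.1 hc
    exact h.act_iff.2 ⟨h1.trans (SmallCat.hom_comp h3).2.symm, (F.act_act _ _ _ h1 h3).symm⟩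
  id s A i hA hi := by
    obtain ⟨s, A, rfl, rfl⟩ := h.exists_of_rel hA
    obtain ⟨i, rfl, -⟩ := SmallCat.exists_of_dom hi.1.1
    obtain rfl := SmallCat.isId_iff.1 hi
    obtain rfl := h.idx_iff.1 hA
    exact h.act_iff.2 ⟨((C.site hJ).cod_id _).symm, F.act_id s⟩

/-- A compatible family x of the model is read as the internal relation of the pairs whose code
belongs to x, and is then glued in F. -/
theorem sheafCondition : SheafCondition C J (range F.El) γ e := by
  intro A S x hS hx hx' hcomp
  obtain ⟨A, S, rfl, rfl⟩ := SmallCat.exists_sieve_of_rel hJ hS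
  let R : IPow M (Elt C.C₁ × F.El) := ⟨fun p => M.Mem (code p) x, ifun_mem x⟩
  have hR : ∀ f s, R.Mem (f, s) ↔ M.Rel (M.elts x) f.1 (code s) := fun f s =>
    (rel_elts_iff (a := f) (b := s)).symm
  have lift : ∀ f s, M.Rel (M.elts x) f s → ∃ (f' : Elt C.C₁) (s' : F.El), S.Mem f' ∧ f'.1 = f ∧
      code s' = s := by
    intro f s H
    obtain ⟨h1, h2⟩ := hx.2.1 _ _ H
    obtain ⟨f, hf, rfl⟩ := mem_code_pow.1 h1
    obtain ⟨s, rfl⟩ := (mem_range _).1 h2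
    exact ⟨f, s, hf, rfl, rfl⟩
  have hidx : ∀ f s, R.Mem (f, s) → S.Mem f ∧ F.idx s = C.domFun f := fun f s H => by
    have H := (hR f s).1 H
    refine ⟨SmallCat.mem_code_elt.1 (hx.2.1 _ _ H).1, ?_⟩
    exact h.idx_iff.1 (hx' _ _ _ H (SmallCat.dom_self f))
  obtain ⟨a, ⟨ha1, ha2⟩, ha3⟩ := F.glue A S R hS hidx
    (fun f hf => by
      obtain ⟨s, hs, -⟩ := hx.2.2 f.1 (SmallCat.mem_code_elt.2 hf)
      obtain ⟨f', s, -, -, rfl⟩ := lift _ _ hs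
      exact ⟨s, (hR _ _).2 hs⟩)
    (fun f f' s s' g g' hs hs' hg hg' hgg' => (code_eq_code (M := M)).1 (hcomp _ _ _ _ _ _ _ _ _
      (SmallCat.comp_iff.2 ⟨hg, rfl⟩) (SmallCat.comp_iff.2 ⟨hg', hgg'.symm⟩)
      ((hR _ _).1 hs) ((hR _ _).1 hs')
      (h.act_iff.2 ⟨(hidx _ _ hs).2.trans hg.symm, rfl⟩)
      (h.act_iff.2 ⟨(hidx _ _ hs').2.trans hg'.symm, rfl⟩)))
  refine ⟨code a, ⟨h.idx_iff.2 ha1, fun f t H => ?_⟩, ?_⟩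
  · obtain ⟨f, t, hf, rfl, rfl⟩ := lift _ _ H
    exact h.act_iff.2 ⟨ha1.trans ((C.site hJ).cov_cod _ _ _ hS hf).symm, ha2 _ _ ((hR _ _).2 H)⟩
  · rintro b ⟨hb1, hb2⟩
    obtain ⟨b, -, rfl, -⟩ := h.exists_of_rel hb1
    rw [ha3 b ⟨h.idx_iff.1 hb1, fun f t H => (h.act_iff.1 (hb2 _ _ ((hR _ _).1 H))).2⟩]

/-- The elements of F and the members of its range are identified by a ↦ code a. The statement is
about an arbitrary presentation because the one attached to a sheaf of the model is only chosen. -/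
theorem nonempty_iso {P : M.V} (p : Presentation C J P) (h1 : p.F₀ = range F.El) (h2 : p.γ = γ)
    (h3 : p.e = e) : Nonempty (p.toSheaf hJ ≅ F) := by
  obtain ⟨F₀, γ, e, t1, t2, t3⟩ := p
  dsimp only at h1 h2 h3
  subst h1 h2 h3
  let φ : F ⟶ (Presentation.mk _ _ _ t1 t2 t3).toSheaf hJ :=
    { toFun x := ⟨code x, code_mem_range x⟩
      ifun := ifun_of_code_eq (M := M) fun _ => rfl
      idx_map x := t2.idx_iff.1 (h.idx_iff.2 rfl)
      map_act' x f hf := ((t2.act_iff (s := ⟨code x, code_mem_range x⟩)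
        (t := ⟨code (F.act x f), code_mem_range _⟩)).1 (h.act_iff.2 ⟨hf, rfl⟩)).2.symm }
  have := isIso_of_bijective φ ⟨fun x y hxy => code_injective (congrArg Subtype.val hxy), fun y => by
    obtain ⟨x, hx⟩ := (mem_range _).1 y.2
    exact ⟨x, Subtype.ext hx⟩⟩
  exact ⟨(asIso φ).symm⟩

end IsPresentedBy

end ISheaf

/-- The range of the element type, with the graphs of the indexing and the action, is a sheaf in the
model isomorphic to F; all three are sets because everything is coded. -/
theorem exists_iso_sheafCatObj (hJ : IsTopology C J) (F : ISheaf (C.site hJ)) :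
    ∃ P : (sheafCat C J).Obj, Nonempty (sheafCatObj hJ P ≅ F) := by
  obtain ⟨γ, e, h⟩ := F.exists_isPresentedBy
  obtain ⟨P, hP⟩ := exists_isTriple (M := M) (range F.El) γ e
  have hP' : IsSheaf C J P := ⟨_, _, _, hP, h.isPresheafTriple, h.sheafCondition⟩
  refine ⟨⟨P, sheafCat_ob.2 hP'⟩, ?_⟩
  obtain ⟨h1, h2, h3⟩ := (presentation hP').isTriple.inj hP
  exact h.nonempty_iso _ h1 h2 h3

theorem Struc.ClassCat.IsGrothendieckTopos.isElementaryTopos {E : M.ClassCat}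
    (hE : E.IsGrothendieckTopos) : IsElementaryTopos E.Obj := by
  obtain ⟨C, J, hJ, h⟩ := hE
  obtain ⟨hY, F, hF, hF1, hF2⟩ := exists_functor_sheafCat hJ
  let := hY.category
  have : F.EssSurj := ⟨fun G => by
    obtain ⟨P, ⟨i⟩⟩ := exists_iso_sheafCatObj hJ G
    exact ⟨P, ⟨eqToIso (hF P) ≪≫ i⟩⟩⟩
  have : F.IsEquivalence := {}
  obtain ⟨i⟩ := h.nonempty_equivalence E.cat.2.2.2 hY
  exact .of_equivalence i (.of_equivalence F.asEquivalence (ISheaf.isElementaryTopos _))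

end MTT

namespace MTT

open CategoryTheory Struc

/-! ### Satisfaction of the formulas of topos theory in a class category -/

namespace Struc.ClassCat

variable {M : Struc.{u}} {E : M.ClassCat}

/-- An object, as an element of the first-order structure. -/
def obj (A : E.Obj) : E.Elt := Sum.inl A

/-- An arrow, as an element of the first-order structure. -/
def arr {A B : E.Obj} (f : A ⟶ B) : E.Elt := Sum.inr ⟨f.1, (E.cat.2.2.2.dom.1 _ _ f.2.1).1⟩

theorem obj_inj {A B : E.Obj} : obj A = obj B ↔ A = B := Sum.inl.inj_iff

theorem obj_ne_arr {A B C : E.Obj} {f : B ⟶ C} : obj A ≠ arr f := Sum.inl_ne_inr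

/-- The underlying set of an arrow determines its domain and codomain. Equality in the dependent sum
lets all three be identified at once. -/
theorem arr_inj {A B A' B' : E.Obj} {f : A ⟶ B} {f' : A' ⟶ B'} (h : arr f = arr f') :
    (⟨A, B, f⟩ : Σ A B : E.Obj, A ⟶ B) = ⟨A', B', f'⟩ := by
  obtain ⟨f, hf⟩ := f
  obtain ⟨f', hf'⟩ := f'
  obtain rfl : f = f' := congrArg Subtype.val (Sum.inr.inj h)
  have hE := E.cat.2.2.2
  obtain rfl : A = A' := Subtype.ext ((hE.dom.2 _ (hE.dom.1 _ _ hf.1).1).unique hf.1 hf'.1)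
  obtain rfl : B = B' := Subtype.ext ((hE.cod.2 _ (hE.cod.1 _ _ hf.2).1).unique hf.2 hf'.2)
  rfl

theorem arr_eq_arr {A B : E.Obj} {f g : A ⟶ B} : arr f = arr g ↔ f = g :=
  ⟨fun h => by cases arr_inj h; rfl, fun h => h ▸ rfl⟩

theorem exists_arr {f A B : M.V} (h : E.data.Hom f A B) :
    ∃ (A' B' : E.Obj) (f' : A' ⟶ B'), f'.1 = f ∧ A'.1 = A ∧ B'.1 = B :=
  ⟨⟨A, (E.cat.2.2.2.dom.1 _ _ h.1).2⟩, ⟨B, (E.cat.2.2.2.cod.1 _ _ h.2).2⟩, ⟨f, h⟩, rfl, rfl, rfl⟩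

/-- `x` is an object. -/
def IsObj (x : E.Elt) : Prop := ∃ A : E.Obj, x = obj A

/-- `x` is an arrow. -/
def IsArr (x : E.Elt) : Prop := ∃ (A B : E.Obj) (f : A ⟶ B), x = arr f

/-- The domain of `x` is `a`. -/
def IsDom (x a : E.Elt) : Prop := ∃ (A B : E.Obj) (f : A ⟶ B), x = arr f ∧ a = obj A

/-- The codomain of `x` is `b`. -/
def IsCod (x b : E.Elt) : Prop := ∃ (A B : E.Obj) (f : A ⟶ B), x = arr f ∧ b = obj B

/-- `z` is the composite `x ∘ y`. -/
def IsComp (x y z : E.Elt) : Prop :=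
  ∃ (A B C : E.Obj) (f : A ⟶ B) (g : B ⟶ C), x = arr g ∧ y = arr f ∧ z = arr (f ≫ g)

/-- `x : a → b`. -/
def IsHom (x a b : E.Elt) : Prop := IsDom x a ∧ IsCod x b

theorem isHom_iff {x a b : E.Elt} :
    IsHom x a b ↔ ∃ (A B : E.Obj) (f : A ⟶ B), x = arr f ∧ a = obj A ∧ b = obj B := by
  constructor
  · rintro ⟨⟨A, B, f, rfl, rfl⟩, ⟨A', B', f', h, rfl⟩⟩
    cases arr_inj h
    exact ⟨_, _, f, rfl, rfl, rfl⟩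
  · rintro ⟨A, B, f, rfl, rfl, rfl⟩
    exact ⟨⟨_, _, f, rfl, rfl⟩, ⟨_, _, f, rfl, rfl⟩⟩

theorem isHom_obj_iff {x : E.Elt} {A B : E.Obj} :
    IsHom x (obj A) (obj B) ↔ ∃ f : A ⟶ B, x = arr f := by
  rw [isHom_iff]
  constructor
  · rintro ⟨A, B, f, rfl, h, h'⟩
    obtain rfl := obj_inj.1 h
    obtain rfl := obj_inj.1 h'
    exact ⟨f, rfl⟩
  · rintro ⟨f, rfl⟩
    exact ⟨_, _, f, rfl, rfl, rfl⟩

theorem isHom_arr {A B : E.Obj} (f : A ⟶ B) : IsHom (arr f) (obj A) (obj B) :=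
  isHom_obj_iff.2 ⟨f, rfl⟩

theorem isComp_iff {B C : E.Obj} {g : B ⟶ C} {y z : E.Elt} :
    IsComp (arr g) y z ↔ ∃ (A : E.Obj) (f : A ⟶ B), y = arr f ∧ z = arr (f ≫ g) := by
  constructor
  · rintro ⟨A, B, C, f, g, h, rfl, rfl⟩
    cases arr_inj h
    exact ⟨A, f, rfl, rfl⟩
  · rintro ⟨A, f, rfl, rfl⟩
    exact ⟨_, _, _, f, g, rfl, rfl, rfl⟩

theorem isComp_arr_iff {A B C : E.Obj} {f : A ⟶ B} {g : B ⟶ C} {z : E.Elt} :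
    IsComp (arr g) (arr f) z ↔ z = arr (f ≫ g) := by
  rw [isComp_iff]
  constructor
  · rintro ⟨A, f, h, rfl⟩
    cases arr_inj h
    rfl
  · rintro rfl
    exact ⟨_, f, rfl, rfl⟩

theorem isComp_of_arr_iff {A B C : E.Obj} {h : A ⟶ C} {g : B ⟶ C} {y : E.Elt} :
    IsComp (arr g) y (arr h) ↔ ∃ f : A ⟶ B, y = arr f ∧ f ≫ g = h := by
  rw [isComp_iff]
  constructor
  · rintro ⟨A, f, rfl, h⟩
    cases arr_inj h
    exact ⟨f, rfl, rfl⟩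
  · rintro ⟨f, rfl, rfl⟩
    exact ⟨_, f, rfl, rfl⟩

end Struc.ClassCat

namespace ToposTheory

open FirstOrder FirstOrder.Language Struc.ClassCat

section

variable {M : Struc.{u}} {E : M.ClassCat} {n : ℕ} {v : Empty → E.Elt} {xs : Fin n → E.Elt}

theorem snoc_castAdd_succ {W : Type*} {k : ℕ} (ys : Fin (n + k) → W) (a : W) (x : Fin n) :
    Fin.snoc (α := fun _ => W) ys a (Fin.castAdd (k + 1) x) = ys (Fin.castAdd k x) :=
  Fin.snoc_castSucc (α := fun _ => W) a ys (Fin.castAdd k x)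

@[simp]
theorem realize_ob {x : Fin n} : (ob x).Realize v xs ↔ IsObj (xs x) := by
  exact BoundedFormula.realize_rel₁ (L := catLang) (R := CatRel.ob)

@[simp]
theorem realize_dom {x y : Fin n} : (dom x y).Realize v xs ↔ IsDom (xs x) (xs y) := by
  refine (BoundedFormula.realize_rel₂ (L := catLang) (R := CatRel.dom)).trans ?_
  change (∃ f A, xs x = _ ∧ xs y = _ ∧ _) ↔ _
  constructor
  · rintro ⟨f, A, hx, hy, h⟩
    obtain ⟨B, hB, -⟩ := E.cat.2.2.2.cod.2 _ f.2
    exact ⟨A, ⟨B, (E.cat.2.2.2.cod.1 _ _ hB).2⟩, ⟨f.1, h, hB⟩, hx, hy⟩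
  · rintro ⟨A, B, f, hx, hy⟩
    exact ⟨_, _, hx, hy, f.2.1⟩

@[simp]
theorem realize_cod {x y : Fin n} : (cod x y).Realize v xs ↔ IsCod (xs x) (xs y) := by
  refine (BoundedFormula.realize_rel₂ (L := catLang) (R := CatRel.cod)).trans ?_
  change (∃ f A, xs x = _ ∧ xs y = _ ∧ _) ↔ _
  constructor
  · rintro ⟨f, B, hx, hy, h⟩
    obtain ⟨A, hA, -⟩ := E.cat.2.2.2.dom.2 _ f.2
    exact ⟨⟨A, (E.cat.2.2.2.dom.1 _ _ hA).2⟩, B, ⟨f.1, hA, h⟩, hx, hy⟩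
  · rintro ⟨A, B, f, hx, hy⟩
    exact ⟨_, _, hx, hy, f.2.2⟩

@[simp]
theorem realize_ar {x : Fin n} : (ar x).Realize v xs ↔ IsArr (xs x) := by
  refine (BoundedFormula.realize_rel₁ (L := catLang) (R := CatRel.ar)).trans ?_
  change (∃ f, xs x = _) ↔ _
  constructor
  · rintro ⟨f, hx⟩
    obtain ⟨A, hA, -⟩ := E.cat.2.2.2.dom.2 _ f.2
    obtain ⟨B, hB, -⟩ := E.cat.2.2.2.cod.2 _ f.2
    exact ⟨⟨A, (E.cat.2.2.2.dom.1 _ _ hA).2⟩, ⟨B, (E.cat.2.2.2.cod.1 _ _ hB).2⟩,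
      ⟨f.1, hA, hB⟩, hx⟩
  · rintro ⟨A, B, f, hx⟩
    exact ⟨_, hx⟩

@[simp]
theorem realize_comp {x y z : Fin n} :
    (comp x y z).Realize v xs ↔ IsComp (xs x) (xs y) (xs z) := by
  refine (BoundedFormula.realize_rel (L := catLang) (R := CatRel.comp)).trans ?_
  change (∃ g f h, xs x = _ ∧ xs y = _ ∧ xs z = _ ∧ _) ↔ _
  constructor
  · rintro ⟨g, f, h, hx, hy, hz, H⟩
    obtain ⟨A, B, C, h1, h2, h3⟩ := E.cat.2.2.2.comp_hom _ _ _ H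
    have hA := (E.cat.2.2.2.dom.1 _ _ h1.1).2
    have hB := (E.cat.2.2.2.cod.1 _ _ h1.2).2
    have hC := (E.cat.2.2.2.cod.1 _ _ h2.2).2
    refine ⟨⟨A, hA⟩, ⟨B, hB⟩, ⟨C, hC⟩, ⟨f.1, h1⟩, ⟨g.1, h2⟩, hx, hy, ?_⟩
    have := E.cat.2.2.2.comp_eq (A := ⟨A, hA⟩) (B := ⟨B, hB⟩) (C := ⟨C, hC⟩) (f := ⟨f.1, h1⟩)
      (g := ⟨g.1, h2⟩) (k := ⟨h.1, h3⟩) H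
    rw [hz]
    exact congrArg arr this.symm
  · rintro ⟨A, B, C, f, g, hx, hy, hz⟩
    exact ⟨_, _, _, hx, hy, hz, E.cat.2.2.2.comp_comp f g⟩

@[simp]
theorem realize_eq {x y : Fin n} : (eq x y).Realize v xs ↔ xs x = xs y := by
  rw [eq, BoundedFormula.realize_bdEqual]
  rfl

@[simp]
theorem realize_hom {x y z : Fin n} :
    (hom x y z).Realize v xs ↔ IsHom (xs x) (xs y) (xs z) := by
  rw [hom, BoundedFormula.realize_inf, realize_dom, realize_cod, IsHom]

/-- Unique existence uses φ in contexts with one and with two extra variables. If its truth depends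
only on the outer values and on the distinguished variable, both uses express the same predicate Q.
-/
theorem realize_exUnique {φ : ∀ m : ℕ, Fin (n + m) → Fm (n + m)} {Q : E.Elt → Prop}
    (h : ∀ (m : ℕ) (ys : Fin (n + m) → E.Elt) (x : Fin (n + m)), (∀ i, ys (old m i) = xs i) →
      ((φ m x).Realize v ys ↔ Q (ys x))) : (exUnique φ).Realize v xs ↔ ∃! a, Q a := by
  rw [exUnique, BoundedFormula.realize_ex]
  refine exists_congr fun a => ?_
  rw [BoundedFormula.realize_inf, BoundedFormula.realize_all]
  refine and_congr ?_ (forall_congr' fun b => ?_)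
  · rw [h 1 _ _ fun i => snoc_castAdd_succ (k := 0) xs a i]
    exact iff_of_eq (congrArg Q (Fin.snoc_last (α := fun _ => E.Elt) a xs))
  · rw [BoundedFormula.realize_imp, realize_eq, h 2 _ _ fun i => (snoc_castAdd_succ (k := 1) _ b i).trans
      (snoc_castAdd_succ (k := 0) xs a i)]
    have h1 : Fin.snoc (α := fun _ => E.Elt) (Fin.snoc (α := fun _ => E.Elt) xs a) b (new 2 1) = b :=
      Fin.snoc_last (α := fun _ => E.Elt) b _
    have h2 : Fin.snoc (α := fun _ => E.Elt) (Fin.snoc (α := fun _ => E.Elt) xs a) b (new 2 0) = a :=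
      (Fin.snoc_castSucc (α := fun _ => E.Elt) b _ (Fin.last n)).trans
        (Fin.snoc_last (α := fun _ => E.Elt) a xs)
    exact iff_of_eq (congr (congrArg (fun x y => Q x → x = y) h1) h2)

end

end ToposTheory

end MTT

/-! ### Topos notions for elements of the first-order structure, and the meaning of the formulas -/

namespace MTT

open CategoryTheory Struc

namespace Struc.ClassCat

variable {M : Struc.{u}} {E : M.ClassCat}

/-- `T` is terminal. -/
def IsTerminalElt (T : E.Elt) : Prop := IsObj T ∧ ∀ X, IsObj X → ∃! f, IsHom f X T

/-- `f` is monic. -/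
def IsMonicElt (f : E.Elt) : Prop :=
  IsArr f ∧ ∀ g h k, IsComp f g k → IsComp f h k → g = h

/-- `p : P → A` and `q : P → B` are the projections of a product. -/
def IsProductElt (P p q A B : E.Elt) : Prop :=
  (IsHom p P A ∧ IsHom q P B) ∧
    ∀ X a b, IsHom a X A → IsHom b X B → ∃! u, IsComp p u a ∧ IsComp q u b

/-- The square with sides `p`, `f` and `q`, `g` is a pullback. -/
def IsPullbackElt (p q f g : E.Elt) : Prop :=
  (∃ k, IsComp f p k ∧ IsComp g q k) ∧
    ∀ a b k, IsComp f a k → IsComp g b k → ∃! u, IsComp p u a ∧ IsComp q u b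

/-- `h : Y → X` is a transpose of `g`. -/
def IsTransposeElt (Y X p q e r s g h : E.Elt) : Prop :=
  IsHom h Y X ∧ ∃ u k, ((IsComp h r k ∧ IsComp p u k) ∧ IsComp q u s) ∧ IsComp e u g

/-- `e : P → B` is an evaluation that makes `X` the exponential of `A` and `B`. -/
def IsExponentialElt (X P p q e A B : E.Elt) : Prop :=
  (IsProductElt P p q X A ∧ IsHom e P B) ∧ ∀ Y Q r s g, IsProductElt Q r s Y A → IsHom g Q B →
    ∃! h, IsTransposeElt Y X p q e r s g h

/-- `t : T → W` is a subobject classifier. -/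
def IsClassifierElt (T W t : E.Elt) : Prop :=
  (IsTerminalElt T ∧ IsHom t T W) ∧ ∀ U Z k, IsHom k U Z → IsMonicElt k →
    ∃! c, IsHom c Z W ∧ ∃ y, IsPullbackElt k y c t

end Struc.ClassCat

namespace ToposTheory

open FirstOrder FirstOrder.Language Struc.ClassCat

variable {M : Struc.{u}} {E : M.ClassCat} {n : ℕ} {v : Empty → E.Elt} {xs : Fin n → E.Elt}

/-! #### Values of variables -/

section

variable {W : Type*} (ys : Fin n → W) (a b c d e : W) (x : Fin n)

local notation "S" => Fin.snoc (α := fun _ => W)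

theorem snoc_natAdd {k : ℕ} (zs : Fin (n + k) → W) (i : Fin (k + 1)) :
    S zs a (Fin.natAdd n i) = if h : i.1 < k then zs (Fin.natAdd n ⟨i.1, h⟩) else a := by
  split_ifs with h
  · exact Fin.snoc_castSucc (α := fun _ => W) a zs (Fin.natAdd n ⟨i.1, h⟩)
  · obtain rfl : i = Fin.last k := Fin.ext (by have := i.2; simp; omega)
    exact Fin.snoc_last (α := fun _ => W) a zs

theorem snoc_one_old : S ys a (old 1 x) = ys x :=
  snoc_castAdd_succ (k := 0) _ a x

theorem snoc_one_new : S ys a (new 1 0) = a :=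
  snoc_natAdd (k := 0) a _ 0

theorem snoc_two_old : S (S ys a) b (old 2 x) = ys x :=
  (snoc_castAdd_succ (k := 1) _ b x).trans (snoc_one_old _ _ _)

theorem snoc_two_new_zero : S (S ys a) b (new 2 0) = a :=
  (snoc_natAdd (k := 1) b _ 0).trans (snoc_one_new _ _)

theorem snoc_two_new_one : S (S ys a) b (new 2 1) = b :=
  snoc_natAdd (k := 1) b _ 1

theorem snoc_three_old : S (S (S ys a) b) c (old 3 x) = ys x :=
  (snoc_castAdd_succ (k := 2) _ c x).trans (snoc_two_old _ _ _ _)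

theorem snoc_three_new_zero : S (S (S ys a) b) c (new 3 0) = a :=
  (snoc_natAdd (k := 2) c _ 0).trans (snoc_two_new_zero _ _ _)

theorem snoc_three_new_one : S (S (S ys a) b) c (new 3 1) = b :=
  (snoc_natAdd (k := 2) c _ 1).trans (snoc_two_new_one _ _ _)

theorem snoc_three_new_two : S (S (S ys a) b) c (new 3 2) = c :=
  snoc_natAdd (k := 2) c _ 2

theorem snoc_five_old : S (S (S (S (S ys a) b) c) d) e (old 5 x) = ys x :=
  (snoc_castAdd_succ (k := 4) _ e x).trans
    ((snoc_castAdd_succ (k := 3) _ d x).trans (snoc_three_old _ _ _ _ _))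

theorem snoc_five_new_zero : S (S (S (S (S ys a) b) c) d) e (new 5 0) = a :=
  (snoc_natAdd (k := 4) e _ 0).trans
    ((snoc_natAdd (k := 3) d _ 0).trans (snoc_three_new_zero _ _ _ _))

theorem snoc_five_new_one : S (S (S (S (S ys a) b) c) d) e (new 5 1) = b :=
  (snoc_natAdd (k := 4) e _ 1).trans
    ((snoc_natAdd (k := 3) d _ 1).trans (snoc_three_new_one _ _ _ _))

theorem snoc_five_new_two : S (S (S (S (S ys a) b) c) d) e (new 5 2) = c :=
  (snoc_natAdd (k := 4) e _ 2).trans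
    ((snoc_natAdd (k := 3) d _ 2).trans (snoc_three_new_two _ _ _ _))

theorem snoc_five_new_three : S (S (S (S (S ys a) b) c) d) e (new 5 3) = d :=
  (snoc_natAdd (k := 4) e _ 3).trans (snoc_natAdd (k := 3) d _ 3)

theorem snoc_five_new_four : S (S (S (S (S ys a) b) c) d) e (new 5 4) = e :=
  snoc_natAdd (k := 4) e _ 4

end

/-! #### Satisfaction of the formulas -/

open BoundedFormula

theorem realize_isTerminal {T : Fin n} :
    (isTerminal T).Realize v xs ↔ IsTerminalElt (xs T) := by
  rw [isTerminal, realize_inf, realize_all, realize_ob, IsTerminalElt]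
  refine and_congr_right fun _ => forall_congr' fun X => ?_
  rw [realize_imp, realize_ob, realize_exUnique (Q := fun f => IsHom f X (xs T)), snoc_one_new]
  intro m ys x hys
  rw [realize_hom, hys, hys, snoc_one_new, snoc_one_old]

theorem realize_isMonic {f : Fin n} : (isMonic f).Realize v xs ↔ IsMonicElt (xs f) := by
  simp only [isMonic, IsMonicElt, realize_inf, realize_all, realize_imp, realize_comp, realize_ar,
    realize_eq, snoc_three_old, snoc_three_new_zero, snoc_three_new_one, snoc_three_new_two]

theorem realize_isProduct {P p q A B : Fin n} : (isProduct P p q A B).Realize v xs ↔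
    IsProductElt (xs P) (xs p) (xs q) (xs A) (xs B) := by
  simp only [isProduct, IsProductElt, realize_inf, realize_all, realize_imp, realize_hom]
  refine and_congr_right fun _ => forall_congr' fun X => forall_congr' fun a =>
    forall_congr' fun b => ?_
  rw [realize_exUnique (Q := fun u => IsComp (xs p) u a ∧ IsComp (xs q) u b)]
  · simp only [snoc_three_old, snoc_three_new_zero, snoc_three_new_one, snoc_three_new_two]
  · intro m ys x hys
    simp only [realize_inf, realize_comp, hys, snoc_three_old, snoc_three_new_one,
      snoc_three_new_two]

theorem realize_isPullback {p q f g : Fin n} : (isPullback p q f g).Realize v xs ↔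
    IsPullbackElt (xs p) (xs q) (xs f) (xs g) := by
  simp only [isPullback, IsPullbackElt, realize_inf, realize_all, realize_imp, realize_comp,
    realize_ex, snoc_one_old, snoc_one_new]
  refine and_congr_right fun _ => forall_congr' fun a => forall_congr' fun b =>
    forall_congr' fun k => ?_
  rw [realize_exUnique (Q := fun u => IsComp (xs p) u a ∧ IsComp (xs q) u b)]
  · simp only [snoc_three_old, snoc_three_new_zero, snoc_three_new_one, snoc_three_new_two]
  · intro m ys x hys
    simp only [realize_inf, realize_comp, hys, snoc_three_old, snoc_three_new_zero,
      snoc_three_new_one]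

theorem realize_isTranspose {Y X p q e r s g h : Fin n} :
    (isTranspose Y X p q e r s g h).Realize v xs ↔ IsTransposeElt (xs Y) (xs X) (xs p) (xs q)
      (xs e) (xs r) (xs s) (xs g) (xs h) := by
  simp only [isTranspose, IsTransposeElt, realize_inf, realize_ex, realize_comp, realize_hom,
    snoc_two_old, snoc_two_new_zero, snoc_two_new_one]

theorem realize_isExponential {X P p q e A B : Fin n} :
    (isExponential X P p q e A B).Realize v xs ↔
      IsExponentialElt (xs X) (xs P) (xs p) (xs q) (xs e) (xs A) (xs B) := by
  simp only [isExponential, IsExponentialElt, realize_inf, realize_all, realize_imp, realize_hom,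
    realize_isProduct]
  refine and_congr_right fun _ => forall_congr' fun Y => forall_congr' fun Q =>
    forall_congr' fun r => forall_congr' fun s => forall_congr' fun g => ?_
  rw [realize_exUnique
    (Q := fun h => IsTransposeElt Y (xs X) (xs p) (xs q) (xs e) r s g h)]
  · simp only [snoc_five_old, snoc_five_new_zero, snoc_five_new_one, snoc_five_new_two,
      snoc_five_new_three, snoc_five_new_four]
  · intro m ys x hys
    simp only [realize_isTranspose, hys, snoc_five_old, snoc_five_new_zero, snoc_five_new_two,
      snoc_five_new_three, snoc_five_new_four]

theorem realize_isClassifier {T W t : Fin n} : (isClassifier T W t).Realize v xs ↔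
    IsClassifierElt (xs T) (xs W) (xs t) := by
  simp only [isClassifier, IsClassifierElt, realize_inf, realize_all, realize_imp, realize_hom,
    realize_isTerminal, realize_isMonic]
  refine and_congr_right fun _ => forall_congr' fun U => forall_congr' fun Z =>
    forall_congr' fun k => ?_
  rw [realize_exUnique (Q := fun c => IsHom c Z (xs W) ∧ ∃ y, IsPullbackElt k y c (xs t))]
  · simp only [snoc_three_new_zero, snoc_three_new_one, snoc_three_new_two]
  · intro m ys x hys
    simp only [realize_inf, realize_hom, realize_ex, realize_isPullback, hys, snoc_one_old,
      snoc_one_new, snoc_three_old, snoc_three_new_one, snoc_three_new_two]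

theorem realize_isId {i A : Fin n} : (isId i A).Realize v xs ↔ IsHom (xs i) (xs A) (xs A) ∧
    ∀ f, (IsDom f (xs A) → IsComp f (xs i) f) ∧ (IsCod f (xs A) → IsComp (xs i) f f) := by
  simp only [isId, realize_inf, realize_all, realize_imp, realize_comp, realize_hom, realize_dom,
    realize_cod, snoc_one_old, snoc_one_new]

end ToposTheory

end MTT

/-! ### Verification of the elementary topos axioms -/

namespace MTT

open CategoryTheory Limits Struc

/-- The universal property of an exponential, for any choice of products. -/
theorem existsUnique_transpose_of_product {C : Type u₁} [Category.{v₁} C] [HasBinaryProducts C]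
    {A B X : C} {ev : A ⨯ X ⟶ B}
    (h : ∀ (Y : C) (g : A ⨯ Y ⟶ B), ∃! k : Y ⟶ X, prod.map (𝟙 A) k ≫ ev = g) {Y Q : C}
    {r : Q ⟶ Y} {s : Q ⟶ A}
    (hQ : ∀ (Z : C) (a : Z ⟶ Y) (b : Z ⟶ A), ∃! f : Z ⟶ Q, f ≫ r = a ∧ f ≫ s = b) (g : Q ⟶ B) :
    ∃! k : Y ⟶ X, ∃ u : Q ⟶ A ⨯ X, u ≫ prod.snd = r ≫ k ∧ u ≫ prod.fst = s ∧ u ≫ ev = g := by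
  -- The comparison of the chosen product with Q, which carries the given universal property over to
  -- Q.
  obtain ⟨i, ⟨hi1, hi2⟩, -⟩ := hQ (A ⨯ Y) prod.snd prod.fst
  have e1 : prod.lift s r ≫ i = 𝟙 Q :=
    (hQ Q r s).unique ⟨by simp [hi1, prod.lift_snd], by simp [hi2, prod.lift_fst]⟩
      ⟨by simp, by simp⟩
  have e : ∀ k : Y ⟶ X, (∃ u : Q ⟶ A ⨯ X, u ≫ prod.snd = r ≫ k ∧ u ≫ prod.fst = s ∧
      u ≫ ev = g) ↔ prod.map (𝟙 A) k ≫ ev = i ≫ g := by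
    intro k
    constructor
    · rintro ⟨u, h1, h2, rfl⟩
      have : prod.map (𝟙 A) k = i ≫ u := by ext <;> simp [h1, h2, reassoc_of% hi1, hi2]
      rw [this, Category.assoc]
    · intro hk
      refine ⟨prod.lift s (r ≫ k), prod.lift_snd _ _, prod.lift_fst _ _, ?_⟩
      have : prod.lift s (r ≫ k) = prod.lift s r ≫ prod.map (𝟙 A) k := by ext <;> simp
      rw [this, Category.assoc, hk, reassoc_of% e1]
  simp only [e]
  exact h Y (i ≫ g)

namespace Struc.ClassCat

variable {M : Struc.{u}} {E : M.ClassCat}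

/-- First-order unique existence ranges over all objects and arrows; when the condition forces an
arrow A → B, it is unique existence in that hom-set. -/
theorem existsUnique_arr {A B : E.Obj} {Q : E.Elt → Prop} {R : (A ⟶ B) → Prop}
    (h : ∀ x, Q x ↔ ∃ f, x = arr f ∧ R f) : (∃! x, Q x) ↔ ∃! f, R f := by
  constructor
  · rintro ⟨x, hx, hx'⟩
    obtain ⟨f, rfl, hf⟩ := (h x).1 hx
    exact ⟨f, hf, fun g hg => arr_eq_arr.1 (hx' _ ((h _).2 ⟨g, rfl, hg⟩))⟩
  · rintro ⟨f, hf, hf'⟩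
    refine ⟨arr f, (h _).2 ⟨f, rfl, hf⟩, fun x hx => ?_⟩
    obtain ⟨g, rfl, hg⟩ := (h x).1 hx
    rw [hf' g hg]

theorem isComp_and_iff {X P A B : E.Obj} {p : P ⟶ A} {q : P ⟶ B} {a : X ⟶ A} {b : X ⟶ B}
    {x : E.Elt} : IsComp (arr p) x (arr a) ∧ IsComp (arr q) x (arr b) ↔
      ∃ f : X ⟶ P, x = arr f ∧ f ≫ p = a ∧ f ≫ q = b := by
  rw [isComp_of_arr_iff, isComp_of_arr_iff]
  constructor
  · rintro ⟨⟨f, rfl, h⟩, ⟨g, e, h'⟩⟩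
    obtain rfl := arr_eq_arr.1 e
    exact ⟨f, rfl, h, h'⟩
  · rintro ⟨f, rfl, h, h'⟩
    exact ⟨⟨f, rfl, h⟩, ⟨f, rfl, h'⟩⟩

theorem isTerminalElt_obj {T : E.Obj} (hT : IsTerminal T) : IsTerminalElt (obj T) := by
  refine ⟨⟨T, rfl⟩, ?_⟩
  rintro _ ⟨X, rfl⟩
  refine (existsUnique_arr (R := fun _ => True) fun x => ?_).2
    ⟨hT.from X, trivial, fun f _ => hT.hom_ext _ _⟩
  rw [isHom_obj_iff]
  simp

theorem mono_of_isMonicElt {A B : E.Obj} {f : A ⟶ B} (h : IsMonicElt (arr f)) : Mono f :=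
  ⟨fun _ _ e => arr_eq_arr.1 (h.2 _ _ _ (isComp_arr_iff.2 rfl)
    (isComp_arr_iff.2 (congrArg arr e)))⟩

theorem isProductElt_iff {P A B : E.Obj} {p : P ⟶ A} {q : P ⟶ B} :
    IsProductElt (obj P) (arr p) (arr q) (obj A) (obj B) ↔
      ∀ (X : E.Obj) (a : X ⟶ A) (b : X ⟶ B), ∃! f : X ⟶ P, f ≫ p = a ∧ f ≫ q = b := by
  constructor
  · intro h X a b
    exact (existsUnique_arr fun _ => isComp_and_iff).1 (h.2 _ _ _ (isHom_arr a) (isHom_arr b))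
  · refine fun h => ⟨⟨isHom_arr p, isHom_arr q⟩, fun X a b ha hb => ?_⟩
    obtain ⟨X, A, a, rfl, rfl, e⟩ := isHom_iff.1 ha
    obtain rfl := obj_inj.1 e
    obtain ⟨b, rfl⟩ := isHom_obj_iff.1 hb
    exact (existsUnique_arr fun _ => isComp_and_iff).2 (h _ a b)

theorem isPullbackElt_iff {P X Y Z : E.Obj} {p : P ⟶ X} {q : P ⟶ Y} {f : X ⟶ Z} {g : Y ⟶ Z} :
    IsPullbackElt (arr p) (arr q) (arr f) (arr g) ↔ IsPullback p q f g := by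
  constructor
  · rintro ⟨⟨k, h1, h2⟩, h⟩
    have hw : p ≫ f = q ≫ g :=
      arr_eq_arr.1 ((isComp_arr_iff.1 h1).symm.trans (isComp_arr_iff.1 h2))
    have H : ∀ (W : E.Obj) (a : W ⟶ X) (b : W ⟶ Y), a ≫ f = b ≫ g →
        ∃! l : W ⟶ P, l ≫ p = a ∧ l ≫ q = b := fun W a b e =>
      (existsUnique_arr fun _ => isComp_and_iff).1
        (h _ _ _ (isComp_arr_iff.2 rfl) (isComp_arr_iff.2 (congrArg arr e)))
    refine ⟨⟨hw⟩, ⟨PullbackCone.IsLimit.mk _ (fun s => (H _ _ _ s.condition).choose)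
      (fun s => (H _ _ _ s.condition).choose_spec.1.1)
      (fun s => (H _ _ _ s.condition).choose_spec.1.2)
      (fun s m hm hm' => (H _ _ _ s.condition).choose_spec.2 m ⟨hm, hm'⟩)⟩⟩
  · refine fun h => ⟨⟨_, isComp_arr_iff.2 rfl, isComp_arr_iff.2 (congrArg arr h.w)⟩,
      fun a b k ha hb => ?_⟩
    obtain ⟨W, a, rfl, rfl⟩ := isComp_iff.1 ha
    obtain ⟨b, rfl, e⟩ := isComp_of_arr_iff.1 hb
    refine (existsUnique_arr fun _ => isComp_and_iff).2 ⟨h.lift a b e.symm,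
      ⟨h.lift_fst _ _ _, h.lift_snd _ _ _⟩, fun l hl => h.hom_ext ?_ ?_⟩
    · rw [hl.1, h.lift_fst]
    · rw [hl.2, h.lift_snd]

theorem isTransposeElt_iff {X Y P Q A B : E.Obj} {p : P ⟶ X} {q : P ⟶ A} {e : P ⟶ B} {r : Q ⟶ Y}
    {s : Q ⟶ A} {g : Q ⟶ B} {x : E.Elt} :
    IsTransposeElt (obj Y) (obj X) (arr p) (arr q) (arr e) (arr r) (arr s) (arr g) x ↔
      ∃ h : Y ⟶ X, x = arr h ∧ ∃ u : Q ⟶ P, u ≫ p = r ≫ h ∧ u ≫ q = s ∧ u ≫ e = g := by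
  rw [IsTransposeElt, isHom_obj_iff]
  constructor
  · rintro ⟨⟨h, rfl⟩, u, k, ⟨⟨h1, h2⟩, h3⟩, h4⟩
    obtain rfl := isComp_arr_iff.1 h1
    obtain ⟨u, rfl, h5⟩ := isComp_of_arr_iff.1 h2
    exact ⟨h, rfl, u, h5, arr_eq_arr.1 (isComp_arr_iff.1 h3).symm,
      arr_eq_arr.1 (isComp_arr_iff.1 h4).symm⟩
  · rintro ⟨h, rfl, u, h1, rfl, rfl⟩
    exact ⟨⟨h, rfl⟩, arr u, arr (r ≫ h), ⟨⟨isComp_arr_iff.2 rfl,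
      isComp_arr_iff.2 (congrArg arr h1.symm)⟩, isComp_arr_iff.2 rfl⟩, isComp_arr_iff.2 rfl⟩

theorem exists_isExponentialElt [HasBinaryProducts E.Obj] (A B : E.Obj)
    (hA : (prod.functor.obj A).IsLeftAdjoint) :
    ∃ X P p q e, IsExponentialElt (E := E) X P p q e (obj A) (obj B) := by
  obtain ⟨X, ev, h⟩ := exists_exponential_of_isLeftAdjoint A hA B
  -- The formula lists the projection to the exponential first, whereas the chosen product has A
  -- first, so the two projections are exchanged.
  refine ⟨obj X, obj (A ⨯ X), arr prod.snd, arr prod.fst, arr ev,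
    ⟨isProductElt_iff.2 fun Z a b => ⟨prod.lift b a, ⟨prod.lift_snd _ _, prod.lift_fst _ _⟩,
      fun f hf => ?_⟩, isHom_arr _⟩, ?_⟩
  · exact prod.hom_ext (hf.2.trans (prod.lift_fst _ _).symm) (hf.1.trans (prod.lift_snd _ _).symm)
  · intro Y Q r s g hQ hg
    obtain ⟨Q, Y, r, rfl, rfl, rfl⟩ := isHom_iff.1 hQ.1.1
    obtain ⟨s, rfl⟩ := isHom_obj_iff.1 hQ.1.2
    obtain ⟨g, rfl⟩ := isHom_obj_iff.1 hg
    exact (existsUnique_arr fun _ => isTransposeElt_iff).2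
      (existsUnique_transpose_of_product h (isProductElt_iff.1 hQ) g)

theorem isClassifierElt (c : Subobject.Classifier E.Obj) :
    IsClassifierElt (obj c.Ω₀) (obj c.Ω) (arr c.truth) := by
  refine ⟨⟨isTerminalElt_obj c.isTerminalΩ₀, isHom_arr _⟩, fun U Z k hk hm => ?_⟩
  obtain ⟨U, Z, k, rfl, rfl, rfl⟩ := isHom_iff.1 hk
  have := mono_of_isMonicElt hm
  refine (existsUnique_arr (R := fun x : Z ⟶ c.Ω => ∃ y, IsPullback k y x c.truth)
    fun x => ?_).2 ⟨c.χ k, ⟨_, c.isPullback k⟩, fun x ⟨y, hy⟩ => c.uniq k hy⟩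
  rw [isHom_obj_iff]
  constructor
  · rintro ⟨⟨x, rfl⟩, y, hy⟩
    -- Commutativity of the square shows that the element y is an arrow from U to Ω₀.
    obtain ⟨⟨l, h1, h2⟩, -⟩ := id hy
    obtain rfl := isComp_arr_iff.1 h1
    obtain ⟨y, rfl, -⟩ := isComp_of_arr_iff.1 h2
    exact ⟨x, rfl, y, isPullbackElt_iff.1 hy⟩
  · rintro ⟨x, rfl, y, hy⟩
    exact ⟨⟨x, rfl⟩, arr y, isPullbackElt_iff.2 hy⟩

end Struc.ClassCat

namespace ToposTheory

open FirstOrder FirstOrder.Language Struc.ClassCat BoundedFormula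

variable {M : Struc.{u}} (E : M.ClassCat)

theorem model_categoryAxioms : Theory.Model E.Elt categoryAxioms := by
  refine ⟨fun φ hφ => ?_⟩
  simp only [categoryAxioms, Set.mem_insert_iff, Set.mem_singleton_iff] at hφ
  rcases hφ with rfl | rfl | rfl | rfl | rfl | rfl | rfl | rfl | rfl | rfl <;>
    simp only [Sentence.Realize, Formula.Realize, realize_all, realize_imp, realize_sup,
      realize_inf, realize_not, realize_ex, realize_ob, realize_ar, realize_dom, realize_cod,
      realize_comp, realize_hom, realize_isId]
  · intro x
    -- The values of the numbered variables are computed by unfolding; each later `change` in these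
    -- verifications does the same.
    change IsObj x ∨ IsArr x
    rcases x with A | ⟨f, hf⟩
    · exact .inl ⟨A, rfl⟩
    · obtain ⟨A, hA, -⟩ := E.cat.2.2.2.dom.2 _ hf
      obtain ⟨B, hB, -⟩ := E.cat.2.2.2.cod.2 _ hf
      obtain ⟨A, B, f, rfl, -, -⟩ := exists_arr ⟨hA, hB⟩
      exact .inr ⟨A, B, f, rfl⟩
  · intro x
    change ¬ (IsObj x ∧ IsArr x)
    rintro ⟨⟨A, rfl⟩, ⟨B, C, f, h⟩⟩
    exact obj_ne_arr h
  · intro f A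
    change IsDom f A → IsArr f ∧ IsObj A
    rintro ⟨A, B, f, rfl, rfl⟩
    exact ⟨⟨A, B, f, rfl⟩, ⟨A, rfl⟩⟩
  · intro f A
    change IsCod f A → IsArr f ∧ IsObj A
    rintro ⟨A, B, f, rfl, rfl⟩
    exact ⟨⟨A, B, f, rfl⟩, ⟨B, rfl⟩⟩
  · intro f
    rw [realize_exUnique (Q := fun A => IsDom f A)]
    · change IsArr f → _
      rintro ⟨A, B, f, rfl⟩
      refine ⟨obj A, ⟨A, B, f, rfl, rfl⟩, ?_⟩
      rintro _ ⟨A', B', f', h, rfl⟩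
      cases arr_inj h
      rfl
    · intro m ys x h
      rw [realize_dom, h]
      rfl
  · intro f
    rw [realize_exUnique (Q := fun A => IsCod f A)]
    · change IsArr f → _
      rintro ⟨A, B, f, rfl⟩
      refine ⟨obj B, ⟨A, B, f, rfl, rfl⟩, ?_⟩
      rintro _ ⟨A', B', f', h, rfl⟩
      cases arr_inj h
      rfl
    · intro m ys x h
      rw [realize_cod, h]
      rfl
  · intro g f h
    change IsComp g f h → ∃ A B C, (IsHom f A B ∧ IsHom g B C) ∧ IsHom h A C
    rintro ⟨A, B, C, f, g, rfl, rfl, rfl⟩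
    exact ⟨_, _, _, ⟨isHom_arr f, isHom_arr g⟩, isHom_arr _⟩
  · intro f g A B C
    rw [realize_exUnique (Q := fun h => IsComp g f h)]
    · change IsHom f A B → IsHom g B C → _
      intro hf hg
      obtain ⟨A, B, f, rfl, rfl, rfl⟩ := isHom_iff.1 hf
      obtain ⟨B, C, g, rfl, e, rfl⟩ := isHom_iff.1 hg
      obtain rfl := obj_inj.1 e
      exact ⟨_, isComp_arr_iff.2 rfl, fun _ h => isComp_arr_iff.1 h⟩
    · intro m ys x h
      rw [realize_comp, h, h]
      rfl
  · intro f g h p q r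
    change IsComp g f p → IsComp h g q → IsComp h p r → IsComp q f r
    rintro hp ⟨B, C, D, g, h, rfl, rfl, rfl⟩ hr
    obtain ⟨A, f, rfl, rfl⟩ := isComp_iff.1 hp
    obtain rfl := isComp_arr_iff.1 hr
    exact isComp_arr_iff.2 (congrArg arr (Category.assoc f g h))
  · intro A
    change IsObj A → ∃ i, IsHom i A A ∧ ∀ f, (IsDom f A → IsComp f i f) ∧ (IsCod f A → IsComp i f f)
    rintro ⟨A, rfl⟩
    refine ⟨arr (𝟙 A), isHom_arr _, fun f => ⟨?_, ?_⟩⟩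
    · rintro ⟨A, B, f, rfl, e⟩
      obtain rfl := obj_inj.1 e
      exact isComp_arr_iff.2 (by rw [Category.id_comp])
    · rintro ⟨A, B, f, rfl, e⟩
      obtain rfl := obj_inj.1 e
      exact isComp_arr_iff.2 (by rw [Category.comp_id])

theorem model_structureAxioms (hE : IsElementaryTopos E.Obj) :
    Theory.Model E.Elt structureAxioms := by
  obtain ⟨hlim, hexp, ⟨⟨c⟩⟩⟩ := hE
  refine ⟨fun φ hφ => ?_⟩
  simp only [structureAxioms, Set.mem_insert_iff, Set.mem_singleton_iff] at hφ
  rcases hφ with rfl | rfl | rfl | rfl <;>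
    simp only [Sentence.Realize, Formula.Realize, realize_all, realize_imp, realize_ex, realize_ob,
      realize_hom, realize_isTerminal, realize_isPullback, realize_isExponential,
      realize_isClassifier]
  · exact ⟨obj (⊤_ E.Obj), isTerminalElt_obj terminalIsTerminal⟩
  · intro f g A B C
    change IsHom f A C → IsHom g B C → ∃ p q, IsPullbackElt p q f g
    intro hf hg
    obtain ⟨A, C, f, rfl, rfl, rfl⟩ := isHom_iff.1 hf
    obtain ⟨B, C, g, rfl, rfl, e⟩ := isHom_iff.1 hg
    obtain rfl := obj_inj.1 e
    exact ⟨_, _, isPullbackElt_iff.2 (IsPullback.of_hasPullback f g)⟩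
  · intro A B
    change IsObj A → IsObj B → ∃ X P p q e, IsExponentialElt X P p q e A B
    rintro ⟨A, rfl⟩ ⟨B, rfl⟩
    exact exists_isExponentialElt A B (hexp A)
  · exact ⟨_, _, _, isClassifierElt c⟩

end ToposTheory

end MTT

/-! ### The main theorem -/

theorem mainTheorem5 (M : MTT.Struc.{u}) (hM : M.IsModel) (E : M.ClassCat)
    (hE : E.IsGrothendieckTopos) :
    MTT.IsElementaryTopos E.Obj ∧
    FirstOrder.Language.Theory.Model E.Elt MTT.ToposTheory.elementaryTopos ∧
    ∀ φ : MTT.catLang.Sentence,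
      FirstOrder.Language.Theory.ModelsBoundedFormula MTT.ToposTheory.elementaryTopos φ →
        FirstOrder.Language.Sentence.Realize E.Elt φ := by
  have : Fact M.IsModel := ⟨hM⟩
  have h := hE.isElementaryTopos
  have h1 := MTT.ToposTheory.model_categoryAxioms E
  have h2 := MTT.ToposTheory.model_structureAxioms E h
  have h3 : FirstOrder.Language.Theory.Model E.Elt MTT.ToposTheory.elementaryTopos := h1.union h2
  obtain ⟨hlim, -⟩ := id h
  -- Semantic consequence ranges over nonempty structures; the terminal object witnesses that this
  -- one is nonempty.
  have : Nonempty E.Elt := ⟨MTT.Struc.ClassCat.obj (CategoryTheory.Limits.terminal E.Obj)⟩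
  exact ⟨h, h3, fun φ hφ => hφ.realize_sentence E.Elt⟩
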